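/- Let $X$ be a complex manifold of dimension $m$, $E\to X$ a holomorphic vector bundle of rank $r\ge 1$, and $d\ge 1$ an integer; let $R$ be the rank of $\mathrm{Sym}^dE$. Notation. For a Kähler form $\omega=i\sum g_{j\bar k}\,dz_j\wedge d\bar z_k$, $\Lambda_\omega$ is the contraction with $m\,\alpha\wedge\omega^{m-1}=(\Lambda_\omega\alpha)\,\omega^m$ for $(1,1)$-forms $\alpha$, and $\Lambda^2_\omega$ is normalized by $m(m-1)\,\beta\wedge\omega^{m-2}=(\Lambda^2_\omega\beta)\,\omega^m$ for $(2,2)$-forms $\beta$. $S(\omega)=2\Lambda_\omega\mathrm{Ric}(\omega)$ is the (Riemannian) scalar curvature. $\mathcal D f=\bar\partial(\nabla^{1,0}f)\in\Omega^{0,1}(T^{1,0}X)$ with $\nabla^{1,0}f=\sum g^{j\bar l}\,\partial_{\bar l}f\,\partial_j$, $\mathcal D^*$ is its formal adjoint for the pointwise norms defined by $g_{j\bar k}$ and the volume form $\omega^m/m!$, and $\mathcal D^*\mathcal D$ is the Lichnerowicz operator. For a Hermitian metric $h$ on $E$, $\mathrm{Sym}^dh$ is the metric on $\mathrm{Sym}^dE$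 with $\langle v_1\cdots v_d,w_1\cdots w_d\rangle=\frac1{d!}\sum_{\sigma}\prod_i\langle v_i,w_{\sigma(i)}\rangle_h$, $F_h$ and $F_{\mathrm{Sym}^dh}$ are the curvatures of the Chern connections, and $S^dA(v_1\cdots v_d)=\sum_i v_1\cdots Av_i\cdots v_d$. The map $T=T_h$ on $\mathrm{End}(\mathrm{Sym}^dE)$ is defined fibrewise by $$\langle s,(T\Phi)t\rangle_{\mathrm{Sym}^dh}=C_{r,d}^{-1}\int_{\mathbb PE_x^*}\bigl(F(\Phi)+\tilde\Delta F(\Phi)\bigr)\langle\hat s,\hat t\rangle_g\,\frac{\omega_g^{r-1}}{(r-1)!},$$ where $g$ is the metric on $\mathcal O_{\mathbb PE_x^*}(d)$ with $\langle\hat s,\hat t\rangle_g([v])=v^{\otimes d}(s)\overline{v^{\otimes d}(t)}/|v\cdots v|^2_{\mathrm{Sym}^dh}$, $\omega_g=i\bar\partial\partial\log g$, $F(\Phi)([v])=\mathrm{tr}(\lambda\Phi)$ with $\lambda$ the $\mathrm{Sym}^dh$-orthogonal projection onto the line spanned by the vector representing $v^{\otimes d}$, $\tilde\Delta F=(r-1)\,i\bar\partial\partial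 F\wedge\omega_g^{r-2}/\omega_g^{r-1}$, and $C_{r,d}=d^{\,r-1}\int_{\mathbb C^{r-1}}(1+|\xi|^2)^{-r-d}\prod_j i\,d\xi_j\wedge d\bar\xi_j$ (so that $T(I)=I$). For a section $\Phi$ of $\mathrm{End}(\mathrm{Sym}^dE)$ put $$A_1(h,\omega,\Phi)=\frac{ir}{2\pi(r+d)}\Bigl(\Lambda_\omega F_{\mathrm{Sym}^dh}-\frac1R\mathrm{tr}(\Lambda_\omega F_{\mathrm{Sym}^dh})\,I\Bigr)+\frac12S(\omega)\,I+\Phi-T_h\Phi .$$ Statement. Let $\omega_\infty$ be a Kähler form on $X$ with constant scalar curvature and let $h_{HE}$ be a Hermitian–Einstein metric on $E$, i.e. $\Lambda_{\omega_\infty}F_{h_{HE}}=\mu I_E$ for a constant $\mu$. Let $\varphi$ be a smooth section of $\mathrm{End}(E)$ that is Hermitian with respect to $h_{HE}$, $\eta$ a smooth real function on $X$ and $\Phi$ a section of $\mathrm{End}(\mathrm{Sym}^dE)$. Then, at every point of $X$, $$\begin{aligned}A_{1,1}(\varphi,\eta,\Phi):={}&\frac{d}{dt}\Big|_{t=0}A_1\bigl(h_{HE}(I_E+t\varphi),\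 \omega_\infty+it\bar\partial\partial\eta,\ I+t\Phi\bigr)\\={}&\mathcal D^*\mathcal D\eta\; I+\frac{ir}{2\pi(r+d)}\Bigl(B-\frac1R\mathrm{tr}(B)\,I\Bigr)+\Phi-T_{h_{HE}}\Phi,\end{aligned}$$ $$B=S^d\Lambda_{\omega_\infty}\bar\partial\partial\varphi+\Lambda^2_{\omega_\infty}\bigl(F_{\mathrm{Sym}^dh_{HE}}\wedge i\bar\partial\partial\eta\bigr),$$ where $\mathcal D^*\mathcal D$ is taken with respect to $\omega_\infty$ and $\bar\partial\partial\varphi$ is formed with the Chern connection of $h_{HE}$; in particular the derivative exists. -/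

import Mathlib

open scoped Manifold ContDiff Bundle TensorProduct ComplexConjugate

noncomputable section

namespace SymBalanced

/-! ### Symmetric powers `Sym^d V = V^{⊗ d} / ∼` -/

section SymPower

variable {V V' N : Type*} [AddCommGroup V] [Module ℂ V] [AddCommGroup V'] [Module ℂ V']
  [AddCommGroup N] [Module ℂ N] {d : ℕ}

/-- The `d`-th symmetric power of `V`. -/
abbrev SymP (d : ℕ) (V : Type*) [AddCommGroup V] [Module ℂ V] : Type _ :=
  SymmetricPower ℂ (Fin d) V

/-- The product `v₁ ⋯ v_d` in `Sym^d V`. -/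
abbrev sprod (v : Fin d → V) : SymP d V := SymmetricPower.tprod ℂ v

/-- The linear map on `Sym^d V` induced by a symmetric multilinear map. -/
def symLift (f : MultilinearMap ℂ (fun _ : Fin d => V) N)
    (hf : ∀ (e : Equiv.Perm (Fin d)) (v : Fin d → V), f (fun i => v (e i)) = f v) :
    SymP d V →ₗ[ℂ] N where
  toFun := AddCon.lift (addConGen (SymmetricPower.Rel ℂ (Fin d) V))
    (PiTensorProduct.lift f).toAddMonoidHom (by
      rw [AddCon.addConGen_le]
      rintro _ _ ⟨e, v⟩
      simp [AddCon.ker_rel, hf e v])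
  map_add' := map_add _
  map_smul' c x := by
    refine AddCon.induction_on x fun y => ?_
    exact (PiTensorProduct.lift f).map_smul c y

theorem symLift_sprod (f : MultilinearMap ℂ (fun _ : Fin d => V) N)
    (hf : ∀ (e : Equiv.Perm (Fin d)) (v : Fin d → V), f (fun i => v (e i)) = f v)
    (v : Fin d → V) : symLift f hf (sprod v) = f v :=
  PiTensorProduct.lift.tprod (φ := f) v

theorem symP_ext {f g : SymP d V →ₗ[ℂ] N} (h : ∀ v, f (sprod v) = g (sprod v)) : f = g :=
  LinearMap.ext_on_range (SymmetricPower.span_tprod_eq_top ℂ (Fin d) V) h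

instance [Module.Finite ℂ V] : Module.Finite ℂ (SymP d V) :=
  Module.Finite.of_surjective (SymmetricPower.mk ℂ (Fin d) V) AddCon.mk'_surjective

/-- `Sym^d A : v₁ ⋯ v_d ↦ A v₁ ⋯ A v_d`. -/
def symMap (d : ℕ) (A : V →ₗ[ℂ] V') : SymP d V →ₗ[ℂ] SymP d V' :=
  symLift ((SymmetricPower.tprod ℂ).compLinearMap fun _ => A) fun e v =>
    SymmetricPower.tprod_equiv e fun i => A (v i)

theorem symMap_sprod (A : V →ₗ[ℂ] V') (v : Fin d → V) :
    symMap d A (sprod v) = sprod fun i => A (v i) :=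
  symLift_sprod _ _ _

/-- `S^d A : v₁ ⋯ v_d ↦ ∑ᵢ v₁ ⋯ (A vᵢ) ⋯ v_d`. -/
def symDer (d : ℕ) (A : Module.End ℂ V) : Module.End ℂ (SymP d V) :=
  symLift
    (∑ i : Fin d, (SymmetricPower.tprod ℂ).compLinearMap
      fun j => if j = i then A else LinearMap.id) fun e v => by
    simp only [sum_apply, MultilinearMap.compLinearMap_apply]
    refine Fintype.sum_equiv e _ _ fun i => ?_
    rw [← SymmetricPower.tprod_equiv e (fun j => (if j = e i then A else LinearMap.id) (v j))]
    simp only [e.injective.eq_iff]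

theorem symDer_sprod (A : Module.End ℂ V) (v : Fin d → V) :
    symDer d A (sprod v) = ∑ i, sprod (Function.update v i (A (v i))) := by
  refine (symLift_sprod _ _ _).trans ?_
  simp only [sum_apply, MultilinearMap.compLinearMap_apply]
  refine Finset.sum_congr rfl fun i _ => congrArg _ (funext fun j => ?_)
  by_cases h : j = i
  · subst h; simp
  · simp [h]

/-- `v^{⊗ d}`, as a linear form on `Sym^d V`, for `v ∈ V*`. -/
def dualPow (d : ℕ) (v : Module.Dual ℂ V) : SymP d V →ₗ[ℂ] ℂ :=
  symLift ((MultilinearMap.mkPiAlgebra ℂ (Fin d) ℂ).compLinearMap fun _ => v) fun e w => by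
    simpa using Equiv.prod_comp e fun i => v (w i)

theorem dualPow_sprod (v : Module.Dual ℂ V) (w : Fin d → V) :
    dualPow d v (sprod w) = ∏ i, v (w i) := by
  refine (symLift_sprod _ _ _).trans ?_
  simp

/-- Sesquilinear forms, linear in the first and conjugate-linear in the second variable. -/
abbrev Sesq (V : Type*) [AddCommGroup V] [Module ℂ V] : Type _ := V →ₗ[ℂ] V →ₗ⋆[ℂ] ℂ

/-- `h` is a Hermitian inner product. -/
def IsHermInner (h : Sesq V) : Prop :=
  (∀ u v, h v u = conj (h u v)) ∧ ∀ u, u ≠ 0 → 0 < (h u u).re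

/-- Auxiliary: `w₁ ⋯ w_d ↦ (1/d!) ∑_σ ∏ᵢ conj h(vᵢ, w_{σ i})`, a linear form. -/
def symFormAux (h : Sesq V) (v : Fin d → V) : SymP d V →ₗ[ℂ] ℂ :=
  symLift
    ((d.factorial : ℂ)⁻¹ • ∑ σ : Equiv.Perm (Fin d),
      ((MultilinearMap.mkPiAlgebra ℂ (Fin d) ℂ).compLinearMap
        fun i => (starLinearEquiv ℂ (A := ℂ)).toLinearMap.comp (h (v i))).domDomCongr σ)
    fun e w => by
      simp only [smul_apply, sum_apply,
        MultilinearMap.domDomCongr_apply]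
      congr 1
      exact Fintype.sum_equiv (Equiv.mulLeft e) _ _ fun σ => rfl

theorem symFormAux_sprod (h : Sesq V) (v w : Fin d → V) :
    symFormAux h v (sprod w) =
      (d.factorial : ℂ)⁻¹ * ∑ σ : Equiv.Perm (Fin d), ∏ i, conj (h (v i) (w (σ i))) := by
  refine (symLift_sprod _ _ _).trans ?_
  simp [MultilinearMap.domDomCongr_apply]

/-- Auxiliary: `v ↦ (1/d!) ∑_σ ∏ᵢ h(vᵢ, w_{σ i})`. -/
def permForm (h : Sesq V) (w : Fin d → V) : MultilinearMap ℂ (fun _ : Fin d => V) ℂ :=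
  (d.factorial : ℂ)⁻¹ • ∑ σ : Equiv.Perm (Fin d),
    (MultilinearMap.mkPiAlgebra ℂ (Fin d) ℂ).compLinearMap fun i => h.flip (w (σ i))

theorem permForm_apply (h : Sesq V) (v w : Fin d → V) :
    permForm h w v = (d.factorial : ℂ)⁻¹ * ∑ σ : Equiv.Perm (Fin d), ∏ i, h (v i) (w (σ i)) := by
  simp [permForm]

theorem symFormAux_conj (h : Sesq V) (v w : Fin d → V) :
    symFormAux h v (sprod w) = conj (permForm h w v) := by
  rw [symFormAux_sprod, permForm_apply]
  simp

theorem symFormAux_perm (h : Sesq V) (e : Equiv.Perm (Fin d)) (v : Fin d → V) :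
    symFormAux h (fun i => v (e i)) = symFormAux h v := by
  refine symP_ext fun w => ?_
  rw [symFormAux_sprod, symFormAux_sprod]
  congr 1
  refine Fintype.sum_equiv (Equiv.mulRight e⁻¹) _ _ fun σ => ?_
  exact Fintype.prod_equiv e _ _ fun i => by simp

/-- The Hermitian form `Sym^d h` on `Sym^d V`. -/
def symForm (d : ℕ) (h : Sesq V) : Sesq (SymP d V) :=
  symLift
    { toFun := fun v => (starLinearEquiv ℂ (A := ℂ)).toLinearMap.comp (symFormAux h v)
      map_update_add' := fun {inst} v i x y => by
        have : inst = instDecidableEqFin d := Subsingleton.elim _ _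
        subst this
        rw [← LinearMap.comp_add]
        congr 1
        refine symP_ext fun w => ?_
        rw [LinearMap.add_apply]
        simp only [symFormAux_conj, MultilinearMap.map_update_add, map_add]
      map_update_smul' := fun {inst} v i c x => by
        have : inst = instDecidableEqFin d := Subsingleton.elim _ _
        subst this
        have : symFormAux h (Function.update v i (c • x)) =
            conj c • symFormAux h (Function.update v i x) := by
          refine symP_ext fun w => ?_
          rw [LinearMap.smul_apply]
          simp only [symFormAux_conj, MultilinearMap.map_update_smul, smul_eq_mul, map_mul]
        rw [this]
        ext t
        simp }
    fun e v => by
      change (starLinearEquiv ℂ (A := ℂ)).toLinearMap.comp _ =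
        (starLinearEquiv ℂ (A := ℂ)).toLinearMap.comp _
      rw [symFormAux_perm]

/-- `⟨v₁ ⋯ v_d, w₁ ⋯ w_d⟩ = (1/d!) ∑_σ ∏ᵢ ⟨vᵢ, w_{σ i}⟩`, which determines `Sym^d h`. -/
theorem symForm_sprod (h : Sesq V) (v w : Fin d → V) :
    symForm d h (sprod v) (sprod w) =
      (d.factorial : ℂ)⁻¹ * ∑ σ : Equiv.Perm (Fin d), ∏ i, h (v i) (w (σ i)) := by
  have : symForm d h (sprod v) =
      (starLinearEquiv ℂ (A := ℂ)).toLinearMap.comp (symFormAux h v) := symLift_sprod _ _ _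
  rw [this]
  change star (symFormAux h v (sprod w)) = _
  rw [symFormAux_conj, ← permForm_apply]
  simp

end SymPower

/-! ### Local complex calculus on `ℂ^m`

A `(1,1)`-form `α = ∑ α_{jk} dz_j ∧ dz̄_k` is stored as its coefficients `α j k`. -/

section Local

variable {m : ℕ} {M : Type*} [AddCommGroup M] [Module ℂ M]

/-- `∂f/∂z_j`. -/
def wd (j : Fin m) (f : (Fin m → ℂ) → ℂ) (z : Fin m → ℂ) : ℂ :=
  (1 / 2) * (fderiv ℝ f z (Pi.single j 1) - Complex.I * fderiv ℝ f z (Pi.single j Complex.I))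

/-- `∂f/∂z̄_j`. -/
def wdbar (j : Fin m) (f : (Fin m → ℂ) → ℂ) (z : Fin m → ℂ) : ℂ :=
  (1 / 2) * (fderiv ℝ f z (Pi.single j 1) + Complex.I * fderiv ℝ f z (Pi.single j Complex.I))

/-- Coefficients of `∂̄∂f = ∑ (∂²f/∂z̄_k∂z_j) dz̄_k ∧ dz_j`. -/
def dbard (f : (Fin m → ℂ) → ℂ) (z : Fin m → ℂ) : Matrix (Fin m) (Fin m) ℂ :=
  Matrix.of fun j k => -wdbar k (wd j f) z

/-- The matrix `g_{jk̄}` of a `(1,1)`-form `ω = i ∑ g_{jk̄} dz_j ∧ dz̄_k`. -/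
def metricMatrix (om : Matrix (Fin m) (Fin m) ℂ) : Matrix (Fin m) (Fin m) ℂ :=
  (-Complex.I) • om

/-- `g^{jk̄}`, normalized by `∑_k g^{jk̄} g_{pk̄} = δ_{jp}`. -/
def invMetric (om : Matrix (Fin m) (Fin m) ℂ) (j k : Fin m) : ℂ := (metricMatrix om)⁻¹ k j

/-- The contraction `Λ_ω α = -i ∑ g^{jk̄} α_{jk̄}` of a (possibly vector-valued) `(1,1)`-form at a
point; equivalently `m α ∧ ω^{m-1} = (Λ_ω α) ω^m`. -/
def Lam (om : Matrix (Fin m) (Fin m) ℂ) (α : Fin m → Fin m → M) : M :=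
  ∑ j, ∑ k, (-Complex.I * invMetric om j k) • α j k

/-- The coefficients of `F ∧ α = (1/4) ∑ β_{jkpq} dz_j ∧ dz̄_k ∧ dz_p ∧ dz̄_q`, antisymmetric in
`j, p` and in `k, q`, for a vector-valued `(1,1)`-form `F` and a scalar `(1,1)`-form `α`. -/
def wedge11 (F : Fin m → Fin m → M) (α : Fin m → Fin m → ℂ) (j k p q : Fin m) : M :=
  α p q • F j k + α j k • F p q - α p k • F j q - α j q • F p k

/-- `Λ²_ω β` for a `(2,2)`-form `β = (1/4) ∑ β_{jkpq} dz_j ∧ dz̄_k ∧ dz_p ∧ dz̄_q`, normalized by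
`m (m-1) β ∧ ω^{m-2} = (Λ²_ω β) ω^m` (this is one half of the square of the operator `Λ_ω`). -/
def Lam2 (om : Matrix (Fin m) (Fin m) ℂ) (β : Fin m → Fin m → Fin m → Fin m → M) : M :=
  (1 / 2 : ℂ) • ∑ j, ∑ k, ∑ p, ∑ q,
    ((-Complex.I * invMetric om j k) * (-Complex.I * invMetric om p q)) • β j k p q

/-- The Ricci form `i ∂̄∂ log det g`. -/
def ricciForm (om : (Fin m → ℂ) → Matrix (Fin m) (Fin m) ℂ) (z : Fin m → ℂ) :
    Matrix (Fin m) (Fin m) ℂ :=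
  Complex.I • dbard (fun y => Complex.log (metricMatrix (om y)).det) z

/-- The (Riemannian) scalar curvature `2 Λ_ω Ric(ω)`. -/
def scalarCurvLoc (om : (Fin m → ℂ) → Matrix (Fin m) (Fin m) ℂ) (z : Fin m → ℂ) : ℂ :=
  2 * Lam (om z) (ricciForm om z)

/-- `𝓓 f = ∂̄ (∇^{1,0} f)`, a `(0,1)`-form with values in `T^{1,0}`: the coefficient of
`dz̄_k ⊗ ∂/∂z_j` is `∂/∂z̄_k (∑_l g^{jl̄} ∂f/∂z̄_l)`. -/
def lichD (om : (Fin m → ℂ) → Matrix (Fin m) (Fin m) ℂ) (f : (Fin m → ℂ) → ℂ)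
    (j k : Fin m) (z : Fin m → ℂ) : ℂ :=
  wdbar k (fun y => ∑ l, invMetric (om y) j l * wdbar l f y) z

/-- The formal adjoint `𝓓*` of `𝓓`, for the pointwise inner products
`⟨a, b⟩ = ∑ g_{jp̄} g^{qk̄} a^j_k̄ conj (b^p_q̄)` and the volume density `det g`. -/
def lichDStar (om : (Fin m → ℂ) → Matrix (Fin m) (Fin m) ℂ)
    (b : Fin m → Fin m → (Fin m → ℂ) → ℂ) (z : Fin m → ℂ) : ℂ :=
  ((metricMatrix (om z)).det)⁻¹ * ∑ l, wd l (fun y => ∑ j, invMetric (om y) l j *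
    ∑ k, wd k (fun x => (metricMatrix (om x)).det *
      ∑ p, ∑ q, metricMatrix (om x) p j * invMetric (om x) k q * b p q x) y) z

variable {W κ : Type*} [AddCommGroup W] [Module ℂ W] [Fintype κ] [DecidableEq κ]

/-- Gram matrix of a metric on the trivial bundle with fibre `W`, in the holomorphic frame given by
a basis of `W`: `K(u, v) = v† H u`. -/
def gram (b : Module.Basis κ ℂ W) (K : (Fin m → ℂ) → Sesq W) (z : Fin m → ℂ) : Matrix κ κ ℂ :=
  Matrix.of fun a c => K z (b c) (b a)

/-- The coefficient of `dz_j` in the Chern connection form `H⁻¹ ∂H`. -/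
def chernConn (b : Module.Basis κ ℂ W) (K : (Fin m → ℂ) → Sesq W) (j : Fin m)
    (z : Fin m → ℂ) : Matrix κ κ ℂ :=
  (gram b K z)⁻¹ * Matrix.of fun a c => wd j (fun y => gram b K y a c) z

/-- Coefficients of the Chern curvature `F = ∂̄ (H⁻¹ ∂H)`. -/
def chernCurv (b : Module.Basis κ ℂ W) (K : (Fin m → ℂ) → Sesq W) (z : Fin m → ℂ)
    (j k : Fin m) : Module.End ℂ W :=
  Matrix.toLin b b (Matrix.of fun a c => -wdbar k (fun y => chernConn b K j y a c) z)

/-- Coefficients of `∂̄∂φ` for a section `φ` of the endomorphism bundle, where `∂` is the `(1,0)`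
part of the Chern connection: `∂_j φ + [A_j, φ]`. -/
def dbardEnd (b : Module.Basis κ ℂ W) (K : (Fin m → ℂ) → Sesq W)
    (φ : (Fin m → ℂ) → Module.End ℂ W) (z : Fin m → ℂ) (j k : Fin m) : Module.End ℂ W :=
  Matrix.toLin b b (Matrix.of fun a c => -wdbar k (fun y =>
    wd j (fun x => LinearMap.toMatrix b b (φ x) a c) y +
      (chernConn b K j y * LinearMap.toMatrix b b (φ y) -
        LinearMap.toMatrix b b (φ y) * chernConn b K j y) a c) z)

end Local

/-! ### The operator `T` on `End (Sym^d V)`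

Integrals over `ℙV*` are computed in the affine chart `ξ ↦ [v(ξ)]`, `v(ξ) = e₀* + ∑ ξ_j e_j*`, whose
complement is a null set; `n + 1` is the dimension of `V`. -/

section FibreOperator

variable {V W : Type*} [AddCommGroup V] [Module ℂ V] [AddCommGroup W] [Module ℂ W] {n : ℕ}

/-- The constant `C_{r,d}` with `∫_{ℙV*} ⟨ŝ, t̂⟩_g ω_g^{r-1}/(r-1)! = C_{r,d} ⟨s, t⟩_{Sym^d h}` for
`g` the metric on `𝒪(d)` induced by `h`, where `r = n + 1`; the factor `2^n` comes from
`i dξ ∧ dξ̄ = 2 dx ∧ dy`. -/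
def fibreConst (n d : ℕ) : ℂ :=
  (d : ℂ) ^ n * ∫ ξ : Fin n → ℂ, (2 : ℂ) ^ n / (1 + ∑ j, (‖ξ j‖ : ℂ) ^ 2) ^ (n + 1 + d)

/-- The vector `w` with `ℓ(u) = ⟨u, w⟩_H` for all `u` (unique if `H` is an inner product). -/
def riesz (H : Sesq W) (l : W →ₗ[ℂ] ℂ) : W := Classical.epsilon fun w => ∀ u, l u = H u w

/-- The vector of `Sym^d V` representing `v^{⊗ d}`. -/
def dualVec {d : ℕ} (H : Sesq (SymP d V)) (v : Module.Dual ℂ V) : SymP d V :=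
  riesz H (dualPow d v)

/-- `|v ⋯ v|²_H` for `v ∈ V*`, with respect to the dual metric. -/
def dualNormSq {d : ℕ} (H : Sesq (SymP d V)) (v : Module.Dual ℂ V) : ℂ :=
  H (dualVec H v) (dualVec H v)

/-- `λ_d(v, H) = |w|_H⁻² w ⊗ w^{*H}`, where `w` represents `v^{⊗ d}`. -/
def lamD {d : ℕ} (H : Sesq (SymP d V)) (v : Module.Dual ℂ V) : Module.End ℂ (SymP d V) :=
  (dualNormSq H v)⁻¹ • (H.flip (dualVec H v)).smulRight (dualVec H v)

/-- `F(Φ)([v]) = tr (λ_d(v, H) Φ)`. -/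
def fibreFun {d : ℕ} (H : Sesq (SymP d V)) (Φ : Module.End ℂ (SymP d V))
    (v : Module.Dual ℂ V) : ℂ :=
  LinearMap.trace ℂ (SymP d V) (lamD H v * Φ)

/-- The affine chart `v(ξ) = e₀* + ∑ ξ_j e_j*` of `ℙV*`. -/
def affDual (b : Module.Basis (Fin (n + 1)) ℂ V) (ξ : Fin n → ℂ) : Module.Dual ℂ V :=
  b.coord 0 + ∑ j, ξ j • b.coord j.succ

/-- `⟨ŝ, t̂⟩_Ĥ ([v]) = v^{⊗ d}(s) conj (v^{⊗ d}(t)) / |v ⋯ v|²_H`. -/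
def hatPairing {d : ℕ} (H : Sesq (SymP d V)) (s t : SymP d V) (v : Module.Dual ℂ V) : ℂ :=
  dualPow d v s * conj (dualPow d v t) / dualNormSq H v

/-- `ω_g = i ∂̄∂ log g` on `ℙV*` for `g = Ĥ`, in the affine chart. -/
def fibreForm {d : ℕ} (b : Module.Basis (Fin (n + 1)) ℂ V) (H : Sesq (SymP d V))
    (ξ : Fin n → ℂ) : Matrix (Fin n) (Fin n) ℂ :=
  Complex.I • dbard (fun ζ => Complex.log (dualNormSq H (affDual b ζ))⁻¹) ξ

/-- The density of `ω_g^{r-1}/(r-1)!` with respect to Lebesgue measure. -/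
def fibreVol {d : ℕ} (b : Module.Basis (Fin (n + 1)) ℂ V) (H : Sesq (SymP d V))
    (ξ : Fin n → ℂ) : ℂ :=
  2 ^ n * (metricMatrix (fibreForm b H ξ)).det

/-- `F + Δ̃F` for `F = F(Φ)`, with `Δ̃F = (r-1) i∂̄∂F ∧ ω_g^{r-2} / ω_g^{r-1} = Λ_{ω_g} i∂̄∂F`. -/
def fibreFunLap {d : ℕ} (b : Module.Basis (Fin (n + 1)) ℂ V) (H : Sesq (SymP d V))
    (Φ : Module.End ℂ (SymP d V)) (ξ : Fin n → ℂ) : ℂ :=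
  fibreFun H Φ (affDual b ξ) +
    Lam (fibreForm b H ξ) (Complex.I • dbard (fun ζ => fibreFun H Φ (affDual b ζ)) ξ)

/-- `TΦ`, the endomorphism with
`⟨s, (TΦ) t⟩_H = C_{r,d}⁻¹ ∫_{ℙV*} (F(Φ) + Δ̃F(Φ)) ⟨ŝ, t̂⟩_g ω_g^{r-1}/(r-1)!` for all `s, t`,
where `H = Sym^d h` and `g = Ĥ`. -/
def opT (d : ℕ) (b : Module.Basis (Fin (n + 1)) ℂ V) (h : Sesq V)
    (Φ : Module.End ℂ (SymP d V)) : Module.End ℂ (SymP d V) :=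
  Classical.epsilon fun S => ∀ s t : SymP d V,
    symForm d h s (S t) = (fibreConst n d)⁻¹ * ∫ ξ : Fin n → ℂ,
      fibreFunLap b (symForm d h) Φ ξ * hatPairing (symForm d h) s t (affDual b ξ) *
        fibreVol b (symForm d h) ξ

/-- The trace-free part `A - (1/R) tr(A) I`, `R = dim W`. -/
def traceFree (A : Module.End ℂ W) : Module.End ℂ W :=
  A - ((1 / (Module.finrank ℂ W : ℂ)) * LinearMap.trace ℂ W A) • (1 : Module.End ℂ W)

end FibreOperator

/-! ### Complex manifolds and holomorphic bundles -/

section Global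

variable {m : ℕ} {X : Type*} [TopologicalSpace X] [ChartedSpace (Fin m → ℂ) X]

/-- A `(1,1)`-form on `X`, given by its coefficients with respect to `dz_j ∧ dz̄_k` in charts. -/
abbrev Form11 (m : ℕ) (X : Type*) [TopologicalSpace X] : Type _ :=
  OpenPartialHomeomorph X (Fin m → ℂ) → (Fin m → ℂ) → Matrix (Fin m) (Fin m) ℂ

open scoped ComplexOrder in
/-- `Om` is a Kähler form: in the charts of the atlas its coefficients transform as those of a
`(1,1)`-form, are smooth, form `i` times a positive definite Hermitian matrix, and `d Om = 0`. -/
structure IsKahlerForm (Om : Form11 m X) : Prop where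
  transform : ∀ e ∈ atlas (Fin m → ℂ) X, ∀ e' ∈ atlas (Fin m → ℂ) X, ∀ z ∈ e.target,
    e.symm z ∈ e'.source → ∀ j k, Om e z j k = ∑ p, ∑ q,
      fderiv ℂ (fun y => e' (e.symm y)) z (Pi.single j 1) p * Om e' (e' (e.symm z)) p q *
        conj (fderiv ℂ (fun y => e' (e.symm y)) z (Pi.single k 1) q)
  smooth : ∀ e ∈ atlas (Fin m → ℂ) X, ∀ j k, ContDiffOn ℝ ∞ (fun z => Om e z j k) e.target
  posDef : ∀ e ∈ atlas (Fin m → ℂ) X, ∀ z ∈ e.target, (metricMatrix (Om e z)).PosDef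
  closed : ∀ e ∈ atlas (Fin m → ℂ) X, ∀ z ∈ e.target, ∀ j k l,
    wd l (fun y => Om e y j k) z = wd j (fun y => Om e y l k) z

/-- The form `i ∂̄∂η`. -/
def iDbarD (η : X → ℝ) : Form11 m X :=
  fun e z => Complex.I • dbard (fun y => (η (e.symm y) : ℂ)) z

/-- The value of a form at `x`, in the preferred chart at `x`. -/
def formAt (Om : Form11 m X) (x : X) : Matrix (Fin m) (Fin m) ℂ :=
  Om (chartAt (Fin m → ℂ) x) (chartAt (Fin m → ℂ) x x)

/-- The scalar curvature `S(ω)`. -/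
def scalarCurv (Om : Form11 m X) (x : X) : ℂ :=
  scalarCurvLoc (Om (chartAt (Fin m → ℂ) x)) (chartAt (Fin m → ℂ) x x)

/-- `ω` has constant scalar curvature, as computed in every chart of the atlas. -/
def IsCscK (Om : Form11 m X) : Prop :=
  ∃ c : ℂ, ∀ e ∈ atlas (Fin m → ℂ) X, ∀ z ∈ e.target, scalarCurvLoc (Om e) z = c

/-- The Lichnerowicz operator `𝓓*𝓓`. -/
def lichnerowicz (Om : Form11 m X) (η : X → ℝ) (x : X) : ℂ :=
  let e := chartAt (Fin m → ℂ) x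
  lichDStar (Om e) (lichD (Om e) fun y => (η (e.symm y) : ℂ)) (e x)

variable {n : ℕ} {E : X → Type*} [∀ x, AddCommGroup (E x)] [∀ x, Module ℂ (E x)]
  [∀ x, TopologicalSpace (E x)] [TopologicalSpace (Bundle.TotalSpace (Fin (n + 1) → ℂ) E)]
  [FiberBundle (Fin (n + 1) → ℂ) E] [VectorBundle ℂ (Fin (n + 1) → ℂ) E]

/-- The local holomorphic trivialization of `E` around `x₀`, at the point `y`, and its inverse. -/
def triv (x₀ y : X) : E y →ₗ[ℂ] (Fin (n + 1) → ℂ) :=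
  (trivializationAt (Fin (n + 1) → ℂ) E x₀).linearMapAt ℂ y

/-- The inverse of `triv`. -/
def trivSymm (x₀ y : X) : (Fin (n + 1) → ℂ) →ₗ[ℂ] E y :=
  (trivializationAt (Fin (n + 1) → ℂ) E x₀).symmₗ ℂ y

variable (n) in
/-- The local holomorphic frame of `E` around `x`, at the point `x`. -/
def frameAt (x : X) : Module.Basis (Fin (n + 1)) ℂ (E x) :=
  (Pi.basisFun ℂ (Fin (n + 1))).map
    ((trivializationAt (Fin (n + 1) → ℂ) E x).linearEquivAt ℂ x
      (FiberBundle.mem_baseSet_trivializationAt' x)).symm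

variable (n) in
/-- A Hermitian metric on `E`, smooth in local holomorphic frames. -/
structure IsHermMetric (h : ∀ x, Sesq (E x)) : Prop where
  inner : ∀ x, IsHermInner (h x)
  smooth : ∀ (x : X) (u v : Fin (n + 1) → ℂ), ContMDiffAt 𝓘(ℝ, Fin m → ℂ) 𝓘(ℝ, ℂ) ∞
    (fun y => h y (trivSymm x y u) (trivSymm x y v)) x

variable (n) in
/-- A smooth section of `End E`. -/
def IsSmoothEnd (φ : ∀ x, Module.End ℂ (E x)) : Prop :=
  ∀ (x : X) (u : Fin (n + 1) → ℂ), ContMDiffAt 𝓘(ℝ, Fin m → ℂ) 𝓘(ℝ, Fin (n + 1) → ℂ) ∞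
    (fun y => triv (n := n) x y (φ y (trivSymm x y u))) x

variable (n) in
/-- `h` in the chart and the trivialization at `x`. -/
def locMetric (h : ∀ x, Sesq (E x)) (x : X) (z : Fin m → ℂ) : Sesq (Fin (n + 1) → ℂ) :=
  let y := (chartAt (Fin m → ℂ) x).symm z
  ((h y).compl₂ (trivSymm x y)) ∘ₗ trivSymm x y

variable (n) in
/-- `φ` in the chart and the trivialization at `x`. -/
def locEnd (φ : ∀ x, Module.End ℂ (E x)) (x : X) (z : Fin m → ℂ) :
    Module.End ℂ (Fin (n + 1) → ℂ) :=
  let y := (chartAt (Fin m → ℂ) x).symm z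
  triv x y ∘ₗ φ y ∘ₗ trivSymm x y

variable (n) in
/-- Coefficients at `x` of the curvature `F_h` of the Chern connection of `(E, h)`. -/
def curvE (h : ∀ x, Sesq (E x)) (x : X) (j k : Fin m) : Module.End ℂ (E x) :=
  trivSymm x x ∘ₗ chernCurv (Pi.basisFun ℂ (Fin (n + 1))) (locMetric n h x)
    (chartAt (Fin m → ℂ) x x) j k ∘ₗ triv x x

variable (n) in
/-- Coefficients at `x` of the curvature `F_{Sym^d h}` of the Chern connection of
`(Sym^d E, Sym^d h)`; a basis of `Sym^d ℂ^r` gives a local holomorphic frame of `Sym^d E`. -/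
def curvSym (d : ℕ) (h : ∀ x, Sesq (E x)) (x : X) (j k : Fin m) : Module.End ℂ (SymP d (E x)) :=
  symMap d (trivSymm x x) ∘ₗ
    chernCurv (Module.finBasis ℂ (SymP d (Fin (n + 1) → ℂ)))
      (fun z => symForm d (locMetric n h x z)) (chartAt (Fin m → ℂ) x x) j k ∘ₗ
    symMap d (triv x x)

variable (n) in
/-- Coefficients at `x` of `∂̄∂φ`, for the Chern connection of `(E, h)`. -/
def dbardEndE (h : ∀ x, Sesq (E x)) (φ : ∀ x, Module.End ℂ (E x)) (x : X) (j k : Fin m) :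
    Module.End ℂ (E x) :=
  trivSymm x x ∘ₗ dbardEnd (Pi.basisFun ℂ (Fin (n + 1))) (locMetric n h x) (locEnd n φ x)
    (chartAt (Fin m → ℂ) x x) j k ∘ₗ triv x x

variable (n) in
/-- The Hermitian–Einstein equation `Λ_ω F_h = μ I_E`, for a constant `μ`. -/
def IsHermEinstein (Om : Form11 m X) (h : ∀ x, Sesq (E x)) : Prop :=
  ∃ μ : ℂ, ∀ x, Lam (formAt Om x) (curvE n h x) = μ • (1 : Module.End ℂ (E x))

variable (n) in
/-- The constant `i r / (2π (r + d))`, `r = n + 1`. -/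
def coeffA (d : ℕ) : ℂ :=
  Complex.I * ((n + 1 : ℕ) : ℂ) / (2 * Real.pi * (((n + 1 : ℕ) : ℂ) + d))

variable (n) in
/-- `A₁(h, ω, Φ) = i r / (2π (r + d)) (Λ_ω F_{Sym^d h} - (1/R) tr(Λ_ω F_{Sym^d h}) I) + S(ω)/2 I
+ Φ - TΦ`, a section of `End (Sym^d E)`. -/
def coeffA1 (d : ℕ) (h : ∀ x, Sesq (E x)) (Om : Form11 m X)
    (Φ : ∀ x, Module.End ℂ (SymP d (E x))) (x : X) : Module.End ℂ (SymP d (E x)) :=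
  coeffA n d • traceFree (Lam (formAt Om x) (curvSym n d h x)) +
    ((1 / 2 : ℂ) * scalarCurv Om x) • (1 : Module.End ℂ (SymP d (E x))) +
    Φ x - opT d (frameAt n x) (h x) (Φ x)

/-- The metric `h (I + t φ)`. -/
def perturbMetric (h : ∀ x, Sesq (E x)) (φ : ∀ x, Module.End ℂ (E x)) (t : ℝ) (x : X) :
    Sesq (E x) :=
  (h x).comp (1 + (t : ℂ) • φ x)

end Global

end SymBalanced

end

/-! The summands of `A₁` are differentiated one at a time, each by a computation near one point in a
chart and a trivialization.

Scalar curvature. Put `L = log det g` and `Δ = g^{jk̄} ∂_j ∂_k̄`, so that `S = -2 ΔL`. Along `ω + it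
∂̄∂η` the metric moves by `-∂∂̄η`, hence `L` by `-Δη`, and `S/2` by `Δ²η - g^{jl̄} g^{as̄} (∂_a ∂_l̄
L) (∂_j ∂_s̄ η)` up to naming of indices. For constant `S` this is `𝓓*𝓓η`: commuting derivatives by
the Kähler identities produces one further term, a pairing of `dS` with the gradient of `η`, which
vanishes. The identity is formal. `KahlerRing.lich_eq` proves it in any commutative ring with
commuting derivations, and it is then applied to germs of smooth functions (`lich_eq_local`,
`hasDerivAt_scalarCurvLoc`).

Curvature. The Chern connection form of `Sym^d h` is `S^d` of that of `h`, so the same holds for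
curvatures (`chernCurv_symForm`). Under `h (I + tφ)` the curvature moves by `∂̄∂φ`
(`hasDerivAt_chernCurv`), and the contraction moves by `lamVar`. Algebraically `Λ²(F ∧ α) = Λα · ΛF
+ lamVar` (`Lam2_wedge11`). For a Hermitian–Einstein metric `ΛF` is a multiple of the identity, so
the first summand has no trace-free part and `lamVar` may be replaced by `Λ²(F ∧ α)`.

The operator `T`. Since `T_h(I) = I` for every `h`, one has `T_h(I + tΦ) = I + t T_hΦ` for real `t`.
The difference quotient at `t = 0` is therefore `T_{h_t}Φ` itself, and only continuity in `t` is
needed (`hasDerivAt_opT`). In an affine chart of the projective space the integrand is a polynomial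
in the Gram matrix, its inverse, and the functions `u_c ū_e / N`, where `N` is the dual squared norm
of the point `u`. These are bounded by Cauchy–Schwarz, and after a rewriting the volume density is
such a polynomial times a fixed integrable weight; dominated convergence applies. The normalization
`T_h(I) = I` is obtained by computing a Gaussian integral on `ℂ^r` both coordinatewise and in the
coordinates `c (1, ξ)` (`integral_monomial_fubiniStudy`). -/

noncomputable section

namespace SymBalanced

open Filter Topology MeasureTheory
open scoped ComplexOrder

/-! ### Germs of smooth functions -/

section Germs

variable {E : Type*} [NormedAddCommGroup E] [NormedSpace ℝ E] {p : E}

/-- The ring of germs at `p` of smooth complex-valued functions. -/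
def smoothGerms (p : E) : Subring (Germ (𝓝 p) ℂ) where
  carrier := {γ | ∃ f : E → ℂ, ContDiffAt ℝ ∞ f p ∧ (f : Germ (𝓝 p) ℂ) = γ}
  mul_mem' := by
    rintro _ _ ⟨f, hf, rfl⟩ ⟨g, hg, rfl⟩
    exact ⟨f * g, hf.mul hg, rfl⟩
  one_mem' := ⟨fun _ => 1, contDiffAt_const, rfl⟩
  add_mem' := by
    rintro _ _ ⟨f, hf, rfl⟩ ⟨g, hg, rfl⟩
    exact ⟨f + g, hf.add hg, rfl⟩
  zero_mem' := ⟨fun _ => 0, contDiffAt_const, rfl⟩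
  neg_mem' := by
    rintro _ ⟨f, hf, rfl⟩
    exact ⟨-f, hf.neg, rfl⟩

/-- The function `f` represents the smooth germ `r`. -/
def Rep (f : E → ℂ) (r : smoothGerms p) : Prop := (r : Germ (𝓝 p) ℂ) = (f : Germ (𝓝 p) ℂ)

theorem exists_rep_of_contDiffAt {f : E → ℂ} (hf : ContDiffAt ℝ ∞ f p) :
    ∃ r : smoothGerms p, Rep f r := ⟨⟨f, f, hf, rfl⟩, rfl⟩

theorem exists_rep (r : smoothGerms p) : ∃ f : E → ℂ, Rep f r := by
  obtain ⟨_, f, hf, rfl⟩ := r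
  exact ⟨f, rfl⟩

namespace Rep

variable {f g : E → ℂ} {r s : smoothGerms p}

theorem congr (hf : Rep f r) (h : f =ᶠ[𝓝 p] g) : Rep g r :=
  Eq.trans hf (Germ.coe_eq.2 h)

theorem contDiffAt (hf : Rep f r) : ContDiffAt ℝ ∞ f p := by
  obtain ⟨_, g, hg, rfl⟩ := r
  exact hg.congr_of_eventuallyEq (Germ.coe_eq.1 hf).symm

theorem unique (hf : Rep f r) (hs : Rep f s) : r = s := Subtype.ext (Eq.trans hf hs.symm)

theorem eventuallyEq (hf : Rep f r) (hg : Rep g r) : f =ᶠ[𝓝 p] g :=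
  Germ.coe_eq.1 (hf.symm.trans hg)

theorem add (hf : Rep f r) (hg : Rep g s) : Rep (fun y => f y + g y) (r + s) := by
  change (r : Germ (𝓝 p) ℂ) + (s : Germ (𝓝 p) ℂ) = _
  rw [hf, hg]; rfl

theorem mul (hf : Rep f r) (hg : Rep g s) : Rep (fun y => f y * g y) (r * s) := by
  change (r : Germ (𝓝 p) ℂ) * (s : Germ (𝓝 p) ℂ) = _
  rw [hf, hg]; rfl

theorem neg (hf : Rep f r) : Rep (fun y => -f y) (-r) := by
  change -(r : Germ (𝓝 p) ℂ) = _
  rw [hf]; rfl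

theorem zero : Rep (fun _ => 0) (0 : smoothGerms p) := rfl

theorem one : Rep (fun _ => 1) (1 : smoothGerms p) := rfl

theorem sum {ι : Type*} {t : Finset ι} {f : ι → E → ℂ} {r : ι → smoothGerms p}
    (h : ∀ i ∈ t, Rep (f i) (r i)) : Rep (fun y => ∑ i ∈ t, f i y) (∑ i ∈ t, r i) := by
  classical
  induction t using Finset.induction_on with
  | empty => simpa using zero
  | insert a t ha ih =>
    simp only [Finset.sum_insert ha]
    exact (h a (by simp)).add (ih fun i hi => h i (by simp [hi]))

theorem prod {ι : Type*} {t : Finset ι} {f : ι → E → ℂ} {r : ι → smoothGerms p}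
    (h : ∀ i ∈ t, Rep (f i) (r i)) : Rep (fun y => ∏ i ∈ t, f i y) (∏ i ∈ t, r i) := by
  classical
  induction t using Finset.induction_on with
  | empty => simpa using one
  | insert a t ha ih =>
    simp only [Finset.prod_insert ha]
    exact (h a (by simp)).mul (ih fun i hi => h i (by simp [hi]))

end Rep

/-- Constant germs. -/
def cst (p : E) : ℂ →+* smoothGerms p where
  toFun c := ⟨(fun _ => c : E → ℂ), _, contDiffAt_const, rfl⟩
  map_one' := rfl
  map_mul' _ _ := rfl
  map_zero' := rfl
  map_add' _ _ := rfl

theorem Rep.cst (c : ℂ) : Rep (fun _ => c) (cst p c) := rfl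

/-- The value of a germ. -/
def evalG (p : E) : smoothGerms p →+* ℂ := Germ.valueRingHom.comp (smoothGerms p).subtype

theorem Rep.eval {f : E → ℂ} {r : smoothGerms p} (hf : Rep f r) : evalG p r = f p := by
  change Germ.value (r : Germ (𝓝 p) ℂ) = _
  rw [hf]; rfl

@[simp] theorem evalG_cst (c : ℂ) : evalG p (cst p c) = c := (Rep.cst c).eval

/-- A representative that is nonzero at `p` is nonzero nearby, and its pointwise inverse is smooth
there. -/
theorem isUnit_of_evalG_ne_zero {r : smoothGerms p} (hr : evalG p r ≠ 0) : IsUnit r := by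
  obtain ⟨f, hf⟩ := exists_rep r
  have h0 : f p ≠ 0 := by rwa [← hf.eval]
  obtain ⟨s, hs⟩ := exists_rep_of_contDiffAt (hf.contDiffAt.inv h0)
  refine IsUnit.of_mul_eq_one s ((hf.mul hs).unique (Rep.one.congr ?_))
  filter_upwards [hf.contDiffAt.continuousAt.eventually_ne h0] with y hy
  simp [hy]

/-- The derivative of a germ in the direction `v`. -/
def germDeriv (v : E) : Germ (𝓝 p) ℂ → Germ (𝓝 p) ℂ :=
  Quotient.map' (fun f y => fderiv ℝ f y v) fun f g h => by
    filter_upwards [(show f =ᶠ[𝓝 p] g from h).fderiv (𝕜 := ℝ)] with y hy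
    rw [hy]

theorem ContDiffAt.fderiv_apply_const {f : E → ℂ} (hf : ContDiffAt ℝ ∞ f p) (v : E) :
    ContDiffAt ℝ ∞ (fun y => fderiv ℝ f y v) p :=
  (hf.fderiv_right (m := ∞) (by norm_num)).clm_apply contDiffAt_const

theorem eventually_differentiableAt {f : E → ℂ} (hf : ContDiffAt ℝ ∞ f p) :
    ∀ᶠ y in 𝓝 p, DifferentiableAt ℝ f y := by
  have : ContDiffAt ℝ 1 f p := hf.of_le (by exact_mod_cast le_top)
  exact (this.eventually (by simp)).mono fun y hy => hy.differentiableAt (by simp)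

/-- The derivation of the ring of germs in the direction `v`. -/
def dirD (v : E) : Derivation ℤ (smoothGerms p) (smoothGerms p) :=
  Derivation.mk'
    (AddMonoidHom.toIntLinearMap <| AddMonoidHom.mk'
      (fun r => ⟨germDeriv v r, by
        obtain ⟨_, f, hf, rfl⟩ := r
        exact ⟨_, ContDiffAt.fderiv_apply_const hf v, rfl⟩⟩)
      (by
        rintro ⟨_, f, hf, rfl⟩ ⟨_, g, hg, rfl⟩
        refine Subtype.ext (Germ.coe_eq.2 ?_)
        filter_upwards [eventually_differentiableAt hf, eventually_differentiableAt hg]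
          with y hy hy'
        change fderiv ℝ (f + g) y v = fderiv ℝ f y v + fderiv ℝ g y v
        rw [fderiv_add hy hy']; rfl))
    (by
      rintro ⟨_, f, hf, rfl⟩ ⟨_, g, hg, rfl⟩
      refine Subtype.ext (Germ.coe_eq.2 ?_)
      filter_upwards [eventually_differentiableAt hf, eventually_differentiableAt hg]
        with y hy hy'
      change fderiv ℝ (f * g) y v = f y * fderiv ℝ g y v + g y * fderiv ℝ f y v
      rw [fderiv_mul hy hy']; rfl)

theorem Rep.dirD {f : E → ℂ} {r : smoothGerms p} (hf : Rep f r) (v : E) :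
    Rep (fun y => fderiv ℝ f y v) (dirD v r) := by
  change germDeriv v (r : Germ (𝓝 p) ℂ) = _
  rw [hf]; rfl

/-- Second derivatives are symmetric at every point near `p`, not only at `p`; an identity of germs
requires this. -/
theorem dirD_comm (v w : E) (r : smoothGerms p) : dirD v (dirD w r) = dirD w (dirD v r) := by
  obtain ⟨f, hf⟩ := exists_rep r
  refine ((hf.dirD w).dirD v).unique (((hf.dirD v).dirD w).congr ?_)
  have h2 : ContDiffAt ℝ 2 f p := hf.contDiffAt.of_le (by norm_cast)
  filter_upwards [h2.eventually (by simp)] with y hy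
  have hd : DifferentiableAt ℝ (fderiv ℝ f) y :=
    (hy.fderiv_right (m := 1) (by norm_num)).differentiableAt (by simp)
  have := hy.isSymmSndFDerivAt (by simp) v w
  rw [fderiv_clm_apply hd (by fun_prop), fderiv_clm_apply hd (by fun_prop)]
  simpa using this.symm

theorem dirD_cst (v : E) (c : ℂ) : dirD v (cst p c) = 0 :=
  ((Rep.cst c).dirD v).unique (Rep.zero.congr (by simp))

/-- The derivation `(∂_v + c ∂_w) / 2`. -/
def wirtD (c : ℂ) (v w : E) : Derivation ℤ (smoothGerms p) (smoothGerms p) :=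
  cst p (1 / 2) • (dirD v + cst p c • dirD w)

theorem wirtD_apply (c : ℂ) (v w : E) (r : smoothGerms p) :
    wirtD c v w r = cst p (1 / 2) * (dirD v r + cst p c * dirD w r) := rfl

theorem wirtD_cst (c c' : ℂ) (v w : E) : wirtD c v w (cst p c') = 0 := by
  simp [wirtD_apply, dirD_cst]

theorem wirtD_comm (c c' : ℂ) (v w v' w' : E) (r : smoothGerms p) :
    wirtD c v w (wirtD c' v' w' r) = wirtD c' v' w' (wirtD c v w r) := by
  simp only [wirtD_apply, Derivation.leibniz, map_add, dirD_cst, smul_eq_mul, mul_zero, add_zero]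
  rw [dirD_comm v v', dirD_comm v w', dirD_comm w v', dirD_comm w w']
  ring

end Germs

/-! ### Determinants and inverses of matrices of germs -/

section MatrixGerms

variable {R : Type*} [CommRing R] {κ : Type*} [Fintype κ] [DecidableEq κ]

/-- Jacobi's formula for a derivation. -/
theorem derivation_det (D : Derivation ℤ R R) (M : Matrix κ κ R) (hM : IsUnit M.det) :
    D M.det = M.det * (M⁻¹ * M.map D).trace := by
  -- `r ↦ r + ε D r` is a ring homomorphism into the dual numbers, so Jacobi's formula is the
  -- `ε`-part of `det (M (1 + ε M⁻¹ DM)) = det M · (1 + ε tr (M⁻¹ DM))`.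
  let δ : R →+* DualNumber R :=
    { toFun := fun r => TrivSqZeroExt.inl r + TrivSqZeroExt.inr (D r)
      map_one' := by simp
      map_mul' := fun a b => by
        ext <;> simp [D.leibniz, mul_comm]
      map_zero' := by simp
      map_add' := fun a b => by
        ext <;> simp }
  let ι : R →+* DualNumber R := TrivSqZeroExt.inlHom R R
  have h1 : δ.mapMatrix M = ι.mapMatrix M *
      (1 + (DualNumber.eps : DualNumber R) • ι.mapMatrix (M⁻¹ * M.map D)) := by
    rw [mul_add, mul_one, mul_smul_comm, ← map_mul, ← mul_assoc, Matrix.mul_nonsing_inv _ hM,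
      one_mul]
    ext a b
    · simp only [RingHom.mapMatrix_apply, Matrix.map_apply, Matrix.add_apply, Matrix.smul_apply]
      simp [δ, ι]
    · simp only [RingHom.mapMatrix_apply, Matrix.map_apply, Matrix.add_apply, Matrix.smul_apply]
      simp [δ, ι]
  have h2 := congrArg Matrix.det h1
  rw [← RingHom.map_det, Matrix.det_mul, ← RingHom.map_det, Matrix.det_one_add_smul] at h2
  have h3 := congrArg TrivSqZeroExt.snd h2
  have htr : (ι.mapMatrix (M⁻¹ * M.map D)).trace = ι (M⁻¹ * M.map D).trace := by
    simp only [Matrix.trace, Matrix.diag, RingHom.mapMatrix_apply, Matrix.map_apply, map_sum]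
  rw [htr] at h3
  have he : (DualNumber.eps : DualNumber R) ^ 2 = 0 := by simp [sq]
  simpa [δ, ι, he] using h3

/-- The derivative of an inverse matrix. -/
theorem derivation_inv (D : Derivation ℤ R R) (M : Matrix κ κ R) (hM : IsUnit M.det) :
    (M⁻¹).map D = -(M⁻¹ * M.map D * M⁻¹) := by
  have hmul : ∀ A B : Matrix κ κ R, (A * B).map D = A.map D * B + A * B.map D := by
    intro A B
    ext a b
    simp only [Matrix.map_apply, Matrix.mul_apply, map_sum, D.leibniz, smul_eq_mul,
        Matrix.add_apply,
      ← Finset.sum_add_distrib]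
    exact Finset.sum_congr rfl fun _ _ => by ring
  have h1 : ((1 : Matrix κ κ R)).map D = 0 := by
    ext a b
    by_cases h : a = b <;> simp [h]
  have h2 := hmul M M⁻¹
  rw [Matrix.mul_nonsing_inv _ hM, h1] at h2
  calc (M⁻¹).map D = M⁻¹ * (M * (M⁻¹).map D) := by
        rw [← mul_assoc, Matrix.nonsing_inv_mul _ hM, one_mul]
    _ = M⁻¹ * -(M.map D * M⁻¹) := by rw [eq_neg_of_add_eq_zero_right h2.symm]
    _ = _ := by rw [mul_neg, mul_assoc]

variable {E : Type*} [NormedAddCommGroup E] [NormedSpace ℝ E] {p : E}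

theorem Rep.det {M : E → Matrix κ κ ℂ} {γ : Matrix κ κ (smoothGerms p)}
    (h : ∀ a b, Rep (fun y => M y a b) (γ a b)) : Rep (fun y => (M y).det) γ.det := by
  simp only [Matrix.det_apply']
  refine Rep.sum fun σ _ => Rep.mul ?_ (Rep.prod fun i _ => h _ _)
  have := Rep.cst (p := p) (((Equiv.Perm.sign σ : ℤˣ) : ℤ) : ℂ)
  rwa [map_intCast] at this

theorem isUnit_det_of_rep {M : E → Matrix κ κ ℂ} {γ : Matrix κ κ (smoothGerms p)}
    (h : ∀ a b, Rep (fun y => M y a b) (γ a b)) (h0 : (M p).det ≠ 0) : IsUnit γ.det :=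
  isUnit_of_evalG_ne_zero (by rwa [(Rep.det h).eval])

/-- The inverse over the ring of germs agrees with the pointwise inverse near `p`: representatives
of its entries satisfy the finitely many equations of `M M⁻¹ = 1` on a common neighbourhood. -/
theorem Rep.inv {M : E → Matrix κ κ ℂ} {γ : Matrix κ κ (smoothGerms p)}
    (h : ∀ a b, Rep (fun y => M y a b) (γ a b)) (h0 : (M p).det ≠ 0) (a b : κ) :
    Rep (fun y => (M y)⁻¹ a b) (γ⁻¹ a b) := by
  choose g hg using fun a b => exists_rep (γ⁻¹ a b)
  refine (hg a b).congr ?_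
  have h1 : ∀ a b, ∀ᶠ y in 𝓝 p, ∑ c, M y a c * g c b y = (1 : Matrix κ κ ℂ) a b := by
    intro a b
    have h2 := Rep.sum (t := Finset.univ) fun c _ => (h a c).mul (hg c b)
    have h3 : ∑ c, γ a c * γ⁻¹ c b = (1 : Matrix κ κ (smoothGerms p)) a b := by
      rw [← Matrix.mul_apply, Matrix.mul_nonsing_inv _ (isUnit_det_of_rep h h0)]
    rw [h3] at h2
    refine h2.eventuallyEq ?_
    by_cases hab : a = b
    · subst hab; simpa using Rep.one (p := p)
    · simpa [hab] using Rep.zero (p := p)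
  filter_upwards [eventually_all.2 fun a => eventually_all.2 fun b => h1 a b] with y hy
  have : M y * Matrix.of (fun a b => g a b y) = 1 := by
    ext a b
    simpa [Matrix.mul_apply] using hy a b
  rw [Matrix.inv_eq_right_inv this]
  rfl

end MatrixGerms

/-! ### Wirtinger derivatives -/

section Wirtinger

variable {m : ℕ} {z : Fin m → ℂ}

/-- `(∂_{x_j} + c ∂_{y_j}) / 2`, which is `∂/∂z_j` for `c = -i` and `∂/∂z̄_j` for `c = i`. -/
def wirt (c : ℂ) (j : Fin m) (f : (Fin m → ℂ) → ℂ) (z : Fin m → ℂ) : ℂ :=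
  (1 / 2) * (fderiv ℝ f z (Pi.single j 1) + c * fderiv ℝ f z (Pi.single j Complex.I))

theorem wd_eq_wirt (j : Fin m) : wd j = wirt (-Complex.I) j := by
  funext f z
  simp only [wd, wirt]
  ring

theorem wdbar_eq_wirt (j : Fin m) : wdbar j = wirt Complex.I j := rfl

/-- `∂/∂z_j` on germs. -/
def hol (z : Fin m → ℂ) (j : Fin m) : Derivation ℤ (smoothGerms z) (smoothGerms z) :=
  wirtD (-Complex.I) (Pi.single j 1) (Pi.single j Complex.I)

/-- `∂/∂z̄_j` on germs. -/
def ahol (z : Fin m → ℂ) (j : Fin m) : Derivation ℤ (smoothGerms z) (smoothGerms z) :=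
  wirtD Complex.I (Pi.single j 1) (Pi.single j Complex.I)

theorem Rep.wirt {f : (Fin m → ℂ) → ℂ} {r : smoothGerms z} (hf : Rep f r) (c : ℂ) (j : Fin m) :
    Rep (wirt c j f) (wirtD c (Pi.single j 1) (Pi.single j Complex.I) r) :=
  (Rep.cst _).mul ((hf.dirD _).add ((Rep.cst c).mul (hf.dirD _)))

theorem Rep.wd {f : (Fin m → ℂ) → ℂ} {r : smoothGerms z} (hf : Rep f r) (j : Fin m) :
    Rep (wd j f) (hol z j r) := by
  rw [wd_eq_wirt]; exact hf.wirt _ _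

theorem Rep.wdbar {f : (Fin m → ℂ) → ℂ} {r : smoothGerms z} (hf : Rep f r) (j : Fin m) :
    Rep (wdbar j f) (ahol z j r) := hf.wirt _ _

theorem hol_comm (j k : Fin m) (r : smoothGerms z) : hol z j (hol z k r) = hol z k (hol z j r) :=
  wirtD_comm _ _ _ _ _ _ _

theorem ahol_comm (j k : Fin m) (r : smoothGerms z) :
    ahol z j (ahol z k r) = ahol z k (ahol z j r) := wirtD_comm _ _ _ _ _ _ _

theorem hol_ahol_comm (j k : Fin m) (r : smoothGerms z) :
    hol z j (ahol z k r) = ahol z k (hol z j r) := wirtD_comm _ _ _ _ _ _ _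

theorem hol_cst (j : Fin m) (c : ℂ) : hol z j (cst z c) = 0 := wirtD_cst _ _ _ _

theorem ahol_cst (j : Fin m) (c : ℂ) : ahol z j (cst z c) = 0 := wirtD_cst _ _ _ _

theorem wirt_congr {f g : (Fin m → ℂ) → ℂ} (h : f =ᶠ[𝓝 z] g) (c : ℂ) (j : Fin m) :
    wirt c j f z = wirt c j g z := by
  simp only [wirt, h.fderiv_eq]

theorem fderiv_conj {f : (Fin m → ℂ) → ℂ} (v : Fin m → ℂ) :
    fderiv ℝ (fun y => conj (f y)) z v = conj (fderiv ℝ f z v) := by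
  have := Complex.conjCLE.comp_fderiv (f := f) (x := z)
  have h2 : (fun y => conj (f y)) = Complex.conjCLE ∘ f := by
    funext y; simp
  rw [h2, this]
  simp

theorem wdbar_conj (j : Fin m) (f : (Fin m → ℂ) → ℂ) :
    wdbar j (fun y => conj (f y)) z = conj (wd j f z) := by
  simp only [wdbar, wd, fderiv_conj, map_mul, map_sub, Complex.conj_I, map_div₀, map_one,
    Complex.conj_ofNat]
  ring

/-- Differentiation in `t` commutes with Wirtinger derivatives in `z`: both orders are the second
derivative of the joint function at `(0, z)` on vectors `(1, 0)` and `(0, v)`, which is symmetric.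
-/
theorem hasDerivAt_wirt {f : ℝ → (Fin m → ℂ) → ℂ} {f' : (Fin m → ℂ) → ℂ}
    (hf : ContDiffAt ℝ 2 (fun q : ℝ × (Fin m → ℂ) => f q.1 q.2) (0, z))
    (hf' : ∀ᶠ y in 𝓝 z, HasDerivAt (fun t => f t y) (f' y) 0) (c : ℂ) (j : Fin m) :
    HasDerivAt (fun t => wirt c j (f t) z) (wirt c j f' z) 0 := by
  set F : ℝ × (Fin m → ℂ) → ℂ := fun q => f q.1 q.2 with hF
  have hd1 : ∀ᶠ q in 𝓝 ((0 : ℝ), z), DifferentiableAt ℝ F q :=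
    (hf.eventually (by simp)).mono fun q hq => hq.differentiableAt (by simp)
  have hd2 : DifferentiableAt ℝ (fderiv ℝ F) (0, z) :=
    (hf.fderiv_right (m := 1) (by norm_num)).differentiableAt (by simp)
  have hsymm := hf.isSymmSndFDerivAt (by simp)
  have key : ∀ v : Fin m → ℂ, HasDerivAt (fun t => fderiv ℝ (f t) z v) (fderiv ℝ f' z v) 0 := by
    intro v
    have e1 : (fun t => fderiv ℝ (f t) z v) =ᶠ[𝓝 0] fun t => fderiv ℝ F (t, z) (0, v) := by
      have ht : Tendsto (fun t : ℝ => (t, z)) (𝓝 0) (𝓝 ((0 : ℝ), z)) :=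
        (Continuous.prodMk_left z).tendsto 0
      filter_upwards [ht.eventually hd1] with t ht
      have : HasFDerivAt (f t) ((fderiv ℝ F (t, z)).comp (ContinuousLinearMap.inr ℝ ℝ _)) z :=
        ht.hasFDerivAt.comp z (hasFDerivAt_prodMk_right t z)
      rw [this.fderiv]; simp
    have e2 : f' =ᶠ[𝓝 z] fun y => fderiv ℝ F (0, y) (1, 0) := by
      have ht : Tendsto (fun y : Fin m → ℂ => ((0 : ℝ), y)) (𝓝 z) (𝓝 ((0 : ℝ), z)) :=
        (Continuous.prodMk_right 0).tendsto z
      filter_upwards [hf', ht.eventually hd1] with y hy1 hy2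
      have h3 : HasFDerivAt (fun t => f t y)
          ((fderiv ℝ F (0, y)).comp (ContinuousLinearMap.inl ℝ ℝ _)) 0 :=
        HasFDerivAt.comp (g := F) (f := fun t : ℝ => (t, y)) (0 : ℝ) hy2.hasFDerivAt
          (hasFDerivAt_prodMk_left 0 y)
      have := h3.hasDerivAt.unique hy1
      simpa using this.symm
    rw [e2.fderiv_eq]
    have h4 : HasFDerivAt (fun y => fderiv ℝ F (0, y) (1, 0))
        (((fderiv ℝ (fderiv ℝ F) (0, z)).comp (ContinuousLinearMap.inr ℝ ℝ _)).flip (1, 0)) z := by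
      have := (hd2.hasFDerivAt.comp z (hasFDerivAt_prodMk_right (𝕜 := ℝ) 0 z)).clm_apply
        (hasFDerivAt_const ((1 : ℝ), (0 : Fin m → ℂ)) z)
      refine this.congr_fderiv ?_
      ext; simp
    have h5 : HasDerivAt (fun t => fderiv ℝ F (t, z) (0, v))
        (fderiv ℝ (fderiv ℝ F) (0, z) (1, 0) (0, v)) 0 := by
      have := ((hd2.hasFDerivAt.comp (0 : ℝ) (hasFDerivAt_prodMk_left (𝕜 := ℝ) 0 z)).clm_apply
        (hasFDerivAt_const ((0 : ℝ), v) 0)).hasDerivAt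
      refine this.congr_deriv ?_
      simp
    rw [h4.fderiv]
    have h6 := hsymm (1, 0) (0, v)
    refine (h5.congr_of_eventuallyEq e1).congr_deriv ?_
    simpa using h6
  exact ((key _).add ((key _).const_mul c)).const_mul _

/-- Partial derivatives in `z` are derivatives of the joint function in directions `(0, v)`, so
joint smoothness persists. This is what lets `hasDerivAt_wirt` be applied twice in succession. -/
theorem contDiffAt_wirt {f : ℝ → (Fin m → ℂ) → ℂ} {t : ℝ}
    (hf : ContDiffAt ℝ ∞ (fun q : ℝ × (Fin m → ℂ) => f q.1 q.2) (t, z)) (c : ℂ) (j : Fin m) :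
    ContDiffAt ℝ ∞ (fun q : ℝ × (Fin m → ℂ) => wirt c j (f q.1) q.2) (t, z) := by
  set F : ℝ × (Fin m → ℂ) → ℂ := fun q => f q.1 q.2 with hF
  have e1 : (fun q : ℝ × (Fin m → ℂ) => wirt c j (f q.1) q.2) =ᶠ[𝓝 (t, z)] fun q =>
      (1 / 2) * (fderiv ℝ F q (0, Pi.single j 1) + c * fderiv ℝ F q (0,
          Pi.single j Complex.I)) := by
    filter_upwards [eventually_differentiableAt hf] with q hq
    have : HasFDerivAt (f q.1) ((fderiv ℝ F q).comp (ContinuousLinearMap.inr ℝ ℝ _)) q.2 :=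
      HasFDerivAt.comp (g := F) (f := fun y => (q.1, y)) q.2 hq.hasFDerivAt
        (hasFDerivAt_prodMk_right q.1 q.2)
    simp only [wirt, this.fderiv]
    simp
  refine ContDiffAt.congr_of_eventuallyEq ?_ e1
  exact contDiffAt_const.mul ((ContDiffAt.fderiv_apply_const hf _).add
    (contDiffAt_const.mul (ContDiffAt.fderiv_apply_const hf _)))

end Wirtinger

/-! ### The Lichnerowicz operator in a differential ring -/

section KahlerAlgebra

theorem sum_rotate {ι R : Type*} [Fintype ι] [AddCommMonoid R] (F : ι → ι → ι → R) :
    ∑ l, ∑ j, ∑ a, F l j a = ∑ a, ∑ l, ∑ j, F l j a := by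
  rw [Finset.sum_comm (s := Finset.univ) (t := Finset.univ) (f := fun a l => ∑ j, F l j a)]
  exact Finset.sum_congr rfl fun l _ => Finset.sum_comm

variable {ι R : Type*} [Fintype ι] [DecidableEq ι] [CommRing R]

/-- A Kähler metric `g` over a ring with commuting derivations `D j = ∂_j`, `Db k = ∂_k̄`, with
`L` a logarithm of the determinant of `g`. -/
structure KahlerRing (D Db : ι → Derivation ℤ R R) (g : Matrix ι ι R) (L : R) : Prop where
  isUnit : IsUnit g.det
  comm : ∀ j k r, D j (D k r) = D k (D j r)
  comm_bar : ∀ j k r, Db j (Db k r) = Db k (Db j r)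
  comm_mixed : ∀ j k r, D j (Db k r) = Db k (D j r)
  closed : ∀ l j k, D l (g j k) = D j (g l k)
  closed_bar : ∀ l j k, Db l (g j k) = Db k (g j l)
  det : ∀ a, D a g.det = g.det * D a L

/-- The `∂̄`-Laplacian `∑ g^{jk̄} ∂_j ∂_k̄ f`. -/
def algLap (D Db : ι → Derivation ℤ R R) (g : Matrix ι ι R) (f : R) : R :=
  ∑ j, ∑ k, g⁻¹ k j * D j (Db k f)

/-- The vector field `∇^{1,0} f`. -/
def algGrad (Db : ι → Derivation ℤ R R) (g : Matrix ι ι R) (f : R) (p : ι) : R :=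
  ∑ l, g⁻¹ l p * Db l f

namespace KahlerRing

variable {D Db : ι → Derivation ℤ R R} {g : Matrix ι ι R} {L : R}

theorem sum_inv_mul (h : KahlerRing D Db g L) (p k : ι) :
    ∑ q, g⁻¹ q k * g p q = if p = k then 1 else 0 := by
  have := congrFun (congrFun (Matrix.mul_nonsing_inv g h.isUnit) p) k
  rw [Matrix.mul_apply, Matrix.one_apply] at this
  rw [← this]
  exact Finset.sum_congr rfl fun _ _ => mul_comm _ _

theorem sum_inv_mul' (h : KahlerRing D Db g L) (l q : ι) :
    ∑ p, g⁻¹ l p * g p q = if l = q then 1 else 0 := by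
  have := congrFun (congrFun (Matrix.nonsing_inv_mul g h.isUnit) l) q
  rwa [Matrix.mul_apply, Matrix.one_apply] at this

theorem deriv_inv (h : KahlerRing D Db g L) (a k j : ι) :
    D a (g⁻¹ k j) = -∑ p, ∑ q, g⁻¹ k p * D a (g p q) * g⁻¹ q j := by
  have := congrFun (congrFun (derivation_inv (D a) g h.isUnit) k) j
  simp only [Matrix.map_apply, Matrix.neg_apply, Matrix.mul_apply, Finset.sum_mul] at this
  rw [this, Finset.sum_comm]

theorem deriv_log (h : KahlerRing D Db g L) (a : ι) :
    D a L = ∑ k, ∑ j, g⁻¹ k j * D a (g j k) := by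
  have h1 := derivation_det (D a) g h.isUnit
  rw [h.det] at h1
  have h2 := h.isUnit.mul_left_cancel h1
  rw [h2]
  simp [Matrix.trace, Matrix.mul_apply]

/-- Jacobi's formula with the free index exchanged by closedness, the shape in which `∂ log det g`
turns up in `lich_inner`. -/
theorem deriv_log' (h : KahlerRing D Db g L) (a : ι) :
    D a L = ∑ k, ∑ j, g⁻¹ k j * D j (g a k) := by
  rw [h.deriv_log]
  exact Finset.sum_congr rfl fun k _ => Finset.sum_congr rfl fun j _ => by rw [h.closed]

/-- Closedness exchanges the index of differentiation with the first index of `g`, and the trace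
that arises is `∂ log det g`. This is why divergences involve no Christoffel symbols. -/
theorem sum_deriv_inv (h : KahlerRing D Db g L) (q : ι) :
    ∑ k, D k (g⁻¹ q k) = -∑ p, g⁻¹ q p * D p L := by
  simp only [h.deriv_inv, Finset.sum_neg_distrib, neg_inj, h.deriv_log, Finset.mul_sum]
  rw [Finset.sum_comm]
  refine Finset.sum_congr rfl fun p _ => ?_
  rw [Finset.sum_comm]
  refine Finset.sum_congr rfl fun s _ => Finset.sum_congr rfl fun k _ => ?_
  rw [h.closed]; ring

/-- The divergence of `g^{kq̄} Y_q̄`. -/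
theorem divergence (h : KahlerRing D Db g L) (Y : ι → R) :
    ∑ k, (D k (∑ q, g⁻¹ q k * Y q) + D k L * ∑ q, g⁻¹ q k * Y q) =
      ∑ k, ∑ q, g⁻¹ q k * D k (Y q) := by
  have h1 := fun q => h.sum_deriv_inv q
  -- The terms in which `g⁻¹` is differentiated cancel those containing `∂L`.
  have h2 : ∑ q, Y q * (∑ k, D k (g⁻¹ q k) + ∑ p, g⁻¹ q p * D p L) = 0 := by
    simp [h1]
  rw [← add_zero (∑ k, ∑ q, g⁻¹ q k * D k (Y q)), ← h2]
  simp only [map_sum, Derivation.leibniz, smul_eq_mul, mul_add,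
    Finset.sum_add_distrib, Finset.mul_sum]
  rw [Finset.sum_comm (f := fun q k => Y q * D k (g⁻¹ q k)),
    Finset.sum_comm (f := fun q k => Y q * (g⁻¹ q k * D k L)), add_assoc]
  refine congrArg₂ _ rfl (congrArg₂ _ rfl ?_)
  exact Finset.sum_congr rfl fun k _ => Finset.sum_congr rfl fun q _ => by ring

theorem deriv_det_mul_sum (h : KahlerRing D Db g L) (Y : ι → R) :
    ∑ k, D k (g.det * ∑ q, g⁻¹ q k * Y q) = g.det * ∑ k, ∑ q, g⁻¹ q k * D k (Y q) := by
  rw [← h.divergence, Finset.mul_sum]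
  refine Finset.sum_congr rfl fun k _ => ?_
  rw [Derivation.leibniz, h.det]
  simp only [smul_eq_mul]; ring

theorem lower_grad (h : KahlerRing D Db g L) (f : R) (q : ι) :
    ∑ p, g p q * algGrad Db g f p = Db q f := by
  simp only [algGrad, Finset.mul_sum]
  rw [Finset.sum_comm]
  have : ∀ l, ∑ p, g p q * (g⁻¹ l p * Db l f) = (if l = q then 1 else 0) * Db l f := by
    intro l
    rw [← h.sum_inv_mul', Finset.sum_mul]
    exact Finset.sum_congr rfl fun _ _ => by ring
  simp [this]

/-- Lowering the index of `∂̄∇^{1,0} f` gives a symmetric tensor: in the derivative of `g ∇f = ∂̄f`,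
the second derivatives of `f` are symmetric, and the derivatives of `g` are so by closedness. -/
theorem lower_dbar_grad (h : KahlerRing D Db g L) (f : R) (j q : ι) :
    ∑ p, g p j * Db q (algGrad Db g f p) = ∑ p, g p q * Db j (algGrad Db g f p) := by
  have h1 := congrArg (Db q) (h.lower_grad f j)
  have h2 := congrArg (Db j) (h.lower_grad f q)
  rw [h.comm_bar, ← h2] at h1
  simp only [map_sum, Derivation.leibniz, smul_eq_mul, Finset.sum_add_distrib] at h1
  have h3 : ∑ p, algGrad Db g f p * Db q (g p j) = ∑ p, algGrad Db g f p * Db j (g p q) :=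
    Finset.sum_congr rfl fun p _ => by rw [h.closed_bar]
  rw [h3] at h1
  exact add_right_cancel h1

theorem sum_div_grad (h : KahlerRing D Db g L) (f : R) :
    ∑ p, (D p (algGrad Db g f p) + D p L * algGrad Db g f p) = algLap D Db g f :=
  h.divergence fun q => Db q f

/-- This is the inner divergence in `𝓓*`. By `lower_dbar_grad` the roles of `j` and `q` can be
exchanged; then the metric cancels its inverse and the divergence of `∂̄_j ∇f` remains. Moving
`∂̄_j` out of the divergence costs the Ricci term `∂_j̄ ∂_a L`. -/
theorem lich_inner (h : KahlerRing D Db g L) (f : R) (j : ι) :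
    ∑ k, ∑ q, g⁻¹ q k * D k (∑ p, g p j * Db q (algGrad Db g f p)) =
      Db j (algLap D Db g f) - ∑ a, Db j (D a L) * algGrad Db g f a := by
  have h1 : ∑ k, ∑ q, g⁻¹ q k * D k (∑ p, g p j * Db q (algGrad Db g f p)) =
      ∑ p, (D p (Db j (algGrad Db g f p)) + D p L * Db j (algGrad Db g f p)) := by
    simp only [h.lower_dbar_grad f j, map_sum, Derivation.leibniz, smul_eq_mul, mul_add,
      Finset.sum_add_distrib, Finset.mul_sum]
    congr 1
    · have : ∀ k p, ∑ q, g⁻¹ q k * (g p q * D k (Db j (algGrad Db g f p))) =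
          (if p = k then 1 else 0) * D k (Db j (algGrad Db g f p)) := by
        intro k p
        rw [← h.sum_inv_mul, Finset.sum_mul]
        exact Finset.sum_congr rfl fun _ _ => by ring
      refine Finset.sum_congr rfl fun k _ => ?_
      rw [Finset.sum_comm]
      simp [this]
    · simp only [h.deriv_log', Finset.sum_mul]
      rw [Finset.sum_comm]
      rw [Finset.sum_comm (f := fun p k => ∑ i, g⁻¹ k i * D i (g p k) * Db j (algGrad Db g f p))]
      refine Finset.sum_congr rfl fun q _ => ?_
      rw [Finset.sum_comm]
      exact Finset.sum_congr rfl fun p _ => Finset.sum_congr rfl fun k _ => by ring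
  rw [h1, ← h.sum_div_grad, map_sum, ← Finset.sum_sub_distrib]
  refine Finset.sum_congr rfl fun p _ => ?_
  simp only [map_add, Derivation.leibniz, smul_eq_mul, h.comm_mixed]
  ring

/-- With the formula for the derivative of an inverse, the symmetry in `j` and `s` is once more
closedness of `g`. It makes the terms of first order in `f` cancel in `lich_eq`. -/
theorem sum_inv_mul_deriv_inv_symm (h : KahlerRing D Db g L) (j s a : ι) :
    ∑ l, g⁻¹ j l * D l (g⁻¹ s a) = ∑ l, g⁻¹ s l * D l (g⁻¹ j a) := by
  simp only [h.deriv_inv, mul_neg, Finset.sum_neg_distrib, Finset.mul_sum]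
  rw [Finset.sum_comm]
  congr 1
  refine Finset.sum_congr rfl fun p _ => Finset.sum_congr rfl fun l _ =>
    Finset.sum_congr rfl fun q _ => ?_
  rw [h.closed]; ring

/-- `𝓓*𝓓 f = Δ² f + ⟨Ric, ∂∂̄ f⟩` for a metric of constant scalar curvature. -/
theorem lich_eq (h : KahlerRing D Db g L) (hS : ∀ a, D a (algLap D Db g L) = 0) (f : R) {u : R}
    (hu : u * g.det = 1) :
    u * ∑ l, D l (∑ j, g⁻¹ j l * ∑ k, D k (g.det * ∑ p, ∑ q, g p j * g⁻¹ q k *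
        Db q (algGrad Db g f p))) =
      algLap D Db g (algLap D Db g f) -
        ∑ l, ∑ j, ∑ a, ∑ s, g⁻¹ j l * g⁻¹ s a * Db j (D a L) * D l (Db s f) := by
  have h1 : ∀ j, ∑ k, D k (g.det * ∑ p, ∑ q, g p j * g⁻¹ q k * Db q (algGrad Db g f p)) =
      g.det * (Db j (algLap D Db g f) - ∑ a, Db j (D a L) * algGrad Db g f a) := by
    intro j
    rw [← h.lich_inner, ← h.deriv_det_mul_sum]
    refine Finset.sum_congr rfl fun k _ => ?_
    congr 2
    rw [Finset.sum_comm]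
    simp only [Finset.mul_sum]
    exact Finset.sum_congr rfl fun _ _ => Finset.sum_congr rfl fun _ _ => by ring
  have h2 : ∀ l, ∑ j, g⁻¹ j l * ∑ k, D k (g.det * ∑ p, ∑ q, g p j * g⁻¹ q k *
      Db q (algGrad Db g f p)) = g.det * ∑ j, g⁻¹ j l *
        (Db j (algLap D Db g f) - ∑ a, Db j (D a L) * algGrad Db g f a) := by
    intro l
    simp only [h1]
    rw [Finset.mul_sum]
    exact Finset.sum_congr rfl fun _ _ => by ring
  simp only [h2]
  rw [h.deriv_det_mul_sum, ← mul_assoc, hu, one_mul]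
  simp only [map_sub, map_sum, mul_sub, Finset.sum_sub_distrib, Derivation.leibniz, smul_eq_mul]
  refine congrArg₂ _ rfl ?_
  -- Third derivatives of `L` are permuted so that the trace formed with `g⁻¹` becomes a derivative
  -- of `ΔL`.
  have hL3 : ∀ l j a, D l (Db j (D a L)) = D a (Db j (D l L)) := by
    intro l j a
    rw [h.comm_mixed, h.comm, ← h.comm_mixed]
  have hX : ∀ l a, D l (algGrad Db g f a) =
      ∑ s, (D l (g⁻¹ s a) * Db s f + g⁻¹ s a * D l (Db s f)) := by
    intro l a
    simp only [algGrad, map_sum, Derivation.leibniz, smul_eq_mul]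
    exact Finset.sum_congr rfl fun _ _ => by ring
  -- Constant scalar curvature enters here: third derivatives of `L` are traded for derivatives of
  -- `g⁻¹`.
  have hconst : ∀ a, ∑ l, ∑ j, g⁻¹ j l * D a (Db j (D l L)) =
      -∑ l, ∑ j, D a (g⁻¹ j l) * Db j (D l L) := by
    intro a
    have := hS a
    simp only [algLap, map_sum, Derivation.leibniz, smul_eq_mul, Finset.sum_add_distrib] at this
    simp only [h.comm_mixed] at this ⊢
    rw [eq_neg_of_add_eq_zero_left this]
    simp only [mul_comm]
  have e1 : ∑ l, ∑ j, g⁻¹ j l * ∑ a, algGrad Db g f a * D l (Db j (D a L)) =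
      -∑ l, ∑ j, ∑ a, ∑ s, g⁻¹ s a * Db s f * (D a (g⁻¹ j l) * Db j (D l L)) := by
    calc ∑ l, ∑ j, g⁻¹ j l * ∑ a, algGrad Db g f a * D l (Db j (D a L))
        = ∑ l, ∑ j, ∑ a, algGrad Db g f a * (g⁻¹ j l * D a (Db j (D l L))) := by
          refine Finset.sum_congr rfl fun l _ => Finset.sum_congr rfl fun j _ => ?_
          rw [Finset.mul_sum]
          refine Finset.sum_congr rfl fun a _ => ?_
          rw [hL3]; ring
      _ = ∑ a, algGrad Db g f a * ∑ l, ∑ j, g⁻¹ j l * D a (Db j (D l L)) := by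
          rw [sum_rotate]; simp only [Finset.mul_sum]
      _ = -∑ a, algGrad Db g f a * ∑ l, ∑ j, D a (g⁻¹ j l) * Db j (D l L) := by
          simp only [hconst, mul_neg, Finset.sum_neg_distrib]
      _ = _ := by
          simp only [Finset.mul_sum]
          rw [← sum_rotate fun l j a => algGrad Db g f a * (D a (g⁻¹ j l) * Db j (D l L))]
          simp only [algGrad, Finset.sum_mul]
  -- The right-hand side is what arises when `D l` differentiates `g⁻¹` inside `∇f`; together with
  -- `e1` this removes all terms of first order in `f`.
  have e2 : ∑ l, ∑ j, ∑ a, ∑ s, g⁻¹ s a * Db s f * (D a (g⁻¹ j l) * Db j (D l L)) =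
      ∑ l, ∑ j, ∑ a, ∑ s, g⁻¹ j l * (Db j (D a L) * (D l (g⁻¹ s a) * Db s f)) := by
    have lhs : ∑ l, ∑ j, ∑ a, ∑ s, g⁻¹ s a * Db s f * (D a (g⁻¹ j l) * Db j (D l L)) =
        ∑ l, ∑ j, ∑ s, Db s f * Db j (D l L) * ∑ a, g⁻¹ s a * D a (g⁻¹ j l) := by
      refine Finset.sum_congr rfl fun l _ => Finset.sum_congr rfl fun j _ => ?_
      rw [Finset.sum_comm]
      simp only [Finset.mul_sum]
      exact Finset.sum_congr rfl fun _ _ => Finset.sum_congr rfl fun _ _ => by ring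
    have rhs : ∑ l, ∑ j, ∑ a, ∑ s, g⁻¹ j l * (Db j (D a L) * (D l (g⁻¹ s a) * Db s f)) =
        ∑ l, ∑ j, ∑ s, Db s f * Db j (D l L) * ∑ a, g⁻¹ j a * D a (g⁻¹ s l) := by
      rw [Finset.sum_comm, Finset.sum_comm (s := Finset.univ (α := ι)) (t := Finset.univ (α := ι))
        (f := fun l j => ∑ s, Db s f * Db j (D l L) * ∑ a, g⁻¹ j a * D a (g⁻¹ s l))]
      refine Finset.sum_congr rfl fun j _ => ?_
      rw [Finset.sum_comm]
      refine Finset.sum_congr rfl fun a _ => ?_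
      rw [Finset.sum_comm]
      simp only [Finset.mul_sum]
      exact Finset.sum_congr rfl fun _ _ => Finset.sum_congr rfl fun _ _ => by ring
    rw [lhs, rhs]
    simp only [fun j s l => h.sum_inv_mul_deriv_inv_symm j s l]
  calc ∑ l, ∑ j, g⁻¹ j l * ∑ a, (Db j (D a L) * D l (algGrad Db g f a) +
        algGrad Db g f a * D l (Db j (D a L)))
      = ∑ l, ∑ j, g⁻¹ j l * ∑ a, Db j (D a L) * D l (algGrad Db g f a) +
          ∑ l, ∑ j, g⁻¹ j l * ∑ a, algGrad Db g f a * D l (Db j (D a L)) := by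
        simp only [Finset.sum_add_distrib, mul_add]
    _ = (∑ l, ∑ j, ∑ a, ∑ s, g⁻¹ j l * (Db j (D a L) * (D l (g⁻¹ s a) * Db s f)) +
          ∑ l, ∑ j, ∑ a, ∑ s, g⁻¹ j l * (Db j (D a L) * (g⁻¹ s a * D l (Db s f)))) -
          ∑ l, ∑ j, ∑ a, ∑ s, g⁻¹ j l * (Db j (D a L) * (D l (g⁻¹ s a) * Db s f)) := by
        rw [e1, e2, ← sub_eq_add_neg]
        refine congrArg₂ _ ?_ rfl
        simp only [hX, Finset.mul_sum, Finset.sum_add_distrib, mul_add]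
    _ = _ := by
        rw [add_sub_cancel_left]
        exact Finset.sum_congr rfl fun _ _ => Finset.sum_congr rfl fun _ _ =>
          Finset.sum_congr rfl fun _ _ => Finset.sum_congr rfl fun _ _ => by ring

end KahlerRing

end KahlerAlgebra

/-! ### Exponentials and logarithms of germs -/

section Exponential

variable {E : Type*} [NormedAddCommGroup E] [NormedSpace ℝ E] {p : E}

/-- The chain rule. With `f = log det g` and `s = det g` it leads to the field `det` of
`KahlerRing`. -/
theorem dirD_of_rep_exp {f : E → ℂ} {r s : smoothGerms p} (hf : Rep f r)
    (hs : Rep (fun y => Complex.exp (f y)) s) (v : E) : dirD v s = s * dirD v r := by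
  refine (hs.dirD v).unique ((hs.mul (hf.dirD v)).congr ?_)
  filter_upwards [eventually_differentiableAt hf.contDiffAt] with y hy
  rw [(hy.hasFDerivAt.cexp).fderiv]
  simp

theorem wirtD_of_rep_exp {f : E → ℂ} {r s : smoothGerms p} (hf : Rep f r)
    (hs : Rep (fun y => Complex.exp (f y)) s) (c : ℂ) (v w : E) :
    wirtD c v w s = s * wirtD c v w r := by
  simp only [wirtD_apply, dirD_of_rep_exp hf hs]
  ring

theorem contDiffAt_log {f : E → ℂ} (hf : ContDiffAt ℝ ∞ f p) (h0 : f p ∈ Complex.slitPlane) :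
    ContDiffAt ℝ ∞ (fun y => Complex.log (f y)) p :=
  ((Complex.contDiffAt_log h0).restrict_scalars ℝ).comp p hf

end Exponential

/-! ### Inverse, determinant and log-determinant along a line of matrices -/

section AffineFamilies

variable {κ : Type*} [Fintype κ] [DecidableEq κ]

theorem hasDerivAt_of_rep {f : ℝ → ℂ} {r : smoothGerms (0 : ℝ)} (hf : Rep f r) :
    HasDerivAt f (evalG 0 (dirD 1 r)) 0 := by
  rw [(hf.dirD 1).eval]
  have := (eventually_differentiableAt hf.contDiffAt).self_of_nhds.hasFDerivAt.hasDerivAt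
  simpa using this

/-- Through this the identities for derivations of a ring apply with `D = d/dt` on germs at `0 ∈ ℝ`.
-/
theorem exists_rep_affine (A B : Matrix κ κ ℂ) : ∃ γ : Matrix κ κ (smoothGerms (0 : ℝ)),
    (∀ a b, Rep (fun t : ℝ => (A + (t : ℂ) • B) a b) (γ a b)) ∧
      (evalG 0).mapMatrix γ = A ∧ (evalG 0).mapMatrix (γ.map (dirD 1)) = B := by
  have hs : ∀ a b, ContDiffAt ℝ ∞ (fun t : ℝ => (A + (t : ℂ) • B) a b) 0 := fun a b => by
    simp only [Matrix.add_apply, Matrix.smul_apply, smul_eq_mul]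
    exact contDiffAt_const.add (Complex.ofRealCLM.contDiff.contDiffAt.mul contDiffAt_const)
  choose γ hγ using fun a b => exists_rep_of_contDiffAt (hs a b)
  refine ⟨Matrix.of γ, hγ, ?_, ?_⟩
  · ext a b
    simpa using (hγ a b).eval
  · ext a b
    have h2 : HasDerivAt (fun t : ℝ => (A + (t : ℂ) • B) a b) (B a b) 0 := by
      simp only [Matrix.add_apply, Matrix.smul_apply, smul_eq_mul]
      simpa using ((Complex.ofRealCLM.hasDerivAt (x := (0 : ℝ))).mul_const (B a b)).const_add (A a
          b)
    simpa using (hasDerivAt_of_rep (hγ a b)).unique h2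

theorem hasDerivAt_inv_affine (A B : Matrix κ κ ℂ) (hA : A.det ≠ 0) (a b : κ) :
    HasDerivAt (fun t : ℝ => (A + (t : ℂ) • B)⁻¹ a b) (-(A⁻¹ * B * A⁻¹) a b) 0 := by
  obtain ⟨γ, hγ, hA', hB'⟩ := exists_rep_affine A B
  have h0 : (A + ((0 : ℝ) : ℂ) • B).det ≠ 0 := by simpa using hA
  have h1 := hasDerivAt_of_rep (Rep.inv hγ h0 a b)
  have h2 := congrFun (congrFun (derivation_inv (dirD 1) γ (isUnit_det_of_rep hγ h0)) a) b
  have h3 : (evalG 0).mapMatrix γ⁻¹ = A⁻¹ := by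
    refine (Matrix.inv_eq_right_inv ?_).symm
    rw [← hA', ← map_mul, Matrix.mul_nonsing_inv _ (isUnit_det_of_rep hγ h0), map_one]
  refine h1.congr_deriv ?_
  rw [Matrix.map_apply] at h2
  rw [h2, ← h3, ← hB', ← map_mul, ← map_mul]
  simp

theorem hasDerivAt_det_affine (A B : Matrix κ κ ℂ) (hA : A.det ≠ 0) :
    HasDerivAt (fun t : ℝ => (A + (t : ℂ) • B).det) (A.det * (A⁻¹ * B).trace) 0 := by
  obtain ⟨γ, hγ, hA', hB'⟩ := exists_rep_affine A B
  have h0 : (A + ((0 : ℝ) : ℂ) • B).det ≠ 0 := by simpa using hA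
  have h1 := hasDerivAt_of_rep (Rep.det hγ)
  have h3 : (evalG 0).mapMatrix γ⁻¹ = A⁻¹ := by
    refine (Matrix.inv_eq_right_inv ?_).symm
    rw [← hA', ← map_mul, Matrix.mul_nonsing_inv _ (isUnit_det_of_rep hγ h0), map_one]
  refine h1.congr_deriv ?_
  rw [derivation_det (dirD 1) γ (isUnit_det_of_rep hγ h0), map_mul, RingHom.map_det, hA', ← h3,
    ← hB', ← map_mul]
  simp only [Matrix.trace, Matrix.diag, RingHom.mapMatrix_apply, Matrix.map_apply, map_sum]

theorem hasDerivAt_log_det_affine (A B : Matrix κ κ ℂ) (hA : A.det ∈ Complex.slitPlane) :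
    HasDerivAt (fun t : ℝ => Complex.log (A + (t : ℂ) • B).det) (A⁻¹ * B).trace 0 := by
  have h0 := Complex.slitPlane_ne_zero hA
  refine ((hasDerivAt_det_affine A B h0).clog_real (by simpa using hA)).congr_deriv ?_
  simp [mul_div_cancel_left₀ _ h0]

end AffineFamilies

/-! ### Linearization of the scalar curvature -/

section ScalarCurvature

variable {m : ℕ} {z : Fin m → ℂ} {om : (Fin m → ℂ) → Matrix (Fin m) (Fin m) ℂ}

/-- The `-i` of `Λ`, the `i` of the Ricci form and the minus sign in `dbard` multiply to `-1`. -/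
theorem scalarCurvLoc_eq (om : (Fin m → ℂ) → Matrix (Fin m) (Fin m) ℂ) (z : Fin m → ℂ) :
    scalarCurvLoc om z = -2 * ∑ j, ∑ k, (metricMatrix (om z))⁻¹ k j *
      wdbar k (wd j fun y => Complex.log (metricMatrix (om y)).det) z := by
  simp only [scalarCurvLoc, Lam, ricciForm, invMetric, dbard, Matrix.smul_apply, Matrix.of_apply,
    smul_eq_mul, Finset.mul_sum]
  refine Finset.sum_congr rfl fun j _ => Finset.sum_congr rfl fun k _ => ?_
  ring_nf
  simp only [Complex.I_sq]
  ring

theorem det_mem_slitPlane_of_posDef {κ : Type*} [Fintype κ] [DecidableEq κ] {A : Matrix κ κ ℂ}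
    (hA : A.PosDef) : A.det ∈ Complex.slitPlane := by
  have := hA.det_pos
  rw [Complex.lt_def] at this
  exact Or.inl (by simpa using this.1)

/-- The conjugate closedness relation is not assumed: it follows from closedness by conjugation,
since `g` is Hermitian near `z`. -/
theorem exists_kahlerRing (hom : ∀ j k, ContDiffAt ℝ ∞ (fun y => om y j k) z)
    (hpos : ∀ᶠ y in 𝓝 z, (metricMatrix (om y)).PosDef)
    (hclosed : ∀ᶠ y in 𝓝 z, ∀ j k l, wd l (fun y => om y j k) y = wd j (fun y => om y l k) y) :
    ∃ (γ : Matrix (Fin m) (Fin m) (smoothGerms z)) (L : smoothGerms z),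
    KahlerRing (hol z) (ahol z) γ L ∧ (∀ j k, Rep (fun y => metricMatrix (om y) j k) (γ j k)) ∧
      Rep (fun y => Complex.log (metricMatrix (om y)).det) L := by
  have hs : ∀ j k, ContDiffAt ℝ ∞ (fun y => metricMatrix (om y) j k) z := fun j k =>
    contDiffAt_const.mul (hom j k)
  choose γ hγ using fun j k => exists_rep_of_contDiffAt (hs j k)
  have hdet := det_mem_slitPlane_of_posDef hpos.self_of_nhds
  have hdetrep := Rep.det (γ := Matrix.of γ) hγ
  obtain ⟨L, hL⟩ := exists_rep_of_contDiffAt (contDiffAt_log hdetrep.contDiffAt hdet)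
  have hclosed' : ∀ l j k, hol z l (γ j k) = hol z j (γ l k) := by
    intro l j k
    choose o ho using fun j k => exists_rep_of_contDiffAt (hom j k)
    have h1 : ∀ j k, γ j k = cst z (-Complex.I) * o j k := fun j k =>
      (hγ j k).unique ((Rep.cst _).mul (ho j k))
    have h2 : hol z l (o j k) = hol z j (o l k) := by
      refine ((ho j k).wd l).unique (((ho l k).wd j).congr ?_)
      filter_upwards [hclosed] with y hy using (hy j k l).symm
    simp only [h1, Derivation.leibniz, hol_cst, h2]
    simp
  have hherm : ∀ᶠ y in 𝓝 z, ∀ j k, metricMatrix (om y) j k = conj (metricMatrix (om y) k j) := by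
    filter_upwards [hpos] with y hy j k
    exact (hy.isHermitian.apply j k).symm
  refine ⟨Matrix.of γ, L, ⟨isUnit_det_of_rep (γ := Matrix.of γ) hγ (Complex.slitPlane_ne_zero hdet),
    hol_comm, ahol_comm, hol_ahol_comm, hclosed', ?_, ?_⟩, hγ, hL⟩
  · intro l j k
    have h2 : ∀ j k, Rep (fun y => conj (metricMatrix (om y) k j)) (γ j k) := fun j k =>
      (hγ j k).congr (hherm.mono fun y hy => hy j k)
    refine ((h2 j k).wdbar l).unique (((h2 j l).wdbar k).congr ?_)
    have h3 := (((hγ k j).wd l).eventuallyEq (hclosed' l k j ▸ (hγ l j).wd k))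
    filter_upwards [h3] with y hy
    rw [wdbar_conj, wdbar_conj, hy]
  · intro a
    have h3 : Rep (fun y => Complex.exp (Complex.log (metricMatrix (om y)).det))
        (Matrix.of γ).det := hdetrep.congr <| hpos.mono fun y hy => by
      exact (Complex.exp_log (Complex.slitPlane_ne_zero (det_mem_slitPlane_of_posDef hy))).symm
    exact wirtD_of_rep_exp hL h3 _ _ _

theorem rep_lap {om : (Fin m → ℂ) → Matrix (Fin m) (Fin m) ℂ}
    {γ : Matrix (Fin m) (Fin m) (smoothGerms z)}
    (hinv : ∀ j k, Rep (fun y => (metricMatrix (om y))⁻¹ j k) (γ⁻¹ j k))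
    {f : (Fin m → ℂ) → ℂ} {r : smoothGerms z} (hf : Rep f r) :
    Rep (fun y => ∑ j, ∑ k, (metricMatrix (om y))⁻¹ k j * wdbar k (wd j f) y)
      (algLap (hol z) (ahol z) γ r) := by
  refine Rep.sum fun j _ => Rep.sum fun k _ => (hinv k j).mul ?_
  rw [hol_ahol_comm]
  exact (hf.wd j).wdbar k

/-- The `i` of `i ∂̄∂η` cancels the `-i` of `metricMatrix`, so the metric moves on a line with
direction `dbard η`. -/
theorem metricMatrix_add_smul_dbard (om : Matrix (Fin m) (Fin m) ℂ) (B : Matrix (Fin m) (Fin m) ℂ)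
    (t : ℂ) : metricMatrix (om + t • (Complex.I • B)) = metricMatrix om + t • B := by
  simp only [metricMatrix, smul_add, smul_smul]
  congr 2
  ring_nf
  simp

/-- This is `KahlerRing.lich_eq` evaluated at `z`. The scalar curvature must be constant near `z`,
since its derivative enters. -/
theorem lich_eq_local (hom : ∀ j k, ContDiffAt ℝ ∞ (fun y => om y j k) z)
    (hpos : ∀ᶠ y in 𝓝 z, (metricMatrix (om y)).PosDef)
    (hclosed : ∀ᶠ y in 𝓝 z, ∀ j k l, wd l (fun y => om y j k) y = wd j (fun y => om y l k) y)
    {η : (Fin m → ℂ) → ℂ} (hη : ContDiffAt ℝ ∞ η z)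
    (hcsc : ∃ c : ℂ, ∀ᶠ y in 𝓝 z, scalarCurvLoc om y = c) :
    lichDStar om (lichD om η) z =
      (∑ j, ∑ k, (metricMatrix (om z))⁻¹ k j * wdbar k (wd j fun y =>
        ∑ j, ∑ k, (metricMatrix (om y))⁻¹ k j * wdbar k (wd j η) y) z) -
      ∑ l, ∑ j, ∑ a, ∑ s, (metricMatrix (om z))⁻¹ j l * (metricMatrix (om z))⁻¹ s a *
        wdbar j (wd a fun y => Complex.log (metricMatrix (om y)).det) z *
          wdbar s (wd l η) z := by
  obtain ⟨γ, L, hK, hγ, hL⟩ := exists_kahlerRing hom hpos hclosed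
  obtain ⟨e, he⟩ := exists_rep_of_contDiffAt hη
  have hdet0 := Complex.slitPlane_ne_zero (det_mem_slitPlane_of_posDef hpos.self_of_nhds)
  have hinv := Rep.inv hγ hdet0
  have hdetrep := Rep.det hγ
  have hS : ∀ a, hol z a (algLap (hol z) (ahol z) γ L) = 0 := by
    intro a
    obtain ⟨c, hc⟩ := hcsc
    have h1 : algLap (hol z) (ahol z) γ L = cst z (-1 / 2 * c) := by
      refine (rep_lap hinv hL).unique ((Rep.cst _).congr ?_)
      filter_upwards [hc] with y hy
      rw [← hy, scalarCurvLoc_eq]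
      ring
    rw [h1, hol_cst]
  have hgrad : ∀ p, Rep (fun y => ∑ l, invMetric (om y) p l * wdbar l η y)
      (algGrad (ahol z) γ e p) := fun p =>
    Rep.sum fun l _ => (hinv l p).mul (he.wdbar l)
  have hmain := hK.lich_eq hS e (u := Ring.inverse γ.det) (Ring.inverse_mul_cancel _ hK.isUnit)
  have hlhs : Rep (fun y => ∑ l, wd l (fun y => ∑ j, invMetric (om y) l j *
      ∑ k, wd k (fun x => (metricMatrix (om x)).det *
      ∑ p, ∑ q, metricMatrix (om x) p j * invMetric (om x) k q * lichD om η p q x) y) y)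
      (∑ l, hol z l (∑ j, γ⁻¹ j l * ∑ k, hol z k (γ.det * ∑ p, ∑ q, γ p j * γ⁻¹ q k *
        ahol z q (algGrad (ahol z) γ e p)))) := by
    refine Rep.sum fun l _ => Rep.wd (Rep.sum fun j _ => (hinv j l).mul (Rep.sum fun k _ =>
      Rep.wd (hdetrep.mul (Rep.sum fun p _ => Rep.sum fun q _ => ?_)) k)) l
    exact ((hγ p j).mul (hinv q k)).mul ((hgrad p).wdbar q)
  have h1 : lichDStar om (lichD om η) z = evalG z (Ring.inverse γ.det * ∑ l, hol z l (∑ j, γ⁻¹ j l *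
      ∑ k, hol z k (γ.det * ∑ p, ∑ q, γ p j * γ⁻¹ q k *
        ahol z q (algGrad (ahol z) γ e p)))) := by
    rw [map_mul, hlhs.eval, lichDStar]
    congr 1
    rw [← hdetrep.eval]
    refine inv_eq_of_mul_eq_one_left ?_
    rw [← map_mul, Ring.inverse_mul_cancel _ hK.isUnit, map_one]
  rw [h1, hmain, map_sub, (rep_lap hinv (rep_lap hinv he)).eval]
  congr 1
  have h2 : Rep (fun y => ∑ l, ∑ j, ∑ a, ∑ s, (metricMatrix (om y))⁻¹ j l *
      (metricMatrix (om y))⁻¹ s a *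
        wdbar j (wd a fun y => Complex.log (metricMatrix (om y)).det) y *
          wdbar s (wd l η) y) (∑ l, ∑ j, ∑ a, ∑ s, γ⁻¹ j l * γ⁻¹ s a * ahol z j (hol z a L) *
            hol z l (ahol z s e)) := by
    refine Rep.sum fun l _ => Rep.sum fun j _ => Rep.sum fun a _ => Rep.sum fun s _ => ?_
    rw [hol_ahol_comm]
    exact (((hinv j l).mul (hinv s a)).mul ((hL.wd a).wdbar j)).mul ((he.wd l).wdbar s)
  exact h2.eval

/-- The linearization of the scalar curvature at a metric of constant scalar curvature. -/
theorem hasDerivAt_scalarCurvLoc (hom : ∀ j k, ContDiffAt ℝ ∞ (fun y => om y j k) z)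
    (hpos : ∀ᶠ y in 𝓝 z, (metricMatrix (om y)).PosDef)
    (hclosed : ∀ᶠ y in 𝓝 z, ∀ j k l, wd l (fun y => om y j k) y = wd j (fun y => om y l k) y)
    {η : (Fin m → ℂ) → ℂ} (hη : ContDiffAt ℝ ∞ η z)
    (hcsc : ∃ c : ℂ, ∀ᶠ y in 𝓝 z, scalarCurvLoc om y = c) :
    HasDerivAt (fun t : ℝ => scalarCurvLoc (fun y => om y + (t : ℂ) • (Complex.I • dbard η y)) z)
      (2 * lichDStar om (lichD om η) z) 0 := by
  have hdet0 := Complex.slitPlane_ne_zero (det_mem_slitPlane_of_posDef hpos.self_of_nhds)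
  have hmet : ∀ (t : ℝ) y, metricMatrix (om y + (t : ℂ) • (Complex.I • dbard η y)) =
      metricMatrix (om y) + (t : ℂ) • dbard η y := fun t y => metricMatrix_add_smul_dbard _ _ _
  have hsm : ∀ j k, ContDiffAt ℝ ∞ (fun y => dbard η y j k) z := by
    intro j k
    obtain ⟨e, he⟩ := exists_rep_of_contDiffAt hη
    exact ((he.wd j).wdbar k).neg.contDiffAt
  have hjoint : ContDiffAt ℝ ∞ (fun q : ℝ × (Fin m → ℂ) =>
      Complex.log (metricMatrix (om q.2) + (q.1 : ℂ) • dbard η q.2).det) (0, z) := by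
    have hs : ∀ j k, ContDiffAt ℝ ∞ (fun q : ℝ × (Fin m → ℂ) =>
        (metricMatrix (om q.2) + (q.1 : ℂ) • dbard η q.2) j k) (0, z) := by
      intro j k
      have h1 : ContDiffAt ℝ ∞ (fun q : ℝ × (Fin m → ℂ) => om q.2 j k) (0, z) :=
        (hom j k).comp (0, z) contDiffAt_snd
      have h2 : ContDiffAt ℝ ∞ (fun q : ℝ × (Fin m → ℂ) => dbard η q.2 j k) (0, z) :=
        (hsm j k).comp (0, z) contDiffAt_snd
      have h3 : ContDiffAt ℝ ∞ (fun q : ℝ × (Fin m → ℂ) => (q.1 : ℂ)) (0, z) :=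
        Complex.ofRealCLM.contDiff.contDiffAt.comp (0, z) contDiffAt_fst
      exact (contDiffAt_const.mul h1).add (h3.mul h2)
    choose γ hγ using fun j k => exists_rep_of_contDiffAt (hs j k)
    refine contDiffAt_log (Rep.det (γ := Matrix.of γ) hγ).contDiffAt ?_
    simpa using det_mem_slitPlane_of_posDef hpos.self_of_nhds
  -- By `δ log det g = tr (g⁻¹ δg)` with `δg = -∂∂̄η`, the logarithm of the determinant moves by
  -- minus the Laplacian of `η`. This is needed near `z`, because two more derivatives are taken.
  have hder : ∀ᶠ y in 𝓝 z, HasDerivAt (fun t : ℝ =>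
      Complex.log (metricMatrix (om y) + (t : ℂ) • dbard η y).det)
      (-∑ j, ∑ k, (metricMatrix (om y))⁻¹ k j * wdbar k (wd j η) y) 0 := by
    filter_upwards [hpos] with y hy
    refine (hasDerivAt_log_det_affine _ _ (det_mem_slitPlane_of_posDef hy)).congr_deriv ?_
    rw [Finset.sum_comm]
    simp [Matrix.trace, Matrix.mul_apply, dbard]
  -- Joint smoothness in `(t, z)` allows `d/dt` to pass through the two Wirtinger derivatives one
  -- after the other.
  have hder2 : ∀ j k, HasDerivAt (fun t : ℝ => wdbar k (wd j fun y =>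
      Complex.log (metricMatrix (om y) + (t : ℂ) • dbard η y).det) z)
      (wdbar k (wd j fun y => -∑ j, ∑ k, (metricMatrix (om y))⁻¹ k j * wdbar k (wd j η) y) z) 0 :=
          by
    intro j k
    simp only [wd_eq_wirt, wdbar_eq_wirt] at hder ⊢
    have hj1 := (contDiffAt_wirt (f := fun (t : ℝ) y =>
      Complex.log (metricMatrix (om y) + (t : ℂ) • dbard η y).det) hjoint (-Complex.I) j).of_le
        (m := 2) (by norm_cast)
    refine hasDerivAt_wirt (f := fun t => wirt (-Complex.I) j fun y =>
      Complex.log (metricMatrix (om y) + (t : ℂ) • dbard η y).det) hj1 ?_ _ _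
    have hj2 := (hjoint.of_le (m := 2) (by norm_cast)).eventually (by simp)
    have ht : Tendsto (fun y : Fin m → ℂ => ((0 : ℝ), y)) (𝓝 z) (𝓝 ((0 : ℝ), z)) :=
      (Continuous.prodMk_right 0).tendsto z
    filter_upwards [ht.eventually hj2, hder.eventually_nhds] with y hy1 hy2
    exact hasDerivAt_wirt (f := fun t y =>
      Complex.log (metricMatrix (om y) + (t : ℂ) • dbard η y).det) hy1 hy2 _ _
  have hinv : ∀ j k, HasDerivAt (fun t : ℝ =>
      (metricMatrix (om z) + (t : ℂ) • dbard η z)⁻¹ k j) _ 0 := fun j k =>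
    hasDerivAt_inv_affine _ _ hdet0 k j
  have hfin := (HasDerivAt.fun_sum (u := Finset.univ) fun j _ =>
    HasDerivAt.fun_sum (u := Finset.univ) fun k _ => (hinv j k).mul (hder2 j k)).const_mul (-2 : ℂ)
  simp only [scalarCurvLoc_eq, hmet]
  refine hfin.congr_deriv ?_
  rw [lich_eq_local hom hpos hclosed hη hcsc]
  have hneg : ∀ j k, wdbar k (wd j fun y =>
      -∑ j, ∑ k, (metricMatrix (om y))⁻¹ k j * wdbar k (wd j η) y) z = -wdbar k (wd j fun y =>
      ∑ j, ∑ k, (metricMatrix (om y))⁻¹ k j * wdbar k (wd j η) y) z := by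
    intro j k
    obtain ⟨γ, L, hK, hγ, hL⟩ := exists_kahlerRing hom hpos hclosed
    obtain ⟨e, he⟩ := exists_rep_of_contDiffAt hη
    have h := rep_lap (Rep.inv hγ hdet0) he
    rw [← ((h.neg.wd j).wdbar k).eval, map_neg, map_neg, map_neg, ((h.wd j).wdbar k).eval]
  simp only [hneg, Complex.ofReal_zero, zero_smul, add_zero, Finset.sum_add_distrib, mul_neg,
    neg_mul, Finset.sum_neg_distrib]
  -- The contribution of `δ(g⁻¹) = -g⁻¹ (δg) g⁻¹`, which is the Ricci term of `𝓓*𝓓`; the sign comes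
  -- from `δg = -∂∂̄η`.
  have hquad : ∑ j, ∑ k, ((metricMatrix (om z))⁻¹ * dbard η z * (metricMatrix (om z))⁻¹) k j *
      wdbar k (wd j fun y => Complex.log (metricMatrix (om y)).det) z =
      -∑ l, ∑ j, ∑ a, ∑ s, (metricMatrix (om z))⁻¹ j l * (metricMatrix (om z))⁻¹ s a *
        wdbar j (wd a fun y => Complex.log (metricMatrix (om y)).det) z * wdbar s (wd l η) z := by
    rw [← sum_rotate (F := fun k a j => ∑ s, (metricMatrix (om z))⁻¹ k j *
      (metricMatrix (om z))⁻¹ s a * wdbar k (wd a fun y =>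
        Complex.log (metricMatrix (om y)).det) z * wdbar s (wd j η) z), Finset.sum_comm,
      ← Finset.sum_neg_distrib]
    refine Finset.sum_congr rfl fun k _ => ?_
    rw [← Finset.sum_neg_distrib]
    refine Finset.sum_congr rfl fun a _ => ?_
    simp only [Matrix.mul_apply, dbard, Matrix.of_apply, Finset.sum_mul]
    rw [Finset.sum_comm, ← Finset.sum_neg_distrib]
    refine Finset.sum_congr rfl fun l _ => ?_
    rw [← Finset.sum_neg_distrib]
    refine Finset.sum_congr rfl fun s _ => ?_
    ring
  rw [hquad]
  ring

end ScalarCurvature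

/-! ### Algebra of symmetric powers -/

section SymAlgebra

variable {V V' V'' : Type*} [AddCommGroup V] [Module ℂ V] [AddCommGroup V'] [Module ℂ V']
  [AddCommGroup V''] [Module ℂ V''] {d : ℕ}

theorem symP_induction {P : SymP d V → Prop} (hprod : ∀ v, P (sprod v))
    (hadd : ∀ s t, P s → P t → P (s + t)) (hsmul : ∀ (c : ℂ) s, P s → P (c • s)) (h0 : P 0)
    (s : SymP d V) : P s := by
  have hs : s ∈ Submodule.span ℂ (Set.range (SymmetricPower.tprod ℂ (ι := Fin d) (M := V))) := by
    rw [SymmetricPower.span_tprod_eq_top]; trivial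
  induction hs using Submodule.span_induction with
  | mem x hx => obtain ⟨v, rfl⟩ := hx; exact hprod v
  | zero => exact h0
  | add x y _ _ hx hy => exact hadd x y hx hy
  | smul c x _ hx => exact hsmul c x hx

variable (V d) in
/-- `A ↦ S^d A` as a linear map. -/
def symDerL : Module.End ℂ V →ₗ[ℂ] Module.End ℂ (SymP d V) where
  toFun := symDer d
  map_add' A B := symP_ext fun v => by
    rw [LinearMap.add_apply, symDer_sprod, symDer_sprod, symDer_sprod, ← Finset.sum_add_distrib]
    exact Finset.sum_congr rfl fun i _ =>
      (SymmetricPower.tprod ℂ).map_update_add v i (A (v i)) (B (v i))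
  map_smul' c A := symP_ext fun v => by
    rw [LinearMap.smul_apply, symDer_sprod, symDer_sprod, Finset.smul_sum]
    exact Finset.sum_congr rfl fun i _ =>
      (SymmetricPower.tprod ℂ).map_update_smul v i c (A (v i))

theorem symDerL_apply (A : Module.End ℂ V) : symDerL V d A = symDer d A := rfl

theorem symDer_one : symDer d (1 : Module.End ℂ V) = (d : ℂ) • (1 : Module.End ℂ (SymP d V)) :=
  symP_ext fun v => by
    rw [symDer_sprod]
    simp [Nat.cast_smul_eq_nsmul]

/-- In each summand `A` acts on one factor only, and the others pass through `σ ∘ τ`; no condition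
on `τ ∘ σ` is needed. -/
theorem symMap_comp_symDer_comp {σ : V →ₗ[ℂ] V'} {τ : V' →ₗ[ℂ] V} (h : σ ∘ₗ τ = LinearMap.id)
    (A : Module.End ℂ V) :
    symMap d σ ∘ₗ symDer d A ∘ₗ symMap d τ = symDer d (σ ∘ₗ A ∘ₗ τ) :=
  symP_ext fun v => by
    rw [LinearMap.comp_apply, LinearMap.comp_apply, symMap_sprod, symDer_sprod, symDer_sprod,
      map_sum]
    refine Finset.sum_congr rfl fun i _ => ?_
    rw [symMap_sprod]
    congr 1
    funext j
    by_cases hj : j = i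
    · subst hj; simp
    · simpa [hj] using LinearMap.congr_fun h (v j)

/-- Products of basis vectors span the symmetric power. -/
theorem sprod_eq_sum {κ : Type*} [Fintype κ] [DecidableEq κ] (b : Module.Basis κ ℂ V)
    (v : Fin d → V) :
    sprod v = ∑ I : Fin d → κ, (∏ k, b.repr (v k) (I k)) • sprod fun k => b (I k) := by
  have h1 : v = fun k => ∑ i, b.repr (v k) i • b i := funext fun k => (b.sum_repr (v k)).symm
  conv_lhs => rw [h1]
  refine (MultilinearMap.map_sum (SymmetricPower.tprod ℂ) fun k i => b.repr (v k) i • b i).trans ?_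
  exact Finset.sum_congr rfl fun I _ => MultilinearMap.map_smul_univ _ _ _

theorem symP_basis_induction {κ : Type*} [Fintype κ] [DecidableEq κ] (b : Module.Basis κ ℂ V)
    {P : SymP d V → Prop} (hprod : ∀ I : Fin d → κ, P (sprod fun k => b (I k)))
    (hadd : ∀ s t, P s → P t → P (s + t)) (hsmul : ∀ (c : ℂ) s, P s → P (c • s)) (h0 : P 0)
    (s : SymP d V) : P s := by
  refine symP_induction (fun v => ?_) hadd hsmul h0 s
  rw [sprod_eq_sum b]
  exact Finset.sum_induction _ P hadd h0 fun I _ => hsmul _ _ (hprod I)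

theorem exists_eq_sum_sprod {κ : Type*} [Fintype κ] [DecidableEq κ] (b : Module.Basis κ ℂ V)
    (s : SymP d V) : ∃ c : (Fin d → κ) → ℂ, s = ∑ I, c I • sprod fun k => b (I k) := by
  refine symP_basis_induction b (P := fun s => ∃ c : (Fin d → κ) → ℂ,
    s = ∑ I, c I • sprod fun k => b (I k)) (fun I => ?_) ?_ ?_ ?_ s
  · exact ⟨Pi.single I 1, by simp [Pi.single_apply]⟩
  · rintro _ _ ⟨c, rfl⟩ ⟨c', rfl⟩
    exact ⟨c + c', by simp [add_smul, Finset.sum_add_distrib]⟩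
  · rintro a _ ⟨c, rfl⟩
    exact ⟨a • c, by simp [Finset.smul_sum, smul_smul]⟩
  · exact ⟨0, by simp⟩

end SymAlgebra

/-! ### Positivity of `Sym^d h` -/

section SymPositive

variable {V : Type*} [AddCommGroup V] [Module ℂ V] {d : ℕ} {κ : Type*} [Fintype κ] [DecidableEq κ]

theorem IsHermInner.exists_orthonormal {h : Sesq V} (hh : IsHermInner h)
    (b : Module.Basis κ ℂ V) :
    ∃ e : Module.Basis κ ℂ V, ∀ i j, h (e i) (e j) = if i = j then 1 else 0 := by
  have hre : ∀ x, 0 ≤ (h x x).re := fun x => by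
    by_cases hx : x = 0
    · simp [hx]
    · exact (hh.2 x hx).le
  let core : InnerProductSpace.Core ℂ V :=
    -- Inner products in Mathlib are conjugate-linear in the first variable, hence the swap.
    { inner := fun x y => h y x
      conj_inner_symm := fun x y => by rw [← hh.1]
      re_inner_nonneg := fun x => hre x
      add_left := fun x y z => by simp
      smul_left := fun x y r => by simp
      definite := fun x hx => by
        by_contra h0
        have := hh.2 x h0
        rw [hx] at this
        simp at this }
  let : NormedAddCommGroup V := core.toNormedAddCommGroup
  let : InnerProductSpace ℂ V := InnerProductSpace.ofCore core.toCore
  have : FiniteDimensional ℂ V := Module.Finite.of_basis b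
  let o := (stdOrthonormalBasis ℂ V).reindex
    (Fintype.equivOfCardEq (by simp [Module.finrank_eq_card_basis b]) :
      Fin (Module.finrank ℂ V) ≃ κ)
  refine ⟨o.toBasis, fun i j => ?_⟩
  have := orthonormal_iff_ite.1 o.orthonormal j i
  rw [OrthonormalBasis.coe_toBasis]
  simp only [eq_comm (a := i)]
  exact this

theorem symForm_symm {h : Sesq V} (hh : ∀ u v, h v u = conj (h u v)) (s t : SymP d V) :
    symForm d h t s = conj (symForm d h s t) := by
  refine symP_induction (P := fun s => symForm d h t s = conj (symForm d h s t)) (fun v => ?_)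
    (fun s s' hs hs' => by simp [hs, hs']) (fun c s hs => by simp [hs]) (by simp) s
  refine symP_induction (P := fun t => symForm d h t (sprod v) = conj (symForm d h (sprod v) t))
    (fun w => ?_)
    (fun s s' hs hs' => by simp [hs, hs']) (fun c s hs => by simp [hs]) (by simp) t
  rw [symForm_sprod, symForm_sprod]
  simp only [map_mul, map_inv₀, map_natCast, map_sum, map_prod, ← hh]
  congr 1
  -- Exchanging the two arguments replaces each permutation by its inverse.
  refine Fintype.sum_equiv (Equiv.inv _) _ _ fun σ => ?_
  exact Fintype.prod_equiv σ _ _ fun i => by simp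

theorem symForm_orthonormal {κ : Type*} [DecidableEq κ] {h : Sesq V} {e : κ → V}
    (he : ∀ i j, h (e i) (e j) = if i = j then 1 else 0) (I J : Fin d → κ) :
    symForm d h (sprod fun k => e (I k)) (sprod fun k => e (J k)) =
      (d.factorial : ℂ)⁻¹ * ∑ σ : Equiv.Perm (Fin d), if I = fun k => J (σ k) then 1 else 0 := by
  rw [symForm_sprod]
  congr 1
  refine Finset.sum_congr rfl fun σ _ => ?_
  simp only [he]
  split_ifs with hI
  · subst hI; simp
  · obtain ⟨k, hk⟩ := Function.ne_iff.1 hI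
    exact Finset.prod_eq_zero (Finset.mem_univ k) (if_neg hk)

/-- The expansion of an element of `Sym^d V` in products of orthonormal vectors. -/
theorem sum_symForm_smul {h : Sesq V} (e : Module.Basis κ ℂ V)
    (he : ∀ i j, h (e i) (e j) = if i = j then 1 else 0) (s : SymP d V) :
    ∑ J : Fin d → κ, symForm d h s (sprod fun k => e (J k)) • sprod (fun k => e (J k)) = s := by
  refine symP_basis_induction e (P := fun s => ∑ J : Fin d → κ,
    symForm d h s (sprod fun k => e (J k)) • sprod (fun k => e (J k)) = s) (fun I => ?_)
    (fun s t hs ht => by simp [add_smul, Finset.sum_add_distrib, hs, ht])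
    (fun c s hs => by
      simp only [map_smul, LinearMap.smul_apply, smul_eq_mul, mul_smul, ← Finset.smul_sum, hs])
    (by simp) s
  simp only [symForm_orthonormal he, mul_smul, Finset.sum_smul, ← Finset.smul_sum]
  rw [Finset.sum_comm]
  -- For each of the `d!` permutations a single multi-index contributes, always with the same
  -- product. This cancels the `1/d!` of `Sym^d h`.
  have h1 : ∀ σ : Equiv.Perm (Fin d), ∑ J : Fin d → κ,
      (if I = fun k => J (σ k) then (1 : ℂ) else 0) •
      (sprod fun k => e (J k)) = sprod fun k => e (I k) := by
    intro σ
    have : ∀ J : Fin d → κ, (I = fun k => J (σ k)) ↔ J = fun k => I (σ⁻¹ k) := fun J =>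
      ⟨fun hI => by subst hI; simp, fun hJ => by subst hJ; simp⟩
    simp only [this, ite_smul, one_smul, zero_smul, Finset.sum_ite_eq', Finset.mem_univ, if_true]
    exact SymmetricPower.tprod_equiv σ⁻¹ fun k => e (I k)
  simp only [h1, Finset.sum_const, Finset.card_univ, Fintype.card_perm, Fintype.card_fin]
  rw [← Nat.cast_smul_eq_nsmul ℂ, smul_smul,
      inv_mul_cancel₀ (by exact_mod_cast d.factorial_ne_zero),
    one_smul]

/-- Parseval's identity: by `sum_symForm_smul` the squared norm of `s` is the sum of all `|⟨s,
e_J⟩|²`, and if these vanish then so does `s`. -/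
theorem IsHermInner.symForm {h : Sesq V} (hh : IsHermInner h) (b : Module.Basis κ ℂ V) :
    IsHermInner (symForm d h) := by
  obtain ⟨e, he⟩ := hh.exists_orthonormal b
  refine ⟨symForm_symm hh.1, fun s hs => ?_⟩
  have h1 : SymBalanced.symForm d h s s =
      ∑ J : Fin d → κ, (Complex.normSq (SymBalanced.symForm d h s (sprod fun k => e (J k))) : ℂ) :=
          by
    calc SymBalanced.symForm d h s s = SymBalanced.symForm d h s
          (∑ J : Fin d → κ, SymBalanced.symForm d h s (sprod fun k => e (J k)) •
            sprod (fun k => e (J k))) := by rw [sum_symForm_smul e he s]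
      _ = _ := by
          rw [map_sum]
          refine Finset.sum_congr rfl fun J _ => ?_
          rw [map_smulₛₗ, smul_eq_mul, mul_comm, Complex.mul_conj]
  rw [h1, ← Complex.ofReal_sum, Complex.ofReal_re]
  refine Finset.sum_pos' (fun _ _ => Complex.normSq_nonneg _) ?_
  by_contra hne
  push Not at hne
  apply hs
  rw [← sum_symForm_smul e he s]
  refine Finset.sum_eq_zero fun J _ => ?_
  have := Complex.normSq_eq_zero.1 (le_antisymm (hne J (Finset.mem_univ J)) (Complex.normSq_nonneg
      _))
  rw [this, zero_smul]

end SymPositive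

/-! ### Families of Hermitian forms -/

section Families

variable {V : Type*} [AddCommGroup V] [Module ℂ V] {d : ℕ}

/-- Values of `Sym^d h` are polynomials in values of `h`. An arbitrary subalgebra covers smoothness,
differentiability and continuity at once. -/
theorem symForm_mem {X : Type*} (S : Subalgebra ℂ (X → ℂ)) {K : X → Sesq V}
    (hK : ∀ u v, (fun p => K p u v) ∈ S) (s t : SymP d V) :
    (fun p => symForm d (K p) s t) ∈ S := by
  refine symP_induction (P := fun s => (fun p => symForm d (K p) s t) ∈ S) (fun v => ?_)
    (fun s s' hs hs' => by simpa using! S.add_mem hs hs')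
    (fun c s hs => by simpa using! S.smul_mem hs c)
    (by simp only [map_zero, LinearMap.zero_apply]; exact S.zero_mem) s
  refine symP_induction (P := fun t => (fun p => symForm d (K p) (sprod v) t) ∈ S) (fun w => ?_)
    (fun s s' hs hs' => by simpa using! S.add_mem hs hs')
    (fun c s hs => by simpa using! S.smul_mem hs (conj c)) (by simp only [map_zero]; exact
        S.zero_mem) t
  simp only [symForm_sprod]
  have := S.smul_mem (S.sum_mem (t := Finset.univ) fun (σ : Equiv.Perm (Fin d)) _ =>
    S.prod_mem (t := Finset.univ) fun (i : Fin d) _ => hK (v i) (w (σ i))) (d.factorial : ℂ)⁻¹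
  convert! this using 1
  funext p
  simp

/-- Functions which are smooth at `p`. -/
def smoothAt {E : Type*} [NormedAddCommGroup E] [NormedSpace ℝ E] (p : E) :
    Subalgebra ℂ (E → ℂ) where
  carrier := {f | ContDiffAt ℝ ∞ f p}
  mul_mem' {f g} (hf : ContDiffAt ℝ ∞ f p) (hg : ContDiffAt ℝ ∞ g p) :=
    show ContDiffAt ℝ ∞ (f * g) p from hf.mul hg
  add_mem' {f g} (hf : ContDiffAt ℝ ∞ f p) (hg : ContDiffAt ℝ ∞ g p) :=
    show ContDiffAt ℝ ∞ (f + g) p from hf.add hg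
  algebraMap_mem' c := show ContDiffAt ℝ ∞ (fun _ => c) p from contDiffAt_const

/-- Functions which are continuous at `p`. -/
def continuousAtSubalgebra {X : Type*} [TopologicalSpace X] (p : X) : Subalgebra ℂ (X → ℂ) where
  carrier := {f | ContinuousAt f p}
  mul_mem' hf hg := ContinuousAt.mul hf hg
  add_mem' hf hg := ContinuousAt.add hf hg
  algebraMap_mem' _ := continuousAt_const

/-- Functions which are differentiable at `p`. -/
def differentiableAtSubalgebra {E : Type*} [NormedAddCommGroup E] [NormedSpace ℝ E] (p : E) :
    Subalgebra ℂ (E → ℂ) where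
  carrier := {f | DifferentiableAt ℝ f p}
  mul_mem' {f g} (hf : DifferentiableAt ℝ f p) (hg : DifferentiableAt ℝ g p) :=
    show DifferentiableAt ℝ (f * g) p from hf.mul hg
  add_mem' {f g} (hf : DifferentiableAt ℝ f p) (hg : DifferentiableAt ℝ g p) :=
    show DifferentiableAt ℝ (f + g) p from hf.add hg
  algebraMap_mem' c := show DifferentiableAt ℝ (fun _ => c) p from differentiableAt_const c

theorem differentiableAt_prod {E ι : Type*} [NormedAddCommGroup E] [NormedSpace ℝ E] {p : E}
    {s : Finset ι} {f : ι → E → ℂ} (hf : ∀ i ∈ s, DifferentiableAt ℝ (f i) p) :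
    DifferentiableAt ℝ (fun y => ∏ i ∈ s, f i y) p := by
  have h : ∏ i ∈ s, f i ∈ differentiableAtSubalgebra p := Subalgebra.prod_mem _ hf
  rw [show ∏ i ∈ s, f i = fun y => ∏ i ∈ s, f i y from funext fun y => by simp] at h
  exact h

/-! ### Wirtinger derivatives at a point as derivations -/

section PointDerivation

variable {m : ℕ} {z : Fin m → ℂ} {f g : (Fin m → ℂ) → ℂ} {c : ℂ} {j : Fin m}

theorem wirt_const (a : ℂ) : wirt c j (fun _ => a) z = 0 := by
  simp [wirt]

theorem wirt_add (hf : DifferentiableAt ℝ f z) (hg : DifferentiableAt ℝ g z) :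
    wirt c j (fun y => f y + g y) z = wirt c j f z + wirt c j g z := by
  simp only [wirt, fderiv_fun_add hf hg, add_apply]
  ring

theorem wirt_mul (hf : DifferentiableAt ℝ f z) (hg : DifferentiableAt ℝ g z) :
    wirt c j (fun y => f y * g y) z = f z * wirt c j g z + g z * wirt c j f z := by
  simp only [wirt, fderiv_fun_mul hf hg, add_apply, smul_apply, smul_eq_mul]
  ring

theorem wirt_const_mul (a : ℂ) (hf : DifferentiableAt ℝ f z) :
    wirt c j (fun y => a * f y) z = a * wirt c j f z := by
  rw [wirt_mul (differentiableAt_const a) hf, wirt_const, mul_zero, add_zero]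

theorem wirt_sum {ι : Type*} {s : Finset ι} {f : ι → (Fin m → ℂ) → ℂ}
    (hf : ∀ i ∈ s, DifferentiableAt ℝ (f i) z) :
    wirt c j (fun y => ∑ i ∈ s, f i y) z = ∑ i ∈ s, wirt c j (f i) z := by
  classical
  induction s using Finset.induction_on with
  | empty => simpa using wirt_const 0
  | insert a s ha ih =>
    have h1 : ∀ i ∈ s, DifferentiableAt ℝ (f i) z := fun i hi => hf i (by simp [hi])
    simp only [Finset.sum_insert ha]
    rw [wirt_add (hf a (by simp)) (DifferentiableAt.fun_sum h1), ih h1]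

theorem wirt_prod {ι : Type*} [DecidableEq ι] {s : Finset ι} {f : ι → (Fin m → ℂ) → ℂ}
    (hf : ∀ i ∈ s, DifferentiableAt ℝ (f i) z) :
    wirt c j (fun y => ∏ i ∈ s, f i y) z =
      ∑ i ∈ s, wirt c j (f i) z * ∏ k ∈ s.erase i, f k z := by
  induction s using Finset.induction_on with
  | empty => simpa using wirt_const 1
  | insert a s ha ih =>
    have h1 : ∀ i ∈ s, DifferentiableAt ℝ (f i) z := fun i hi => hf i (by simp [hi])
    have h2 : DifferentiableAt ℝ (fun y => ∏ i ∈ s, f i y) z :=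
      differentiableAt_prod h1
    simp only [Finset.prod_insert ha]
    rw [wirt_mul (hf a (by simp)) h2, ih h1, Finset.sum_insert ha, Finset.erase_insert ha, add_comm,
      mul_comm, Finset.mul_sum]
    congr 1
    refine Finset.sum_congr rfl fun i hi => ?_
    have hai : a ≠ i := fun h => ha (h ▸ hi)
    rw [Finset.erase_insert_of_ne hai, Finset.prod_insert (by simp [ha])]
    ring

end PointDerivation

/-- If `A` is the connection form of `h` then `S^d A` is the connection form of `Sym^d h`. -/
theorem symForm_symDer {m : ℕ} {z : Fin m → ℂ} {K : (Fin m → ℂ) → Sesq V}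
    (hK : ∀ u v, DifferentiableAt ℝ (fun y => K y u v) z) {c : ℂ} {j : Fin m} {A : Module.End ℂ V}
    (hA : ∀ u v, K z (A u) v = wirt c j (fun y => K y u v) z) (s t : SymP d V) :
    symForm d (K z) (symDer d A s) t = wirt c j (fun y => symForm d (K y) s t) z := by
  have hS : ∀ s t, DifferentiableAt ℝ (fun y => symForm d (K y) s t) z :=
    symForm_mem (d := d) (differentiableAtSubalgebra z) hK
  refine symP_induction (P := fun s => symForm d (K z) (symDer d A s) t =
    wirt c j (fun y => symForm d (K y) s t) z)
    (fun v => ?_)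
    (fun s s' hs hs' => by
      simp only [map_add, LinearMap.add_apply, wirt_add (hS _ _) (hS _ _), hs, hs'])
    (fun a s hs => by
      simp only [map_smul, LinearMap.smul_apply, smul_eq_mul, wirt_const_mul _ (hS _ _), hs])
    (by simp only [map_zero, LinearMap.zero_apply, wirt_const]) s
  refine symP_induction (P := fun t => symForm d (K z) (symDer d A (sprod v)) t =
    wirt c j (fun y => symForm d (K y) (sprod v) t) z)
    (fun w => ?_)
    (fun s s' hs hs' => by simp only [map_add, wirt_add (hS _ _) (hS _ _), hs, hs'])
    (fun a s hs => by simp only [map_smulₛₗ, smul_eq_mul, wirt_const_mul _ (hS _ _), hs])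
    (by simp only [map_zero, wirt_const]) t
  have hP : ∀ σ : Equiv.Perm (Fin d), DifferentiableAt ℝ (fun y => ∏ i, K y (v i) (w (σ i))) z :=
    fun σ => differentiableAt_prod fun i _ => hK (v i) (w (σ i))
  rw [symDer_sprod, map_sum, LinearMap.sum_apply]
  simp only [symForm_sprod, ← Finset.mul_sum]
  rw [wirt_const_mul _ (DifferentiableAt.fun_sum fun σ _ => hP σ), wirt_sum fun σ _ => hP σ,
    Finset.sum_comm]
  congr 1
  refine Finset.sum_congr rfl fun σ _ => ?_
  -- The Leibniz rule: differentiating the `i`-th factor is the same as applying `A` to `vᵢ`.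
  rw [wirt_prod fun i _ => hK (v i) (w (σ i))]
  refine Finset.sum_congr rfl fun i _ => ?_
  rw [← hA, ← Finset.mul_prod_erase Finset.univ _ (Finset.mem_univ i)]
  simp only [Function.update_self]
  congr 1
  refine Finset.prod_congr rfl fun l hl => ?_
  rw [Function.update_of_ne (Finset.ne_of_mem_erase hl)]

end Families

/-! ### Chern connections and their curvature -/

section Chern

variable {V : Type*} [AddCommGroup V] [Module ℂ V] {κ κ' : Type*} [Fintype κ] [DecidableEq κ]
  [Fintype κ'] [DecidableEq κ'] {m d : ℕ} {z : Fin m → ℂ}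

theorem linearMap_matrix_eq_sum (l : Matrix κ κ ℂ →ₗ[ℂ] ℂ) (M : Matrix κ κ ℂ) :
    l M = ∑ a, ∑ b, M a b * l (Matrix.single a b 1) := by
  conv_lhs => rw [Matrix.matrix_eq_sum_single M]
  simp only [map_sum]
  refine Finset.sum_congr rfl fun a _ => Finset.sum_congr rfl fun b _ => ?_
  rw [← smul_eq_mul, ← map_smul, Matrix.smul_single, smul_eq_mul, mul_one]

theorem wirt_linearMap (l : Matrix κ κ ℂ →ₗ[ℂ] ℂ) {C : (Fin m → ℂ) → Matrix κ κ ℂ}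
    (hC : ∀ a b, DifferentiableAt ℝ (fun y => C y a b) z) (c : ℂ) (j : Fin m) :
    wirt c j (fun y => l (C y)) z = l (Matrix.of fun a b => wirt c j (fun y => C y a b) z) := by
  have h1 : ∀ a b, DifferentiableAt ℝ (fun y => C y a b * l (Matrix.single a b 1)) z :=
    fun a b => (hC a b).mul_const _
  rw [show (fun y => l (C y)) = fun y => ∑ a, ∑ b, C y a b * l (Matrix.single a b 1) from
    funext fun y => linearMap_matrix_eq_sum l (C y), linearMap_matrix_eq_sum l (Matrix.of _)]
  rw [wirt_sum fun a _ => DifferentiableAt.fun_sum fun b _ => h1 a b]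
  refine Finset.sum_congr rfl fun a _ => ?_
  rw [wirt_sum fun b _ => h1 a b]
  refine Finset.sum_congr rfl fun b _ => ?_
  simp only [mul_comm _ (l _)]
  exact wirt_const_mul _ (hC a b)

theorem hasDerivAt_linearMap (l : Matrix κ κ ℂ →ₗ[ℂ] ℂ) {M : ℝ → Matrix κ κ ℂ} {M' : Matrix κ κ ℂ}
    (hM : ∀ a b, HasDerivAt (fun t => M t a b) (M' a b) 0) :
    HasDerivAt (fun t => l (M t)) (l M') 0 := by
  rw [show (fun t => l (M t)) = fun t => ∑ a, ∑ b, M t a b * l (Matrix.single a b 1) from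
    funext fun t => linearMap_matrix_eq_sum l (M t), linearMap_matrix_eq_sum l M']
  exact HasDerivAt.fun_sum fun a _ => HasDerivAt.fun_sum fun b _ => (hM a b).mul_const _

theorem gram_mul_apply (b : Module.Basis κ ℂ V) (K : (Fin m → ℂ) → Sesq V) (A : Matrix κ κ ℂ)
    (a c : κ) : (gram b K z * A) a c = K z (Matrix.toLin b b A (b c)) (b a) := by
  rw [Matrix.toLin_self, map_sum, LinearMap.sum_apply, Matrix.mul_apply]
  refine Finset.sum_congr rfl fun i _ => ?_
  simp [gram, mul_comm]

theorem basis_induction {κ : Type*} [Fintype κ] (b : Module.Basis κ ℂ V) {P : V → Prop} (hb : ∀ i,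
    P (b i))
    (hadd : ∀ s t, P s → P t → P (s + t)) (hsmul : ∀ (c : ℂ) s, P s → P (c • s)) (h0 : P 0)
    (v : V) : P v := by
  rw [← b.sum_repr v]
  exact Finset.sum_induction _ P hadd h0 fun i _ => hsmul _ _ (hb i)

theorem forall_mem_of_basis {X κ : Type*} [Fintype κ] (S : Subalgebra ℂ (X → ℂ)) {K : X → Sesq V}
    (b : Module.Basis κ ℂ V) (hK : ∀ a c, (fun p => K p (b c) (b a)) ∈ S) (u v : V) :
    (fun p => K p u v) ∈ S := by
  refine basis_induction b (P := fun u => (fun p => K p u v) ∈ S) (fun c => ?_)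
    (fun s s' hs hs' => by simpa using! S.add_mem hs hs')
    (fun c s hs => by simpa using! S.smul_mem hs c)
    (by simp only [map_zero, LinearMap.zero_apply]; exact S.zero_mem) u
  exact basis_induction b (P := fun v => (fun p => K p (b c) v) ∈ S) (fun a => hK a c)
    (fun s s' hs hs' => by simpa using! S.add_mem hs hs')
    (fun c s hs => by simpa using! S.smul_mem hs (conj c))
    (by simp only [map_zero]; exact S.zero_mem) v

theorem gram_mul_chernConn (b : Module.Basis κ ℂ V) {K : (Fin m → ℂ) → Sesq V}
    (hdet : (gram b K z).det ≠ 0) (j : Fin m) :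
    gram b K z * chernConn b K j z = Matrix.of fun a c => wd j (fun y => gram b K y a c) z := by
  rw [chernConn, ← mul_assoc, Matrix.mul_nonsing_inv _ (isUnit_iff_ne_zero.2 hdet), one_mul]

/-- The equation `H A = ∂H` freed from the frame. Together with the converse
`chernConn_eq_toMatrix`, it lets connection forms of `h` and `Sym^d h` be compared without relating
their bases. -/
theorem sesq_chernConn (b : Module.Basis κ ℂ V) {K : (Fin m → ℂ) → Sesq V}
    (hdet : (gram b K z).det ≠ 0) (hK : ∀ u v, DifferentiableAt ℝ (fun y => K y u v) z)
    (j : Fin m) (u v : V) :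
    K z (Matrix.toLin b b (chernConn b K j z) u) v = wirt (-Complex.I) j (fun y => K y u v) z := by
  refine basis_induction b (P := fun u => K z (Matrix.toLin b b (chernConn b K j z) u) v =
    wirt (-Complex.I) j (fun y => K y u v) z) (fun c => ?_)
    (fun s s' hs hs' => by
      simp only [map_add, LinearMap.add_apply, wirt_add (hK _ _) (hK _ _), hs, hs'])
    (fun a s hs => by
      simp only [map_smul, LinearMap.smul_apply, smul_eq_mul, wirt_const_mul _ (hK _ _), hs])
    (by simp only [map_zero, LinearMap.zero_apply, wirt_const]) u
  refine basis_induction b (P := fun v => K z (Matrix.toLin b b (chernConn b K j z) (b c)) v =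
    wirt (-Complex.I) j (fun y => K y (b c) v) z) (fun a => ?_)
    (fun s s' hs hs' => by simp only [map_add, wirt_add (hK _ _) (hK _ _), hs, hs'])
    (fun a s hs => by simp only [map_smulₛₗ, smul_eq_mul, wirt_const_mul _ (hK _ _), hs])
    (by simp only [map_zero, wirt_const]) v
  rw [← gram_mul_apply, gram_mul_chernConn b hdet, Matrix.of_apply, wd_eq_wirt]
  rfl

theorem chernConn_eq_toMatrix (b : Module.Basis κ ℂ V) {K : (Fin m → ℂ) → Sesq V}
    (hdet : (gram b K z).det ≠ 0) {j : Fin m} {A : Module.End ℂ V}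
    (hA : ∀ u v, K z (A u) v = wirt (-Complex.I) j (fun y => K y u v) z) :
    chernConn b K j z = LinearMap.toMatrix b b A := by
  have h1 : gram b K z * LinearMap.toMatrix b b A =
      Matrix.of fun a c => wd j (fun y => gram b K y a c) z := by
    ext a c
    rw [gram_mul_apply, Matrix.toLin_toMatrix, hA, Matrix.of_apply, wd_eq_wirt]
    rfl
  rw [chernConn, ← h1, ← mul_assoc, Matrix.nonsing_inv_mul _ (isUnit_iff_ne_zero.2 hdet), one_mul]

theorem exists_rep_gram {κ : Type*} (b : Module.Basis κ ℂ V) {K : (Fin m → ℂ) → Sesq V}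
    (hK : ∀ u v, ContDiffAt ℝ ∞ (fun y => K y u v) z) :
    ∃ γ : Matrix κ κ (smoothGerms z), ∀ a c, Rep (fun y => gram b K y a c) (γ a c) := by
  choose γ hγ using fun a c => exists_rep_of_contDiffAt (hK (b c) (b a))
  exact ⟨Matrix.of γ, hγ⟩

theorem contDiffAt_chernConn (b : Module.Basis κ ℂ V) {K : (Fin m → ℂ) → Sesq V}
    (hK : ∀ u v, ContDiffAt ℝ ∞ (fun y => K y u v) z) (hdet : (gram b K z).det ≠ 0) (j : Fin m)
    (a c : κ) : ContDiffAt ℝ ∞ (fun y => chernConn b K j y a c) z := by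
  obtain ⟨γ, hγ⟩ := exists_rep_gram b hK
  have := (Rep.sum (t := Finset.univ) fun e _ => (Rep.inv hγ hdet a e).mul ((hγ e c).wd
      j)).contDiffAt
  exact this

theorem eventually_gram_det_ne_zero (b : Module.Basis κ ℂ V) {K : (Fin m → ℂ) → Sesq V}
    (hK : ∀ u v, ContDiffAt ℝ ∞ (fun y => K y u v) z) (hdet : (gram b K z).det ≠ 0) :
    ∀ᶠ y in 𝓝 z, (gram b K y).det ≠ 0 := by
  obtain ⟨γ, hγ⟩ := exists_rep_gram b hK
  exact (Rep.det hγ).contDiffAt.continuousAt.eventually_ne hdet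

theorem eventually_forall_differentiableAt {κ : Type*} [Fintype κ] (b : Module.Basis κ ℂ V) {K :
    (Fin m → ℂ) → Sesq V}
    (hK : ∀ u v, ContDiffAt ℝ ∞ (fun y => K y u v) z) :
    ∀ᶠ y in 𝓝 z, ∀ u v, DifferentiableAt ℝ (fun y => K y u v) y := by
  have := eventually_all.2 fun a => eventually_all.2 fun c =>
    eventually_differentiableAt (hK (b c) (b a))
  filter_upwards [this] with y hy
  exact forall_mem_of_basis (differentiableAtSubalgebra y) b hy

/-- The curvature of `Sym^d h` is `S^d` of the curvature of `h`. -/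
theorem chernCurv_symForm (b : Module.Basis κ ℂ V) (b' : Module.Basis κ' ℂ (SymP d V))
    {K : (Fin m → ℂ) → Sesq V} (hK : ∀ u v, ContDiffAt ℝ ∞ (fun y => K y u v) z)
    (hdet : (gram b K z).det ≠ 0) (hdet' : (gram b' (fun y => symForm d (K y)) z).det ≠ 0)
    (j k : Fin m) :
    chernCurv b' (fun y => symForm d (K y)) z j k = symDer d (chernCurv b K z j k) := by
  have hS : ∀ s t, ContDiffAt ℝ ∞ (fun y => symForm d (K y) s t) z :=
    symForm_mem (smoothAt z) hK
  have hconn : ∀ᶠ y in 𝓝 z, chernConn b' (fun y => symForm d (K y)) j y =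
      LinearMap.toMatrix b' b' (symDer d (Matrix.toLin b b (chernConn b K j y))) := by
    filter_upwards [eventually_gram_det_ne_zero b hK hdet, eventually_gram_det_ne_zero b' hS hdet',
      eventually_forall_differentiableAt b hK] with y h1 h2 h3
    exact chernConn_eq_toMatrix b' h2 fun s t =>
      symForm_symDer h3 (fun u v => sesq_chernConn b h1 h3 j u v) s t
  rw [chernCurv, ← (LinearMap.toMatrix b' b').injective.eq_iff, LinearMap.toMatrix_toLin]
  ext a c
  -- Each entry of `S^d A` is a fixed complex-linear functional of the matrix of `A`, so taking it
  -- commutes with `∂̄`.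
  let l : Matrix κ κ ℂ →ₗ[ℂ] ℂ := (LinearMap.proj c ∘ₗ LinearMap.proj a) ∘ₗ
    (LinearMap.toMatrix b' b').toLinearMap ∘ₗ symDerL V d ∘ₗ (Matrix.toLin b b).toLinearMap
  have hl : ∀ M, l M = LinearMap.toMatrix b' b' (symDer d (Matrix.toLin b b M)) a c := fun M => rfl
  rw [chernCurv, ← hl, Matrix.of_apply]
  have h4 : (fun y => chernConn b' (fun y => symForm d (K y)) j y a c) =ᶠ[𝓝 z]
      fun y => l (chernConn b K j y) := hconn.mono fun y hy =>
    (congrFun (congrFun hy a) c).trans (hl _).symm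
  rw [wdbar_eq_wirt, wirt_congr h4, wirt_linearMap l fun a c =>
    (contDiffAt_chernConn b hK hdet j a c).differentiableAt (by simp), ← map_neg]
  rfl

/-- The linearization of the Chern curvature. -/
theorem hasDerivAt_chernCurv (b : Module.Basis κ ℂ V) {K : (Fin m → ℂ) → Sesq V}
    {φ : (Fin m → ℂ) → Module.End ℂ V} (hK : ∀ u v, ContDiffAt ℝ ∞ (fun y => K y u v) z)
    (hφ : ∀ a c, ContDiffAt ℝ ∞ (fun y => LinearMap.toMatrix b b (φ y) a c) z)
    (hdet : (gram b K z).det ≠ 0) (l : Module.Dual ℂ (Module.End ℂ V)) (j k : Fin m) :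
    HasDerivAt (fun t : ℝ => l (chernCurv b (fun y => (K y).comp (1 + (t : ℂ) • φ y)) z j k))
      (l (dbardEnd b K φ z j k)) 0 := by
  let H : (Fin m → ℂ) → Matrix κ κ ℂ := gram b K
  let P : (Fin m → ℂ) → Matrix κ κ ℂ := fun y => LinearMap.toMatrix b b (φ y)
  have hgram : ∀ (t : ℝ) y, gram b (fun y => (K y).comp (1 + (t : ℂ) • φ y)) y =
      H y + (t : ℂ) • (H y * P y) := by
    intro t y
    ext a c
    rw [Matrix.add_apply, Matrix.smul_apply, gram_mul_apply, Matrix.toLin_toMatrix]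
    simp [gram, H]
  have hHs : ∀ a c, ContDiffAt ℝ ∞ (fun y => H y a c) z := fun a c => hK (b c) (b a)
  have hHPs : ∀ a c, ContDiffAt ℝ ∞ (fun y => (H y * P y) a c) z := fun a c => by
    simp only [Matrix.mul_apply]
    exact ContDiffAt.sum fun i _ => (hHs a i).mul (hφ i c)
  have hjoint : ∀ a c, ContDiffAt ℝ ∞ (fun q : ℝ × (Fin m → ℂ) =>
      (H q.2 + (q.1 : ℂ) • (H q.2 * P q.2)) a c) (0, z) := by
    intro a c
    have h1 : ContDiffAt ℝ ∞ (fun q : ℝ × (Fin m → ℂ) => H q.2 a c) (0, z) :=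
      (hHs a c).comp (0, z) contDiffAt_snd
    have h2 : ContDiffAt ℝ ∞ (fun q : ℝ × (Fin m → ℂ) => (H q.2 * P q.2) a c) (0, z) :=
      ContDiffAt.comp (g := fun y => (H y * P y) a c) (0, z) (hHPs a c) contDiffAt_snd
    have h3 : ContDiffAt ℝ ∞ (fun q : ℝ × (Fin m → ℂ) => (q.1 : ℂ)) (0, z) :=
      Complex.ofRealCLM.contDiff.contDiffAt.comp (0, z) contDiffAt_fst
    exact h1.add (h3.mul h2)
  have hconn : ∀ (t : ℝ) y, chernConn b (fun y => (K y).comp (1 + (t : ℂ) • φ y)) j y =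
      (H y + (t : ℂ) • (H y * P y))⁻¹ * Matrix.of fun a c =>
        wd j (fun y => (H y + (t : ℂ) • (H y * P y)) a c) y := by
    intro t y
    simp only [chernConn, hgram]
  have hconnjoint : ∀ a c, ContDiffAt ℝ ∞ (fun q : ℝ × (Fin m → ℂ) =>
      chernConn b (fun y => (K y).comp (1 + (q.1 : ℂ) • φ y)) j q.2 a c) (0, z) := by
    intro a c
    simp only [hconn, Matrix.mul_apply, Matrix.of_apply, wd_eq_wirt]
    choose γ hγ using fun a c => exists_rep_of_contDiffAt (hjoint a c)
    refine ContDiffAt.sum fun e _ => ContDiffAt.mul ?_ ?_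
    · exact (Rep.inv (γ := Matrix.of γ) hγ (by simpa using hdet) a e).contDiffAt
    · exact contDiffAt_wirt (f := fun (t : ℝ) y => (H y + (t : ℂ) • (H y * P y)) e c)
        (hjoint e c) _ _
  -- The connection form `H⁻¹ ∂H` moves by the covariant derivative `∂P + [A, P]`. This is needed
  -- near `z` because `∂̄` is still to be applied.
  have hder : ∀ a c, ∀ᶠ y in 𝓝 z, HasDerivAt (fun t : ℝ =>
      chernConn b (fun y => (K y).comp (1 + (t : ℂ) • φ y)) j y a c)
      (wd j (fun x => P x a c) y + (chernConn b K j y * P y - P y * chernConn b K j y) a c) 0 := by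
    intro a c
    have hd1 := eventually_all.2 fun a => eventually_all.2 fun c => eventually_differentiableAt
        (hHs a c)
    have hd2 := eventually_all.2 fun a => eventually_all.2 fun c => eventually_differentiableAt (hφ
        a c)
    filter_upwards [eventually_gram_det_ne_zero b hK hdet, hd1, hd2] with y hy hy1 hy2
    have hHP : ∀ a c, DifferentiableAt ℝ (fun y => (H y * P y) a c) y := fun a c => by
      simp only [Matrix.mul_apply]
      exact DifferentiableAt.fun_sum fun i _ => (hy1 a i).mul (hy2 i c)
    have hwd : ∀ (t : ℝ) e c, wd j (fun y => (H y + (t : ℂ) • (H y * P y)) e c) y =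
        wd j (fun y => H y e c) y + (t : ℂ) * wd j (fun y => (H y * P y) e c) y := by
      intro t e c
      rw [wd_eq_wirt, ← wirt_const_mul _ (hHP e c), ← wirt_add (hy1 e c) ((hHP e c).const_mul _)]
      rfl
    have hwd2 : ∀ e c, wd j (fun y => (H y * P y) e c) y =
        ((Matrix.of fun a c => wd j (fun y => H y a c) y) * P y +
          H y * Matrix.of fun a c => wd j (fun y => P y a c) y) e c := by
      intro e c
      simp only [Matrix.mul_apply, Matrix.add_apply, wd_eq_wirt, Matrix.of_apply]
      rw [wirt_sum (f := fun i y => H y e i * P y i c) fun i _ => (hy1 e i).mul (hy2 i c),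
          ← Finset.sum_add_distrib]
      refine Finset.sum_congr rfl fun i _ => ?_
      rw [wirt_mul (f := fun y => H y e i) (g := fun y => P y i c) (hy1 e i) (hy2 i c)]
      ring
    simp only [hconn, Matrix.mul_apply, Matrix.of_apply, hwd]
    have h1 := HasDerivAt.fun_sum (u := Finset.univ) fun e _ =>
      (hasDerivAt_inv_affine (H y) (H y * P y) hy a e).mul
        (((Complex.ofRealCLM.hasDerivAt (x := (0 : ℝ))).mul_const
          (wd j (fun y => (H y * P y) e c) y)).const_add (wd j (fun y => H y e c) y))
    refine h1.congr_deriv ?_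
    have hu : IsUnit (H y).det := isUnit_iff_ne_zero.2 hy
    have e1 : (H y)⁻¹ * (H y * P y) * (H y)⁻¹ = P y * (H y)⁻¹ := by
      rw [← mul_assoc, Matrix.nonsing_inv_mul _ hu, one_mul]
    set dH : Matrix κ κ ℂ := Matrix.of fun a c => wd j (fun y => H y a c) y with hdH
    set dP : Matrix κ κ ℂ := Matrix.of fun a c => wd j (fun y => P y a c) y with hdP
    have hC : chernConn b K j y = (H y)⁻¹ * dH := rfl
    -- The term `-P H⁻¹ ∂H` comes from varying `H⁻¹`, and `H⁻¹ ∂(HP)` from varying `∂H`.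
    have e2 : -(P y * (H y)⁻¹ * dH) + (H y)⁻¹ * (dH * P y + H y * dP) =
        dP + (chernConn b K j y * P y - P y * chernConn b K j y) := by
      rw [hC, mul_add, ← mul_assoc, ← mul_assoc (H y)⁻¹, Matrix.nonsing_inv_mul _ hu, one_mul,
        ← mul_assoc]
      abel
    have e3 := congrFun (congrFun e2 a) c
    simp only [Matrix.add_apply, Matrix.neg_apply, Matrix.sub_apply] at e3
    rw [Matrix.mul_apply, Matrix.mul_apply (M := (H y)⁻¹)] at e3
    simp only [e1, hwd2, Complex.ofRealCLM_apply, Complex.ofReal_zero, zero_mul, add_zero,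
        zero_smul,
      Complex.ofReal_one, one_mul]
    rw [Finset.sum_add_distrib]
    simp only [neg_mul, Finset.sum_neg_distrib]
    exact e3
  refine hasDerivAt_linearMap (l ∘ₗ (Matrix.toLin b b).toLinearMap) fun a c => ?_
  simp only [Matrix.of_apply, wdbar_eq_wirt]
  exact (hasDerivAt_wirt (f := fun (t : ℝ) y =>
    chernConn b (fun y => (K y).comp (1 + (t : ℂ) • φ y)) j y a c)
    ((hconnjoint a c).of_le (by norm_cast)) (hder a c) Complex.I k).neg

end Chern

/-! ### Contractions -/

section Contraction

variable {m : ℕ} {M : Type*} [AddCommGroup M] [Module ℂ M]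

theorem map_Lam {M' : Type*} [AddCommGroup M'] [Module ℂ M'] (l : M →ₗ[ℂ] M')
    (om : Matrix (Fin m) (Fin m) ℂ) (F : Fin m → Fin m → M) :
    l (Lam om F) = Lam om fun j k => l (F j k) := by
  simp only [Lam, map_sum, map_smul]

theorem sum_swap_pairs {ι κ N : Type*} [Fintype ι] [Fintype κ] [AddCommMonoid N]
    (A : ι → ι → κ → κ → N) :
    ∑ j, ∑ k, ∑ p, ∑ q, A j k p q = ∑ p, ∑ q, ∑ j, ∑ k, A j k p q := by
  have := Finset.sum_comm (s := Finset.univ (α := ι × ι)) (t := Finset.univ (α := κ × κ))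
    (f := fun x y => A x.1 x.2 y.1 y.2)
  simpa only [Fintype.sum_prod_type] using this

/-- The variation `∑ g^{pk̄} g^{jq̄} α_{pq̄} F_{jk̄}` of the contraction. -/
def lamVar (om α : Matrix (Fin m) (Fin m) ℂ) (F : Fin m → Fin m → M) : M :=
  ∑ j, ∑ k, (∑ p, ∑ q, invMetric om p k * invMetric om j q * α p q) • F j k

/-- The product rule. The `-i` of `Λ` and the `-i` of `metricMatrix` multiply to `-1`, which cancels
the sign of `δ(g⁻¹) = -g⁻¹ (δg) g⁻¹`; hence `lamVar` enters with a plus. -/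
theorem hasDerivAt_Lam {om α : Matrix (Fin m) (Fin m) ℂ} (hdet : (metricMatrix om).det ≠ 0)
    {F : ℝ → Fin m → Fin m → ℂ} {F' : Fin m → Fin m → ℂ}
    (hF : ∀ j k, HasDerivAt (fun t => F t j k) (F' j k) 0) :
    HasDerivAt (fun t : ℝ => Lam (om + (t : ℂ) • α) (F t)) (Lam om F' + lamVar om α (F 0)) 0 := by
  have h1 : ∀ t : ℝ, metricMatrix (om + (t : ℂ) • α) =
      metricMatrix om + (t : ℂ) • metricMatrix α := by
    intro t
    simp only [metricMatrix, smul_add]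
    rw [smul_comm]
  have hinv : ∀ j k, HasDerivAt (fun t : ℝ => invMetric (om + (t : ℂ) • α) j k)
      (-((metricMatrix om)⁻¹ * metricMatrix α * (metricMatrix om)⁻¹) k j) 0 := by
    intro j k
    simp only [invMetric, h1]
    exact hasDerivAt_inv_affine _ _ hdet k j
  have h2 := HasDerivAt.fun_sum (u := Finset.univ) fun j _ =>
    HasDerivAt.fun_sum (u := Finset.univ) fun k _ =>
      ((hinv j k).const_mul (-Complex.I)).mul (hF j k)
  refine h2.congr_deriv ?_
  simp only [Lam, lamVar, smul_eq_mul, ← Finset.sum_add_distrib]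
  refine Finset.sum_congr rfl fun j _ => Finset.sum_congr rfl fun k _ => ?_
  rw [add_comm]
  have h3 : -Complex.I * -((metricMatrix om)⁻¹ * metricMatrix α * (metricMatrix om)⁻¹) k j =
      ∑ p, ∑ q, invMetric om p k * invMetric om j q * α p q := by
    have hα : metricMatrix α = (-Complex.I) • α := rfl
    rw [hα]
    unfold invMetric
    generalize (metricMatrix om)⁻¹ = G
    rw [Matrix.mul_smul, Matrix.smul_mul, Matrix.smul_apply, smul_eq_mul, ← mul_neg, ← mul_assoc,
      neg_mul_neg, Complex.I_mul_I, neg_mul_neg, one_mul]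
    simp only [Matrix.mul_apply, Finset.sum_mul]
    rw [Finset.sum_comm]
    refine Finset.sum_congr rfl fun p _ => Finset.sum_congr rfl fun q _ => ?_
    ring
  rw [← h3]
  simp

/-- Of the four terms of the wedge product, two contract to `Λα · ΛF` and the two crossed ones to
`lamVar`; the `1/2` in `Λ²` removes the repetition. Thus the variation of `Λ_ω` is `Λ²(F ∧ α)` up to
a multiple of `ΛF`. -/
theorem Lam2_wedge11 (om α : Matrix (Fin m) (Fin m) ℂ) (F : Fin m → Fin m → M) :
    Lam2 om (wedge11 F α) = Lam om α • Lam om F + lamVar om α F := by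
  have hI : ∀ a b : ℂ, (-Complex.I * a) * (-Complex.I * b) = -(a * b) := fun a b => by
    ring_nf; simp [Complex.I_sq]
  have e1 : ∑ j, ∑ k, ∑ p, ∑ q, ((-Complex.I * invMetric om j k) * (-Complex.I * invMetric om p q))
      •
      α p q • F j k = Lam om α • Lam om F := by
    simp only [Lam, Finset.smul_sum, Finset.sum_smul, smul_eq_mul]
    refine Finset.sum_congr rfl fun j _ => Finset.sum_congr rfl fun k _ =>
      Finset.sum_congr rfl fun p _ => Finset.sum_congr rfl fun q _ => ?_
    rw [smul_smul, smul_smul]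
    congr 1; ring
  have e2 : ∑ j, ∑ k, ∑ p, ∑ q, ((-Complex.I * invMetric om j k) * (-Complex.I * invMetric om p q))
      •
      α j k • F p q = Lam om α • Lam om F := by
    simp only [Lam, Finset.smul_sum, Finset.sum_smul, smul_eq_mul]
    have : ∀ j k : Fin m, ∑ p, ∑ q, ((-Complex.I * invMetric om j k) *
        (-Complex.I * invMetric om p q)) • α j k • F p q = ∑ p, ∑ q,
        (-Complex.I * invMetric om j k * α j k) • (-Complex.I * invMetric om p q) • F p q :=
      fun j k => Finset.sum_congr rfl fun p _ => Finset.sum_congr rfl fun q _ => by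
        rw [smul_smul, smul_smul]; congr 1; ring
    simp only [this, ← Finset.smul_sum, ← Finset.sum_smul]
  have e3 : ∑ j, ∑ k, ∑ p, ∑ q, ((-Complex.I * invMetric om j k) * (-Complex.I * invMetric om p q))
      •
      α p k • F j q = -lamVar om α F := by
    simp only [lamVar, Finset.sum_smul, hI, neg_smul, Finset.sum_neg_distrib, neg_inj]
    refine Finset.sum_congr rfl fun j _ => ?_
    rw [sum_rotate]
    refine Finset.sum_congr rfl fun k _ => ?_
    rw [Finset.sum_comm]
    refine Finset.sum_congr rfl fun p _ => Finset.sum_congr rfl fun q _ => ?_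
    rw [smul_smul]
    congr 1; ring
  have e4 : ∑ j, ∑ k, ∑ p, ∑ q, ((-Complex.I * invMetric om j k) * (-Complex.I * invMetric om p q))
      •
      α j q • F p k = -lamVar om α F := by
    rw [← e3, sum_swap_pairs]
    refine Finset.sum_congr rfl fun p _ => Finset.sum_congr rfl fun q _ =>
      Finset.sum_congr rfl fun j _ => Finset.sum_congr rfl fun k _ => ?_
    rw [mul_comm]
  simp only [Lam2, wedge11, smul_add, smul_sub, Finset.sum_add_distrib, Finset.sum_sub_distrib]
  rw [e1, e2, e3, e4]
  module

theorem traceFree_smul_one {W : Type*} [AddCommGroup W] [Module ℂ W] [Module.Finite ℂ W] (c : ℂ) :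
    traceFree (c • (1 : Module.End ℂ W)) = 0 := by
  rcases subsingleton_or_nontrivial W with h | h
  · exact Subsingleton.elim _ _
  · have h0 : (Module.finrank ℂ W : ℂ) ≠ 0 := by
      exact_mod_cast (Module.finrank_pos (R := ℂ) (M := W)).ne'
    have : 1 / (Module.finrank ℂ W : ℂ) * (c * Module.finrank ℂ W) = c := by field_simp
    rw [traceFree, map_smul, LinearMap.trace_one, smul_eq_mul, this, sub_self]

/-- The trace-free part as a linear map. -/
def traceFreeL (W : Type*) [AddCommGroup W] [Module ℂ W] :
    Module.End ℂ W →ₗ[ℂ] Module.End ℂ W where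
  toFun := traceFree
  map_add' A B := by
    simp only [traceFree, map_add, mul_add, add_smul]; abel
  map_smul' c A := by
    simp only [traceFree, map_smul, smul_eq_mul, RingHom.id_apply, smul_sub, smul_smul]
    congr 2; ring

end Contraction

/-! ### The Fubini–Study metric in an affine chart: linear algebra -/

section FubiniStudyAlgebra

variable {R : Type*} [CommRing R] {n : ℕ}

/-- The matrix `w Γ_{jk} - w² y_j y'_k` with `y = Γ ū`, `y' = u Γ`: this is `∂∂̄ log N` for
`N = u Γ ū` and `w = N⁻¹`. -/
def fsMatrix (Γ : Matrix (Fin (n + 1)) (Fin (n + 1)) R) (u ub : Fin (n + 1) → R) (w : R) :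
    Matrix (Fin n) (Fin n) R :=
  Matrix.of fun j k => w * Γ j.succ k.succ -
    w ^ 2 * ((Γ.mulVec ub) j.succ * (Matrix.vecMul u Γ) k.succ)

/-- The matrix of the frame dual to the homogeneous coordinates: `(-u_j | I)`. -/
def homMatrix (u : Fin (n + 1) → R) : Matrix (Fin n) (Fin (n + 1)) R :=
  Matrix.of fun j a => (if a = j.succ then 1 else 0) - if a = 0 then u j.succ else 0

theorem homMatrix_mulVec (u : Fin (n + 1) → R) (hu : u 0 = 1) : (homMatrix u).mulVec u = 0 := by
  funext j
  simp [homMatrix, Matrix.mulVec, dotProduct, sub_mul, Finset.sum_sub_distrib, hu]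

/-- `fsMatrix` is the lower right block of the matrix `Θ = wΓ - w² y y'` of size `n + 1`, which
annihilates the radial vector `ū`. Modulo the radial directions `Θ` is inverted by `N S`, and the
two factors `homMatrix` pass to this quotient. -/
theorem fsMatrix_mul_inv {Γ S : Matrix (Fin (n + 1)) (Fin (n + 1)) R} (hΓ : Γ * S = 1)
    {u ub : Fin (n + 1) → R} (hu : u 0 = 1) (hub : ub 0 = 1) {w N : R}
    (hN : N = u ⬝ᵥ Γ.mulVec ub) (hw : w * N = 1) :
    fsMatrix Γ u ub w * (N • (homMatrix ub * S * (homMatrix u).transpose)) = 1 := by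
  set J : Matrix (Fin (n + 1)) (Fin n) R := Matrix.of fun a j => if a = j.succ then 1 else 0
    with hJ
  set y := Γ.mulVec ub with hy
  set y' := Matrix.vecMul u Γ with hy'
  set Θ : Matrix (Fin (n + 1)) (Fin (n + 1)) R := w • Γ - w ^ 2 • Matrix.vecMulVec y y' with hΘ
  have hθ : fsMatrix Γ u ub w = J.transpose * Θ * J := by
    ext j k
    simp [fsMatrix, hJ, hΘ, Matrix.mul_apply, Matrix.vecMulVec_apply, hy, hy']
  -- This product is a projection along `ū`; since `Θ ū = 0`, it can be dropped after `Θ`.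
  have hJE : J * homMatrix ub = 1 - Matrix.vecMulVec ub (Pi.single 0 1) := by
    ext a b
    refine Fin.cases ?_ (fun i => ?_) a
    · simp only [Matrix.mul_apply, hJ, Matrix.of_apply, Matrix.sub_apply, Matrix.vecMulVec_apply,
        hub]
      rw [Finset.sum_eq_zero fun j _ => by rw [if_neg (Fin.succ_ne_zero j).symm, zero_mul]]
      by_cases hb : b = 0
      · subst hb; simp
      · simp [hb, Ne.symm hb]
    · simp only [Matrix.mul_apply, hJ, Matrix.of_apply, Matrix.sub_apply, Matrix.vecMulVec_apply,
        homMatrix, Fin.succ_inj, ite_mul, one_mul, zero_mul, Finset.sum_ite_eq, Finset.mem_univ,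
        if_true, Matrix.one_apply]
      congr 1
      · simp [eq_comm]
      · simp [Pi.single_apply]
  have hyub : y' ⬝ᵥ ub = N := by rw [hy', ← Matrix.dotProduct_mulVec, hN]
  have hΘub : Θ.mulVec ub = 0 := by
    rw [hΘ, Matrix.sub_mulVec, Matrix.smul_mulVec, Matrix.smul_mulVec, Matrix.vecMulVec_mulVec,
      hyub, ← hy]
    funext a
    simp only [Pi.sub_apply, Pi.smul_apply, smul_eq_mul, MulOpposite.smul_eq_mul_unop,
      MulOpposite.unop_op, Pi.zero_apply]
    linear_combination (-w * y a) * hw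
  have hΘJE : Θ * J * homMatrix ub = Θ := by
    rw [Matrix.mul_assoc, hJE, Matrix.mul_sub, Matrix.mul_one, Matrix.mul_vecMulVec, hΘub]
    simp
  have hΘS : Θ * S = w • 1 - w ^ 2 • Matrix.vecMulVec y u := by
    rw [hΘ, sub_mul, smul_mul_assoc, hΓ, smul_mul_assoc, Matrix.vecMulVec_mul, hy',
      Matrix.vecMul_vecMul, hΓ, Matrix.vecMul_one]
  have hEJ : J.transpose * (homMatrix u).transpose = 1 := by
    rw [← Matrix.transpose_mul, ← Matrix.transpose_one]
    congr 1
    ext j k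
    simp [Matrix.mul_apply, homMatrix, hJ, Matrix.one_apply,
      Fin.succ_ne_zero, eq_comm]
  have h1 : Θ * J * (homMatrix ub * S * (homMatrix u).transpose) = w • (homMatrix u).transpose := by
    rw [← Matrix.mul_assoc, ← Matrix.mul_assoc, hΘJE, hΘS, Matrix.sub_mul, Matrix.smul_mul,
      Matrix.one_mul, Matrix.smul_mul, Matrix.vecMulVec_mul, Matrix.vecMul_transpose,
          homMatrix_mulVec u hu]
    ext a j
    simp [Matrix.vecMulVec_apply]
  rw [hθ, Matrix.mul_smul, Matrix.mul_assoc, Matrix.mul_assoc, ← Matrix.mul_assoc Θ, h1,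
    Matrix.mul_smul, hEJ, smul_smul, mul_comm, hw, one_smul]

/-- Replacing the first basis vector by `u` on one side and `ū` on the other has determinant one, as
`u 0 = ū 0 = 1`. In the new bases `Γ` has corner entry `N`, with Schur complement `N • fsMatrix`. -/
theorem det_fsMatrix {Γ : Matrix (Fin (n + 1)) (Fin (n + 1)) R} {u ub : Fin (n + 1) → R}
    (hu : u 0 = 1) (hub : ub 0 = 1) {w N : R} (hN : N = u ⬝ᵥ Γ.mulVec ub) (hw : w * N = 1) :
    (fsMatrix Γ u ub w).det = w ^ (n + 1) * Γ.det := by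
  let Q : (Fin (n + 1) → R) → Matrix (Fin (n + 1)) (Fin (n + 1)) R := fun u =>
    Matrix.of fun a c => Fin.cases (u a) (fun j => if a = j.succ then 1 else 0) c
  have hQ : ∀ u : Fin (n + 1) → R, u 0 = 1 → (Q u).det = 1 := by
    intro u hu
    rw [Matrix.det_succ_row_zero, Fin.sum_univ_succ]
    have h1 : (Q u).submatrix Fin.succ (Fin.succAbove 0) = 1 := by
      ext i j
      simp [Q, Matrix.one_apply]
    rw [h1]
    simp [Q, hu, (Fin.succ_ne_zero _).symm]
  let M := (Q u).transpose * Γ * Q ub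
  have hM : M.det = Γ.det := by
    simp only [M, Matrix.det_mul, Matrix.det_transpose, hQ u hu, hQ ub hub, one_mul, mul_one]
  have hM1 : ∀ c, (Γ * Q ub) c 0 = Γ.mulVec ub c := fun c => by
    simp [Matrix.mul_apply, Q, Matrix.mulVec, dotProduct]
  have hM2 : ∀ c (k : Fin n), (Γ * Q ub) c k.succ = Γ c k.succ := fun c k => by
    simp [Matrix.mul_apply, Q]
  have M00 : M 0 0 = N := by
    simp only [M, mul_assoc]
    rw [Matrix.mul_apply, hN]
    simp only [hM1]
    simp [Q, dotProduct]
  have M0k : ∀ k : Fin n, M 0 k.succ = Matrix.vecMul u Γ k.succ := fun k => by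
    simp only [M, mul_assoc]
    rw [Matrix.mul_apply]
    simp only [hM2]
    simp [Q, Matrix.vecMul, dotProduct]
  have Mj0 : ∀ j : Fin n, M j.succ 0 = Γ.mulVec ub j.succ := fun j => by
    simp only [M, mul_assoc]
    rw [Matrix.mul_apply]
    simp only [hM1]
    simp [Q]
  have Mjk : ∀ j k : Fin n, M j.succ k.succ = Γ j.succ k.succ := fun j k => by
    simp only [M, mul_assoc]
    rw [Matrix.mul_apply]
    simp only [hM2]
    simp [Q]
  let B : Matrix (Fin (n + 1)) (Fin (n + 1)) R := Matrix.of fun a c =>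
    M a c - Fin.cases 0 (fun j => w * Γ.mulVec ub j.succ) a * M 0 c
  have hB : M.det = B.det := by
    refine Matrix.det_eq_of_forall_row_eq_smul_add_const
      (fun a => Fin.cases 0 (fun j => w * Γ.mulVec ub j.succ) a) 0 rfl fun a c => ?_
    simp [B]
  have hBdet : B.det = N * (N • fsMatrix Γ u ub w).det := by
    rw [Matrix.det_succ_column_zero, Fin.sum_univ_succ]
    have h1 : ∀ j : Fin n, B j.succ 0 = 0 := fun j => by
      simp only [B, Matrix.of_apply, M00, Mj0, Fin.cases_succ]
      linear_combination (-Γ.mulVec ub j.succ) * hw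
    have h2 : B.submatrix (Fin.succAbove 0) Fin.succ = N • fsMatrix Γ u ub w := by
      ext j k
      simp only [Matrix.submatrix_apply, Fin.succAbove_zero, B, Matrix.of_apply, Mjk, M0k,
        Fin.cases_succ, Matrix.smul_apply, fsMatrix, smul_eq_mul]
      linear_combination (-Γ j.succ k.succ + w * Γ.mulVec ub j.succ * Matrix.vecMul u Γ k.succ) * hw
    simp only [h1, h2]
    simp [B, M00]
  rw [← hM, hB, hBdet, Matrix.det_smul, Fintype.card_fin, ← mul_assoc N, ← pow_succ', ← mul_assoc,
    ← mul_pow, hw, one_pow, one_mul]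

end FubiniStudyAlgebra

/-! ### The Fubini–Study Laplacian in a differential ring -/

section FubiniStudyRing

variable {R : Type*} [CommRing R] {n : ℕ}

/-- An affine chart of projective space over a ring with derivations `D j = ∂_j`, `Db k = ∂_k̄`. -/
structure ProjRing (D Db : Fin n → Derivation ℤ R R) (U Ub : Fin (n + 1) → R)
    (Γ S : Matrix (Fin (n + 1)) (Fin (n + 1)) R) (w : R) : Prop where
  u_zero : U 0 = 1
  ub_zero : Ub 0 = 1
  D_u : ∀ j a, D j (U a) = if a = j.succ then 1 else 0
  D_ub : ∀ j a, D j (Ub a) = 0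
  Db_u : ∀ j a, Db j (U a) = 0
  Db_ub : ∀ j a, Db j (Ub a) = if a = j.succ then 1 else 0
  D_Γ : ∀ j a c, D j (Γ a c) = 0
  Db_Γ : ∀ j a c, Db j (Γ a c) = 0
  inv : S * Γ = 1
  w_mul : w * (U ⬝ᵥ Γ.mulVec Ub) = 1

/-- The derivative along a homogeneous coordinate. -/
def homD (D : Fin n → Derivation ℤ R R) (U : Fin (n + 1) → R) :
    Fin (n + 1) → Derivation ℤ R R :=
  Fin.cons (-∑ j, U j.succ • D j) D

/-- For functions homogeneous of degree zero, Euler's relation `∑ u_a ∂_a = 0` at `u_0 = 1` forces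
`∂_0 = -∑ u_j ∂_j`; this is the first column of `homMatrix`. -/
theorem homD_apply (D : Fin n → Derivation ℤ R R) (U : Fin (n + 1) → R) (a : Fin (n + 1)) (r : R) :
    homD D U a r = ∑ j, homMatrix U j a * D j r := by
  have hsum : ∀ (s : Finset (Fin n)), (∑ j ∈ s, U j.succ • D j) r = ∑ j ∈ s, U j.succ * D j r := by
    intro s
    induction s using Finset.induction_on with
    | empty => simp
    | insert a s ha ih => simp [Finset.sum_insert ha, ih]
  refine Fin.cases ?_ (fun i => ?_) a
  · simp [homD, hsum, homMatrix, (Fin.succ_ne_zero _).symm]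
  · simp [homD, homMatrix, Fin.succ_ne_zero]

/-- `∑ N S_{ba} ∂_a f ∂_b̄ g`. -/
def fsGrad (D Db : Fin n → Derivation ℤ R R) (U Ub : Fin (n + 1) → R)
    (Γ S : Matrix (Fin (n + 1)) (Fin (n + 1)) R) (f g : R) : R :=
  (U ⬝ᵥ Γ.mulVec Ub) * ∑ a, ∑ b, S b a * (homD D U a f * homD Db Ub b g)

/-- `∑ N S_{ba} ∂_b̄ ∂_a f`. -/
def fsLap (D Db : Fin n → Derivation ℤ R R) (U Ub : Fin (n + 1) → R)
    (Γ S : Matrix (Fin (n + 1)) (Fin (n + 1)) R) (f : R) : R :=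
  (U ⬝ᵥ Γ.mulVec Ub) * ∑ a, ∑ b, S b a * homD Db Ub b (homD D U a f)

namespace ProjRing

variable {D Db : Fin n → Derivation ℤ R R} {U Ub : Fin (n + 1) → R}
  {Γ S : Matrix (Fin (n + 1)) (Fin (n + 1)) R} {w : R}

theorem fsGrad_mul_left (f g k : R) : fsGrad D Db U Ub Γ S (f * g) k =
    f * fsGrad D Db U Ub Γ S g k + g * fsGrad D Db U Ub Γ S f k := by
  simp only [fsGrad, Derivation.leibniz, smul_eq_mul, Finset.mul_sum, ← Finset.sum_add_distrib]
  exact Finset.sum_congr rfl fun _ _ => Finset.sum_congr rfl fun _ _ => by ring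

theorem fsGrad_mul_right (f g k : R) : fsGrad D Db U Ub Γ S k (f * g) =
    f * fsGrad D Db U Ub Γ S k g + g * fsGrad D Db U Ub Γ S k f := by
  simp only [fsGrad, Derivation.leibniz, smul_eq_mul, Finset.mul_sum, ← Finset.sum_add_distrib]
  exact Finset.sum_congr rfl fun _ _ => Finset.sum_congr rfl fun _ _ => by ring

theorem fsLap_mul (f g : R) : fsLap D Db U Ub Γ S (f * g) =
    f * fsLap D Db U Ub Γ S g + g * fsLap D Db U Ub Γ S f +
      fsGrad D Db U Ub Γ S f g + fsGrad D Db U Ub Γ S g f := by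
  simp only [fsLap, fsGrad, Derivation.leibniz, smul_eq_mul, Finset.mul_sum, map_add,
    ← Finset.sum_add_distrib]
  exact Finset.sum_congr rfl fun _ _ => Finset.sum_congr rfl fun _ _ => by ring

theorem fsLap_sum {ι : Type*} (s : Finset ι) (r : ι → R) :
    fsLap D Db U Ub Γ S (∑ i ∈ s, r i) = ∑ i ∈ s, fsLap D Db U Ub Γ S (r i) :=
  map_sum (AddMonoidHom.mk' (fsLap D Db U Ub Γ S) fun f g => by
    simp only [fsLap, map_add, mul_add, Finset.sum_add_distrib]) r s

theorem homD_u (h : ProjRing D Db U Ub Γ S w) (a c : Fin (n + 1)) :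
    homD D U a (U c) = (if a = c then 1 else 0) - if a = 0 then U c else 0 := by
  simp only [homD_apply, h.D_u]
  refine Fin.cases ?_ (fun i => ?_) c
  · simp only [(Fin.succ_ne_zero _).symm, if_false, mul_zero, Finset.sum_const_zero, h.u_zero]
    by_cases ha : a = 0 <;> simp [ha]
  · simp [homMatrix]

theorem homD_ub (h : ProjRing D Db U Ub Γ S w) (a c : Fin (n + 1)) : homD D U a (Ub c) = 0 := by
  simp [homD_apply, h.D_ub]

theorem homDb_u (h : ProjRing D Db U Ub Γ S w) (a c : Fin (n + 1)) : homD Db Ub a (U c) = 0 := by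
  simp [homD_apply, h.Db_u]

theorem homDb_ub (h : ProjRing D Db U Ub Γ S w) (a c : Fin (n + 1)) :
    homD Db Ub a (Ub c) = (if a = c then 1 else 0) - if a = 0 then Ub c else 0 := by
  simp only [homD_apply, h.Db_ub]
  refine Fin.cases ?_ (fun i => ?_) c
  · simp only [(Fin.succ_ne_zero _).symm, if_false, mul_zero, Finset.sum_const_zero, h.ub_zero]
    by_cases ha : a = 0 <;> simp [ha]
  · simp [homMatrix]

theorem homD_Γ (h : ProjRing D Db U Ub Γ S w) (a c e : Fin (n + 1)) : homD D U a (Γ c e) = 0 := by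
  simp [homD_apply, h.D_Γ]

theorem homDb_Γ (h : ProjRing D Db U Ub Γ S w) (a c e : Fin (n + 1)) : homD Db Ub a (Γ c e) = 0 :=
    by
  simp [homD_apply, h.Db_Γ]

theorem homD_N (h : ProjRing D Db U Ub Γ S w) (a : Fin (n + 1)) : homD D U a (U ⬝ᵥ Γ.mulVec Ub) =
    Γ.mulVec Ub a - if a = 0 then U ⬝ᵥ Γ.mulVec Ub else 0 := by
  have h1 : ∀ c, homD D U a (Γ.mulVec Ub c) = 0 := fun c => by
    simp [Matrix.mulVec, dotProduct, Derivation.leibniz, h.homD_Γ, h.homD_ub]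
  simp only [dotProduct, map_sum, Derivation.leibniz, h1, h.homD_u, smul_eq_mul, mul_zero, zero_add,
    mul_sub, Finset.sum_sub_distrib]
  congr 1
  · simp
  · by_cases ha : a = 0 <;> simp [ha, mul_comm]

theorem homDb_y (h : ProjRing D Db U Ub Γ S w) (b a : Fin (n + 1)) : homD Db Ub b (Γ.mulVec Ub a) =
    Γ a b - if b = 0 then Γ.mulVec Ub a else 0 := by
  simp only [Matrix.mulVec, dotProduct, map_sum, Derivation.leibniz, h.homDb_Γ, h.homDb_ub,
    smul_eq_mul, mul_zero, add_zero, mul_sub, Finset.sum_sub_distrib]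
  congr 1
  · simp
  · by_cases ha : b = 0 <;> simp [ha]

theorem homDb_N (h : ProjRing D Db U Ub Γ S w) (b : Fin (n + 1)) : homD Db Ub b (U ⬝ᵥ Γ.mulVec Ub) =
    Matrix.vecMul U Γ b - if b = 0 then U ⬝ᵥ Γ.mulVec Ub else 0 := by
  simp only [dotProduct, map_sum, Derivation.leibniz, h.homDb_u, h.homDb_y, smul_eq_mul, mul_zero,
    add_zero, mul_sub, Finset.sum_sub_distrib]
  congr 1
  by_cases ha : b = 0 <;> simp [ha]

theorem deriv_w (h : ProjRing D Db U Ub Γ S w) (δ : Derivation ℤ R R) : δ w = -(w ^ 2 * δ (U ⬝ᵥ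
    Γ.mulVec Ub)) := by
  rw [δ.leibniz_of_mul_eq_one h.w_mul]; simp

/-- The quotient `u_c ū_e / N` has degree zero, so the corrections at index `0` caused by the
normalization `u_0 = 1` cancel, and the formula is uniform in `a`. -/
theorem homD_rho (h : ProjRing D Db U Ub Γ S w) (a c e : Fin (n + 1)) : homD D U a (U c * Ub e * w)
    =
    (if a = c then Ub e * w else 0) - U c * Ub e * w * (w * Γ.mulVec Ub a) := by
  simp only [Derivation.leibniz, h.deriv_w, h.homD_u, h.homD_ub, h.homD_N, smul_eq_mul]
  have hw := h.w_mul
  by_cases ha : a = 0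
  · rw [if_pos ha, if_pos ha]
    split_ifs <;> linear_combination (U c * Ub e * w) * hw
  · rw [if_neg ha, if_neg ha]
    split_ifs <;> ring

theorem homDb_ub_w (h : ProjRing D Db U Ub Γ S w) (b e : Fin (n + 1)) : homD Db Ub b (Ub e * w) =
    (if b = e then w else 0) - Ub e * w * (w * Matrix.vecMul U Γ b) := by
  simp only [Derivation.leibniz, h.deriv_w, h.homDb_ub, h.homDb_N, smul_eq_mul]
  have hw := h.w_mul
  by_cases ha : b = 0
  · rw [if_pos ha, if_pos ha]
    split_ifs <;> linear_combination (Ub e * w) * hw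
  · rw [if_neg ha, if_neg ha]
    split_ifs <;> ring

theorem homDb_rho (h : ProjRing D Db U Ub Γ S w) (b c e : Fin (n + 1)) : homD Db Ub b (U c * Ub e *
    w) =
    (if b = e then U c * w else 0) - U c * Ub e * w * (w * Matrix.vecMul U Γ b) := by
  rw [mul_assoc, Derivation.leibniz, h.homDb_ub_w, h.homDb_u]
  simp only [smul_eq_mul, mul_zero, add_zero]
  split_ifs <;> ring

theorem homDb_w_y (h : ProjRing D Db U Ub Γ S w) (b a : Fin (n + 1)) : homD Db Ub b (w * Γ.mulVec
    Ub a) =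
    w * Γ a b - w * Γ.mulVec Ub a * (w * Matrix.vecMul U Γ b) := by
  simp only [Derivation.leibniz, h.deriv_w, h.homDb_y, h.homDb_N, smul_eq_mul]
  have hw := h.w_mul
  by_cases ha : b = 0
  · simp only [ha, if_true]
    linear_combination (w * Γ.mulVec Ub a) * hw
  · simp only [ha, if_false]
    ring

theorem sum_S_y (h : ProjRing D Db U Ub Γ S w) (b : Fin (n + 1)) : ∑ a,
    S b a * Γ.mulVec Ub a = Ub b := by
  have := congrFun (Matrix.mulVec_mulVec Ub S Γ) b
  rw [h.inv, Matrix.one_mulVec] at this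
  exact this

theorem sum_y_S (h : ProjRing D Db U Ub Γ S w) (a : Fin (n + 1)) : ∑ b,
    Matrix.vecMul U Γ b * S b a = U a := by
  have := congrFun (Matrix.vecMul_vecMul U Γ S) a
  rw [mul_eq_one_comm.1 h.inv, Matrix.vecMul_one] at this
  exact this

theorem sum_S_Γ (h : ProjRing D Db U Ub Γ S w) : ∑ a, ∑ b, S b a * Γ a b = (n + 1 : ℕ) := by
  rw [Finset.sum_comm]
  have : ∀ b, ∑ a, S b a * Γ a b = 1 := fun b => by
    rw [← Matrix.mul_apply, h.inv, Matrix.one_apply_eq]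
  simp [this]

/-- The product of the two derivatives expands into four sums, which `S y = ū` and `y' S = u`
contract; `w N = 1` absorbs the factor `N`. The result is a polynomial in `S` and the functions `u_c
ū_e / N`, so Laplacians of products stay in the algebra they generate. -/
theorem fsGrad_rho (h : ProjRing D Db U Ub Γ S w) (c e c' e' : Fin (n + 1)) :
    fsGrad D Db U Ub Γ S (U c * Ub e * w) (U c' * Ub e' * w) =
      S e' c * (U c' * Ub e * w) - U c * Ub e * w * (U c' * Ub e' * w) := by
  set ρ := U c * Ub e * w with hρ
  set ρ' := U c' * Ub e' * w with hρ'
  set N := U ⬝ᵥ Γ.mulVec Ub with hN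
  set y := Γ.mulVec Ub with hy
  set y' := Matrix.vecMul U Γ with hy'
  have hw : w * N = 1 := h.w_mul
  have hyN : ∑ b, y' b * Ub b = N := (Matrix.dotProduct_mulVec U Γ Ub).symm
  have key : ∑ a, ∑ b, S b a * (homD D U a ρ * homD Db Ub b ρ') =
      S e' c * (Ub e * w) * (U c' * w) - ρ' * w * (Ub e * w) * U c - ρ * w * (U c' * w) * Ub e' +
        ρ * w * (ρ' * w) * N := by
    have e1 : ∀ a b, S b a * (homD D U a ρ * homD Db Ub b ρ') =
        (if a = c then (if b = e' then S b a * (Ub e * w) * (U c' * w) else 0) else 0) -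
        (if a = c then (ρ' * w * (Ub e * w)) * (y' b * S b a) else 0) -
        (if b = e' then (ρ * w * (U c' * w)) * (S b a * y a) else 0) +
        ρ * w * (ρ' * w) * (y' b * (S b a * y a)) := by
      intro a b
      rw [hρ, h.homD_rho, hρ', h.homDb_rho, ← hρ, ← hρ']
      split_ifs <;> ring
    simp only [e1, Finset.sum_add_distrib, Finset.sum_sub_distrib]
    congr 1
    · congr 1
      · congr 1
        · simp
        · rw [Finset.sum_comm]
          simp only [Finset.sum_ite_eq', Finset.mem_univ, if_true, ← Finset.mul_sum]
          rw [h.sum_y_S]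
      · simp only [Finset.sum_ite_eq', Finset.mem_univ, if_true, ← Finset.mul_sum]
        rw [h.sum_S_y]
    · rw [Finset.sum_comm]
      simp only [← Finset.mul_sum, hy, h.sum_S_y]
      rw [hyN]
  rw [fsGrad, key]
  simp only [hρ, hρ']
  linear_combination (S e' c * (U c' * Ub e * w) - U c * Ub e * w * (U c' * Ub e' * w) +
    (w * N) * U c * Ub e * w * (U c' * Ub e' * w)) * hw

/-- The multiple of `u_c ū_e / N` comes only from `tr (S Γ) = n + 1`; the other terms containing it
cancel. -/
theorem fsLap_rho (h : ProjRing D Db U Ub Γ S w) (c e : Fin (n + 1)) :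
    fsLap D Db U Ub Γ S (U c * Ub e * w) = S e c - (n + 1 : ℕ) * (U c * Ub e * w) := by
  set ρ := U c * Ub e * w with hρ
  set N := U ⬝ᵥ Γ.mulVec Ub with hN
  set y := Γ.mulVec Ub with hy
  set y' := Matrix.vecMul U Γ with hy'
  have hw : w * N = 1 := h.w_mul
  have hyN : ∑ b, y' b * Ub b = N := (Matrix.dotProduct_mulVec U Γ Ub).symm
  have key : ∑ a, ∑ b, S b a * homD Db Ub b (homD D U a ρ) =
      S e c * w - Ub e * w ^ 2 * U c - U c * w ^ 2 * Ub e + 2 * ρ * w ^ 2 * N -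
        ρ * w * (n + 1 : ℕ) := by
    have e1 : ∀ a b, S b a * homD Db Ub b (homD D U a ρ) =
        (if a = c then (if b = e then S b a * w else 0) else 0) -
        (if a = c then (Ub e * w ^ 2) * (y' b * S b a) else 0) -
        (if b = e then (U c * w ^ 2) * (S b a * y a) else 0) +
        2 * ρ * w ^ 2 * (y' b * (S b a * y a)) - ρ * w * (S b a * Γ a b) := by
      intro a b
      rw [hρ, h.homD_rho, ← hρ, map_sub, Derivation.leibniz, h.homDb_w_y, hρ, h.homDb_rho, ← hρ]
      by_cases ha : a = c
      · simp only [if_pos ha, h.homDb_ub_w, smul_eq_mul]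
        split_ifs <;> simp only [hρ] <;> ring
      · simp only [if_neg ha, map_zero, smul_eq_mul]
        split_ifs <;> simp only [hρ] <;> ring
    simp only [e1, Finset.sum_add_distrib, Finset.sum_sub_distrib]
    congr 1
    · congr 1
      · congr 1
        · congr 1
          · simp
          · rw [Finset.sum_comm]
            simp only [Finset.sum_ite_eq', Finset.mem_univ, if_true, ← Finset.mul_sum]
            rw [h.sum_y_S]
        · simp only [Finset.sum_ite_eq', Finset.mem_univ, if_true, ← Finset.mul_sum]
          rw [h.sum_S_y]
      · rw [Finset.sum_comm]
        simp only [← Finset.mul_sum, hy, h.sum_S_y]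
        rw [hyN]
    · simp only [← Finset.mul_sum]
      rw [h.sum_S_Γ]
  rw [fsLap, key]
  simp only [hρ]
  linear_combination (S e c - (n + 1 : ℕ) * (U c * Ub e * w) - 2 * (U c * Ub e * w) + 2 * (U c * Ub
      e * w) * (w * N + 1)) * hw

end ProjRing

/-- The product of the `r c e` over a list of pairs of indices. -/
def rhoProd (r : Fin (n + 1) → Fin (n + 1) → R) (l : List (Fin (n + 1) × Fin (n + 1))) : R :=
  (l.map fun p => r p.1 p.2).prod

/-- The pairing of the `∂`-gradient of a product with the `∂̄`-gradient of `r c e`. -/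
def gradProdLeft (S : Matrix (Fin (n + 1)) (Fin (n + 1)) R) (r : Fin (n + 1) → Fin (n + 1) → R)
    (c e : Fin (n + 1)) : List (Fin (n + 1) × Fin (n + 1)) → R
  | [] => 0
  | p :: l => r p.1 p.2 * gradProdLeft S r c e l +
      rhoProd r l * (S e p.1 * r c p.2 - r p.1 p.2 * r c e)

/-- The pairing of the `∂`-gradient of `r c e` with the `∂̄`-gradient of a product. -/
def gradProdRight (S : Matrix (Fin (n + 1)) (Fin (n + 1)) R) (r : Fin (n + 1) → Fin (n + 1) → R)
    (c e : Fin (n + 1)) : List (Fin (n + 1) × Fin (n + 1)) → R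
  | [] => 0
  | p :: l => r p.1 p.2 * gradProdRight S r c e l +
      rhoProd r l * (S p.2 c * r p.1 e - r c e * r p.1 p.2)

/-- The Laplacian of a product, as a polynomial in its factors. -/
def lapProd (S : Matrix (Fin (n + 1)) (Fin (n + 1)) R) (r : Fin (n + 1) → Fin (n + 1) → R) :
    List (Fin (n + 1) × Fin (n + 1)) → R
  | [] => 0
  | p :: l => r p.1 p.2 * lapProd S r l + rhoProd r l * (S p.2 p.1 - (n + 1 : ℕ) * r p.1 p.2) +
      gradProdRight S r p.1 p.2 l + gradProdLeft S r p.1 p.2 l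

theorem rhoProd_cons (r : Fin (n + 1) → Fin (n + 1) → R) (p : Fin (n + 1) × Fin (n + 1))
    (l : List (Fin (n + 1) × Fin (n + 1))) : rhoProd r (p :: l) = r p.1 p.2 * rhoProd r l := by
  simp [rhoProd]

namespace ProjRing

variable {D Db : Fin n → Derivation ℤ R R} {U Ub : Fin (n + 1) → R}
  {Γ S : Matrix (Fin (n + 1)) (Fin (n + 1)) R} {w : R}

theorem fsGrad_rhoProd_left (h : ProjRing D Db U Ub Γ S w) (c e : Fin (n + 1))
    (l : List (Fin (n + 1) × Fin (n + 1))) :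
    fsGrad D Db U Ub Γ S (rhoProd (fun c e => U c * Ub e * w) l) (U c * Ub e * w) =
      gradProdLeft S (fun c e => U c * Ub e * w) c e l := by
  induction l with
  | nil => simp [gradProdLeft, rhoProd, fsGrad]
  | cons p l ih => rw [rhoProd_cons, fsGrad_mul_left, ih, h.fsGrad_rho, gradProdLeft]

theorem fsGrad_rhoProd_right (h : ProjRing D Db U Ub Γ S w) (c e : Fin (n + 1))
    (l : List (Fin (n + 1) × Fin (n + 1))) :
    fsGrad D Db U Ub Γ S (U c * Ub e * w) (rhoProd (fun c e => U c * Ub e * w) l) =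
      gradProdRight S (fun c e => U c * Ub e * w) c e l := by
  induction l with
  | nil => simp [gradProdRight, rhoProd, fsGrad]
  | cons p l ih => rw [rhoProd_cons, fsGrad_mul_right, ih, h.fsGrad_rho, gradProdRight]

theorem fsLap_rhoProd (h : ProjRing D Db U Ub Γ S w) (l : List (Fin (n + 1) × Fin (n + 1))) :
    fsLap D Db U Ub Γ S (rhoProd (fun c e => U c * Ub e * w) l) =
      lapProd S (fun c e => U c * Ub e * w) l := by
  induction l with
  | nil => simp [lapProd, rhoProd, fsLap]
  | cons p l ih =>
    rw [rhoProd_cons, fsLap_mul, ih, h.fsLap_rho, h.fsGrad_rhoProd_left, h.fsGrad_rhoProd_right,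
      lapProd]

end ProjRing

/-! ### Naturality of the product formulas under ring homomorphisms -/

section Map

variable {R' : Type*} [CommRing R'] (f : R →+* R')

theorem map_rhoProd (r : Fin (n + 1) → Fin (n + 1) → R)
    (l : List (Fin (n + 1) × Fin (n + 1))) :
    f (rhoProd r l) = rhoProd (fun c e => f (r c e)) l := by
  simp [rhoProd, map_list_prod, Function.comp_def]

theorem map_gradProdLeft (S : Matrix (Fin (n + 1)) (Fin (n + 1)) R)
    (r : Fin (n + 1) → Fin (n + 1) → R) (c e : Fin (n + 1))
    (l : List (Fin (n + 1) × Fin (n + 1))) :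
    f (gradProdLeft S r c e l) = gradProdLeft (S.map f) (fun c e => f (r c e)) c e l := by
  induction l with
  | nil => simp [gradProdLeft]
  | cons p l ih => simp [gradProdLeft, ih, map_rhoProd]

theorem map_gradProdRight (S : Matrix (Fin (n + 1)) (Fin (n + 1)) R)
    (r : Fin (n + 1) → Fin (n + 1) → R) (c e : Fin (n + 1))
    (l : List (Fin (n + 1) × Fin (n + 1))) :
    f (gradProdRight S r c e l) = gradProdRight (S.map f) (fun c e => f (r c e)) c e l := by
  induction l with
  | nil => simp [gradProdRight]
  | cons p l ih => simp [gradProdRight, ih, map_rhoProd]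

/-- This serves both to evaluate germs at a point and to evaluate families of functions at a
parameter and a point. -/
theorem map_lapProd (S : Matrix (Fin (n + 1)) (Fin (n + 1)) R)
    (r : Fin (n + 1) → Fin (n + 1) → R) (l : List (Fin (n + 1) × Fin (n + 1))) :
    f (lapProd S r l) = lapProd (S.map f) (fun c e => f (r c e)) l := by
  induction l with
  | nil => simp [lapProd]
  | cons p l ih => simp [lapProd, ih, map_rhoProd, map_gradProdLeft, map_gradProdRight]

end Map

end FubiniStudyRing

/-! ### The fibre integrand in an affine chart -/

section FibreAlgebra

variable {V : Type*} [AddCommGroup V] [Module ℂ V] {n d : ℕ}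

/-- The homogeneous coordinates `(1, ξ)`. -/
def affVec (ξ : Fin n → ℂ) : Fin (n + 1) → ℂ := Fin.cons 1 ξ

/-- The Gram matrix of `h` in a basis. -/
def gramMat {κ : Type*} (b : Module.Basis κ ℂ V) (h : Sesq V) : Matrix κ κ ℂ :=
  Matrix.of fun a c => h (b c) (b a)

/-- The squared norm of `∑ u_a e_a*` for the dual metric with matrix `Γ`. -/
def dualQuad (Γ : Matrix (Fin (n + 1)) (Fin (n + 1)) ℂ) (u : Fin (n + 1) → ℂ) : ℂ :=
  u ⬝ᵥ Γ.mulVec fun a => conj (u a)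

/-- The functions `u_c ū_e / N` on projective space. -/
def rho (Γ : Matrix (Fin (n + 1)) (Fin (n + 1)) ℂ) (ξ : Fin n → ℂ) (c e : Fin (n + 1)) : ℂ :=
  affVec ξ c * conj (affVec ξ e) * (dualQuad Γ (affVec ξ))⁻¹

theorem affVec_ne_zero (ξ : Fin n → ℂ) : affVec ξ ≠ 0 := fun h => by
  have := congrFun h 0
  simp [affVec] at this

theorem affDual_apply (b : Module.Basis (Fin (n + 1)) ℂ V) (ξ : Fin n → ℂ) (x : V) :
    affDual b ξ x = ∑ a, affVec ξ a * b.repr x a := by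
  rw [Fin.sum_univ_succ]
  simp [affDual, affVec, LinearMap.sum_apply]

theorem sesq_apply_eq_sum {κ : Type*} [Fintype κ] (b : Module.Basis κ ℂ V) (h : Sesq V)
    (x y : V) :
    h x y = ∑ a, ∑ c, conj (b.repr y a) * (gramMat b h a c * b.repr x c) := by
  conv_lhs => rw [← b.sum_repr x, ← b.sum_repr y]
  simp only [map_sum, LinearMap.sum_apply, LinearMap.map_smulₛₗ, LinearMap.smul_apply, map_smul,
    smul_eq_mul, gramMat, Matrix.of_apply, Finset.mul_sum]
  refine Finset.sum_congr rfl fun a _ => Finset.sum_congr rfl fun c _ => ?_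
  ring

theorem IsHermInner.gramMat_posDef {κ : Type*} [Fintype κ] {h : Sesq V} (hh : IsHermInner h)
    (b : Module.Basis κ ℂ V) : (gramMat b h).PosDef := by
  refine Matrix.PosDef.of_dotProduct_mulVec_pos ?_ fun x hx => ?_
  · ext a c
    exact (hh.1 (b a) (b c)).symm
  · have h1 : star x ⬝ᵥ (gramMat b h).mulVec x = h (b.equivFun.symm x) (b.equivFun.symm x) := by
      rw [sesq_apply_eq_sum b]
      simp only [dotProduct, Matrix.mulVec, Finset.mul_sum, ← b.equivFun_apply,
        LinearEquiv.apply_symm_apply]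
      rfl
    have h2 : b.equivFun.symm x ≠ 0 := (map_ne_zero_iff _ b.equivFun.symm.injective).2 hx
    rw [h1, Complex.lt_def]
    refine ⟨hh.2 _ h2, ?_⟩
    have := congrArg Complex.im (hh.1 (b.equivFun.symm x) (b.equivFun.symm x))
    simp only [Complex.conj_im] at this
    simp only [Complex.zero_im]
    linarith

theorem dualQuad_pos {Γ : Matrix (Fin (n + 1)) (Fin (n + 1)) ℂ} (hΓ : Γ.PosDef)
    {u : Fin (n + 1) → ℂ} (hu : u ≠ 0) : 0 < dualQuad Γ u := by
  have h1 : (fun a => conj (u a)) ≠ 0 := fun h => hu (funext fun a => by simpa using congrFun h a)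
  have h2 := hΓ.dotProduct_mulVec_pos h1
  rwa [show star (fun a => conj (u a)) = u from funext fun a => Complex.conj_conj _] at h2

/-- The vector representing `∑ u_a e_a*`. -/
def affRiesz (b : Module.Basis (Fin (n + 1)) ℂ V) (h : Sesq V) (ξ : Fin n → ℂ) : V :=
  ∑ c, ((gramMat b h)⁻¹.mulVec fun a => conj (affVec ξ a)) c • b c

variable {h : Sesq V} (b : Module.Basis (Fin (n + 1)) ℂ V)

theorem repr_affRiesz (ξ : Fin n → ℂ) (c : Fin (n + 1)) :
    b.repr (affRiesz b h ξ) c = ((gramMat b h)⁻¹.mulVec fun a => conj (affVec ξ a)) c := by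
  simp [affRiesz, Finsupp.single_apply]

theorem IsHermInner.apply_affRiesz (hh : IsHermInner h) (ξ : Fin n → ℂ) (x : V) :
    h x (affRiesz b h ξ) = affDual b ξ x := by
  have hS := hh.gramMat_posDef b
  have h1 : (gramMat b h).mulVec (fun c => b.repr (affRiesz b h ξ) c) =
      fun a => conj (affVec ξ a) := by
    simp only [repr_affRiesz]
    rw [Matrix.mulVec_mulVec, Matrix.mul_nonsing_inv _ (Matrix.isUnit_iff_isUnit_det _ |>.1
        hS.isUnit),
      Matrix.one_mulVec]
  rw [hh.1 (affRiesz b h ξ) x, sesq_apply_eq_sum b, affDual_apply]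
  simp only [map_sum, map_mul, Complex.conj_conj]
  refine Finset.sum_congr rfl fun a _ => ?_
  have h2 := congrArg conj (congrFun h1 a)
  rw [Complex.conj_conj] at h2
  rw [← h2, Matrix.mulVec, dotProduct, map_sum, Finset.sum_mul]
  exact Finset.sum_congr rfl fun c _ => by rw [map_mul]; ring

theorem affDual_affRiesz (ξ : Fin n → ℂ) :
    affDual b ξ (affRiesz b h ξ) = dualQuad (gramMat b h)⁻¹ (affVec ξ) := by
  simp only [affDual_apply, repr_affRiesz]
  rfl

theorem IsHermInner.re_self_nonneg (hh : IsHermInner h) (x : V) : 0 ≤ (h x x).re := by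
  by_cases hx : x = 0
  · simp [hx]
  · exact (hh.2 x hx).le

theorem IsHermInner.ofReal_re_self (hh : IsHermInner h) (x : V) : ((h x x).re : ℂ) = h x x :=
  (Complex.conj_eq_iff_re.1 (hh.1 x x).symm)

/-- The Cauchy–Schwarz inequality. -/
theorem IsHermInner.normSq_le (hh : IsHermInner h) (x y : V) :
    Complex.normSq (h x y) ≤ (h x x).re * (h y y).re := by
  by_cases hy : y = 0
  · simp [hy]
  have hy0 := hh.2 y hy
  have h1 := hh.re_self_nonneg (((h y y).re : ℂ) • x - h x y • y)
  have h2 : h (((h y y).re : ℂ) • x - h x y • y) (((h y y).re : ℂ) • x - h x y • y) =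
      (((h y y).re * ((h x x).re * (h y y).re - Complex.normSq (h x y)) : ℝ) : ℂ) := by
    simp only [map_sub, map_smul, LinearMap.sub_apply, LinearMap.smul_apply, LinearMap.map_smulₛₗ,
      smul_eq_mul, Complex.conj_ofReal, hh.1 x y]
    push_cast
    rw [Complex.normSq_eq_conj_mul_self, hh.ofReal_re_self, hh.ofReal_re_self]
    ring
  rw [h2, Complex.ofReal_re] at h1
  nlinarith [nonneg_of_mul_nonneg_right h1 hy0]

theorem IsHermInner.ext_right {W : Type*} [AddCommGroup W] [Module ℂ W] {H : Sesq W}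
    (hH : IsHermInner H) {x y : W} (hxy : ∀ u, H u x = H u y) : x = y := by
  by_contra hne
  have h1 := hH.2 (x - y) (sub_ne_zero.2 hne)
  rw [map_sub (H (x - y)), hxy, sub_self] at h1
  simp at h1

/-- If `w` represents `v` then `w^d` represents `v^{⊗ d}`: each of the `d!` permutations gives the
same term, against the factor `1/d!`. -/
theorem dualVec_symForm (hh : IsHermInner h) (ξ : Fin n → ℂ) :
    dualVec (symForm d h) (affDual b ξ) = sprod fun _ => affRiesz b h ξ := by
  have h1 : ∀ u, dualPow d (affDual b ξ) u = symForm d h u (sprod fun _ => affRiesz b h ξ) := by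
    have : dualPow d (affDual b ξ) = (symForm d h).flip (sprod fun _ => affRiesz b h ξ) := by
      refine symP_ext fun v => ?_
      rw [LinearMap.flip_apply, symForm_sprod, dualPow_sprod]
      simp only [hh.apply_affRiesz b, Finset.sum_const, Finset.card_univ, Fintype.card_perm,
        Fintype.card_fin, nsmul_eq_mul]
      rw [inv_mul_cancel_left₀ (by exact_mod_cast d.factorial_ne_zero)]
    intro u
    rw [this, LinearMap.flip_apply]
  -- The existence shown in `h1` gives the choice in `riesz` its defining property; positivity of
  -- `Sym^d h` makes it unique.
  have h2 : ∀ u, dualPow d (affDual b ξ) u =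
      symForm d h u (dualVec (symForm d h) (affDual b ξ)) :=
    Classical.epsilon_spec (p := fun w => ∀ u, dualPow d (affDual b ξ) u = symForm d h u w) ⟨_, h1⟩
  exact (hh.symForm b).ext_right fun u => by rw [← h1, ← h2]

theorem symForm_dualVec (hh : IsHermInner h) (ξ : Fin n → ℂ) (s : SymP d V) :
    symForm d h s (dualVec (symForm d h) (affDual b ξ)) = dualPow d (affDual b ξ) s := by
  have : (symForm d h).flip (dualVec (symForm d h) (affDual b ξ)) = dualPow d (affDual b ξ) := by
    refine symP_ext fun v => ?_
    rw [LinearMap.flip_apply, dualVec_symForm b hh, symForm_sprod, dualPow_sprod]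
    simp only [hh.apply_affRiesz b, Finset.sum_const, Finset.card_univ, Fintype.card_perm,
      Fintype.card_fin, nsmul_eq_mul]
    rw [inv_mul_cancel_left₀ (by exact_mod_cast d.factorial_ne_zero)]
  rw [← this, LinearMap.flip_apply]

theorem dualNormSq_symForm (hh : IsHermInner h) (ξ : Fin n → ℂ) :
    dualNormSq (symForm d h) (affDual b ξ) = dualQuad (gramMat b h)⁻¹ (affVec ξ) ^ d := by
  rw [dualNormSq, symForm_dualVec b hh, dualVec_symForm b hh, dualPow_sprod]
  simp [affDual_affRiesz]

theorem dualQuad_affVec_pos (hh : IsHermInner h) (ξ : Fin n → ℂ) :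
    0 < dualQuad (gramMat b h)⁻¹ (affVec ξ) :=
  dualQuad_pos (hh.gramMat_posDef b).inv (affVec_ne_zero ξ)

/-- By cyclicity the trace is that of a rank-one operator, that is `⟨Φ w^d, w^d⟩ / |w^d|²` for the
Riesz vector `w`. -/
theorem fibreFun_symForm (hh : IsHermInner h) (Φ : Module.End ℂ (SymP d V))
    (ξ : Fin n → ℂ) : fibreFun (symForm d h) Φ (affDual b ξ) =
      (dualQuad (gramMat b h)⁻¹ (affVec ξ) ^ d)⁻¹ *
        dualPow d (affDual b ξ) (Φ (sprod fun _ => affRiesz b h ξ)) := by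
  have : Module.Finite ℂ V := Module.Finite.of_basis b
  rw [fibreFun, LinearMap.trace_mul_comm, lamD, mul_smul_comm, map_smul, dualNormSq_symForm b hh,
    smul_eq_mul]
  congr 1
  have : Φ * ((symForm d h).flip (dualVec (symForm d h) (affDual b ξ))).smulRight
      (dualVec (symForm d h) (affDual b ξ)) =
      ((symForm d h).flip (dualVec (symForm d h) (affDual b ξ))).smulRight
        (Φ (dualVec (symForm d h) (affDual b ξ))) := by
    ext s; simp
  rw [this, LinearMap.trace_smulRight, LinearMap.flip_apply, symForm_dualVec b hh,
      dualVec_symForm b hh]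

theorem fibreFun_one (hh : IsHermInner h) (ξ : Fin n → ℂ) :
    fibreFun (symForm d h) 1 (affDual b ξ) = 1 := by
  rw [fibreFun_symForm b hh]
  simp only [Module.End.one_apply, dualPow_sprod, affDual_affRiesz, Finset.prod_const,
    Finset.card_univ, Fintype.card_fin]
  exact inv_mul_cancel₀ (pow_ne_zero _ (dualQuad_affVec_pos b hh ξ).ne')

theorem dualPow_basis (ξ : Fin n → ℂ) (I : Fin d → Fin (n + 1)) :
    dualPow d (affDual b ξ) (sprod fun k => b (I k)) = ∏ k, affVec ξ (I k) := by
  simp [dualPow_sprod, affDual_apply, Finsupp.single_apply]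

theorem prod_rho (Γ : Matrix (Fin (n + 1)) (Fin (n + 1)) ℂ) (ξ : Fin n → ℂ)
    (I J : Fin d → Fin (n + 1)) : rhoProd (rho Γ ξ) (List.ofFn fun k => (I k, J k)) =
      (∏ k, affVec ξ (I k)) * (∏ k, conj (affVec ξ (J k))) * (dualQuad Γ (affVec ξ) ^ d)⁻¹ := by
  rw [rhoProd, List.map_ofFn, List.prod_ofFn]
  simp [rho, Finset.prod_mul_distrib]

theorem hatPairing_basis (hh : IsHermInner h) (ξ : Fin n → ℂ)
    (I J : Fin d → Fin (n + 1)) :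
    hatPairing (symForm d h) (sprod fun k => b (I k)) (sprod fun k => b (J k)) (affDual b ξ) =
      rhoProd (rho (gramMat b h)⁻¹ ξ) (List.ofFn fun k => (I k, J k)) := by
  rw [hatPairing, dualPow_basis, dualPow_basis, dualNormSq_symForm b hh, prod_rho, div_eq_mul_inv,
    map_prod]

/-- `F(Φ)` is a polynomial in the functions `rho`. -/
theorem exists_fibreFun_eq (Φ : Module.End ℂ (SymP d V)) :
    ∃ φ : (Fin d → Fin (n + 1)) → (Fin d → Fin (n + 1)) → ℂ, ∀ h : Sesq V, IsHermInner h →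
      ∀ ξ : Fin n → ℂ, fibreFun (symForm d h) Φ (affDual b ξ) =
        ∑ A, ∑ I, ∑ J : Fin d → Fin (n + 1), (φ A I * ∏ k, (gramMat b h)⁻¹ (A k) (J k)) *
          rhoProd (rho (gramMat b h)⁻¹ ξ) (List.ofFn fun k => (I k, J k)) := by
  -- The coefficients come from expanding `Φ` in the basis alone, so one choice serves all metrics
  -- `h`.
  choose φ hφ using fun A : Fin d → Fin (n + 1) =>
    exists_eq_sum_sprod b (Φ (sprod fun k => b (A k)))
  refine ⟨φ, fun h hh ξ => ?_⟩
  rw [fibreFun_symForm b hh, sprod_eq_sum b]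
  simp only [map_sum, map_smul, hφ, smul_eq_mul, dualPow_basis, Finset.mul_sum]
  refine Finset.sum_congr rfl fun A _ => Finset.sum_congr rfl fun I _ => ?_
  simp only [repr_affRiesz, Matrix.mulVec, dotProduct]
  rw [Finset.prod_univ_sum]
  simp only [Fintype.piFinset_univ, Finset.sum_mul, Finset.mul_sum, prod_rho]
  refine Finset.sum_congr rfl fun J _ => ?_
  rw [Finset.prod_mul_distrib]
  ring

end FibreAlgebra

/-! ### The fibre metric, its volume and its Laplacian in the chart -/

section FibreCalculus

variable {V : Type*} [AddCommGroup V] [Module ℂ V] {n d : ℕ}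

theorem wirt_coord (c : ℂ) (j i : Fin n) (ξ : Fin n → ℂ) :
    wirt c j (fun ζ => ζ i) ξ = if i = j then (1 / 2) * (1 + c * Complex.I) else 0 := by
  have h1 : HasFDerivAt (fun ζ : Fin n → ℂ => ζ i) (ContinuousLinearMap.proj (R := ℝ) i) ξ :=
    hasFDerivAt_apply i ξ
  rw [wirt, h1.fderiv]
  by_cases hij : i = j
  · subst hij; simp
  · simp [hij]

theorem wirt_conj_coord (c : ℂ) (j i : Fin n) (ξ : Fin n → ℂ) :
    wirt c j (fun ζ => conj (ζ i)) ξ = if i = j then (1 / 2) * (1 - c * Complex.I) else 0 := by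
  have h1 : HasFDerivAt (fun ζ : Fin n → ℂ => conj (ζ i))
      ((Complex.conjCLE : ℂ →L[ℝ] ℂ).comp (ContinuousLinearMap.proj (R := ℝ) i)) ξ :=
    (Complex.conjCLE : ℂ →L[ℝ] ℂ).hasFDerivAt.comp ξ (hasFDerivAt_apply i ξ)
  rw [wirt, h1.fderiv]
  by_cases hij : i = j
  · subst hij; simp [sub_eq_add_neg]
  · simp [hij]

theorem wirt_affVec (c : ℂ) (j : Fin n) (a : Fin (n + 1)) (ξ : Fin n → ℂ) :
    wirt c j (fun ζ => affVec ζ a) ξ =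
      if a = j.succ then (1 / 2) * (1 + c * Complex.I) else 0 := by
  refine Fin.cases ?_ (fun i => ?_) a
  · simp [affVec, wirt, (Fin.succ_ne_zero j).symm]
  · simp only [affVec, Fin.cons_succ, wirt_coord, Fin.succ_inj]

theorem wirt_conj_affVec (c : ℂ) (j : Fin n) (a : Fin (n + 1)) (ξ : Fin n → ℂ) :
    wirt c j (fun ζ => conj (affVec ζ a)) ξ =
      if a = j.succ then (1 / 2) * (1 - c * Complex.I) else 0 := by
  refine Fin.cases ?_ (fun i => ?_) a
  · simp [affVec, wirt, (Fin.succ_ne_zero j).symm]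
  · simp only [affVec, Fin.cons_succ, wirt_conj_coord, Fin.succ_inj]

theorem contDiff_affVec (a : Fin (n + 1)) : ContDiff ℝ ∞ fun ζ : Fin n → ℂ => affVec ζ a := by
  refine Fin.cases ?_ (fun i => ?_) a
  · simpa [affVec] using contDiff_const
  · simpa [affVec] using contDiff_apply ℝ ℂ i

theorem contDiff_conj_affVec (a : Fin (n + 1)) :
    ContDiff ℝ ∞ fun ζ : Fin n → ℂ => conj (affVec ζ a) :=
  (Complex.conjCLE : ℂ →L[ℝ] ℂ).contDiff.comp (contDiff_affVec a)

theorem Rep.const_of_forall_eq {E : Type*} [NormedAddCommGroup E] [NormedSpace ℝ E] {p : E}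
    {f : E → ℂ} {r : smoothGerms p} (hf : Rep f r) {c : ℂ} (hc : ∀ y,
        f y = c) : r = SymBalanced.cst p c :=
  hf.unique ((Rep.cst (p := p) c).congr (Eventually.of_forall fun y => (hc y).symm))

/-- Positivity of `Γ` keeps `N` away from zero, so `1/N` is a germ and the formal Fubini–Study
computations apply to functions. -/
theorem exists_projRing {Γ S : Matrix (Fin (n + 1)) (Fin (n + 1)) ℂ} (hΓ : Γ.PosDef)
    (hS : S * Γ = 1) (ξ : Fin n → ℂ) : ∃ (U Ub : Fin (n + 1) → smoothGerms ξ) (w : smoothGerms ξ),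
      ProjRing (hol ξ) (ahol ξ) U Ub (Γ.map (cst ξ)) (S.map (cst ξ)) w ∧
        (∀ a, Rep (fun ζ => affVec ζ a) (U a)) ∧ (∀ a, Rep (fun ζ => conj (affVec ζ a)) (Ub a)) ∧
        Rep (fun ζ => (dualQuad Γ (affVec ζ))⁻¹) w ∧
        Rep (fun ζ => dualQuad Γ (affVec ζ)) (U ⬝ᵥ (Γ.map (cst ξ)).mulVec Ub) := by
  choose U hU using fun a => exists_rep_of_contDiffAt (contDiff_affVec (n := n) a).contDiffAt (p :=
      ξ)
  choose Ub hUb using fun a =>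
    exists_rep_of_contDiffAt (contDiff_conj_affVec (n := n) a).contDiffAt (p := ξ)
  have hN : Rep (fun ζ => dualQuad Γ (affVec ζ)) (U ⬝ᵥ (Γ.map (cst ξ)).mulVec Ub) :=
    Rep.sum fun a _ => (hU a).mul (Rep.sum fun c _ => (Rep.cst (Γ a c)).mul (hUb c))
  have hne : ∀ ζ : Fin n → ℂ, dualQuad Γ (affVec ζ) ≠ 0 := fun ζ =>
    (dualQuad_pos hΓ (affVec_ne_zero ζ)).ne'
  obtain ⟨w, hw⟩ := exists_rep_of_contDiffAt (hN.contDiffAt.inv (hne ξ))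
  have half : (1 / 2 : ℂ) * (1 + -Complex.I * Complex.I) = 1 := by
    rw [neg_mul, Complex.I_mul_I]; norm_num
  refine ⟨U, Ub, w, ⟨?_, ?_, ?_, ?_, ?_, ?_, ?_, ?_, ?_, ?_⟩, hU, hUb, hw, hN⟩
  · rw [(hU 0).const_of_forall_eq (c := 1) fun ζ => by simp [affVec], map_one]
  · rw [(hUb 0).const_of_forall_eq (c := 1) fun ζ => by simp [affVec], map_one]
  · exact fun j a => (((hU a).wd j).const_of_forall_eq fun ζ => by
      rw [wd_eq_wirt, wirt_affVec, half]).trans (by split_ifs <;> simp)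
  · exact fun j a => (((hUb a).wd j).const_of_forall_eq (c := 0) fun ζ => by
      rw [wd_eq_wirt, wirt_conj_affVec]; simp).trans (by simp)
  · exact fun j a => (((hU a).wdbar j).const_of_forall_eq (c := 0) fun ζ => by
      rw [wdbar_eq_wirt, wirt_affVec]; simp).trans (by simp)
  · exact fun j a => (((hUb a).wdbar j).const_of_forall_eq fun ζ => by
      rw [wdbar_eq_wirt, wirt_conj_affVec, sub_eq_add_neg, ← neg_mul, half]).trans
        (by split_ifs <;> simp)
  · exact fun j a c => hol_cst j _
  · exact fun j a c => ahol_cst j _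
  · rw [← Matrix.map_mul, hS, Matrix.map_one _ (map_zero _) (map_one _)]
  · exact (hw.mul hN).unique
      (Rep.one.congr (Eventually.of_forall fun ζ => (inv_mul_cancel₀ (hne ζ)).symm))

/-- The left side contracts with the inverse found in `fsMatrix_mul_inv`. The entries of `homMatrix
U` are holomorphic, so they pass through `∂̄` and no first-order terms appear. -/
theorem ProjRing.lam_eq_fsLap {R : Type*} [CommRing R] {D Db : Fin n → Derivation ℤ R R}
    {U Ub : Fin (n + 1) → R} {Γ S : Matrix (Fin (n + 1)) (Fin (n + 1)) R} {w : R}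
    (h : ProjRing D Db U Ub Γ S w) (f : R) :
    ∑ j, ∑ k, ((U ⬝ᵥ Γ.mulVec Ub) • (homMatrix Ub * S * (homMatrix U).transpose)) k j *
      Db k (D j f) = fsLap D Db U Ub Γ S f := by
  have h0 : ∀ k j a, Db k (homMatrix U j a) = 0 := fun k j a => by
    simp only [homMatrix, Matrix.of_apply, map_sub]
    split_ifs <;> simp [h.Db_u]
  have h1 : ∀ a b, homD Db Ub b (homD D U a f) =
      ∑ j, ∑ k, homMatrix Ub k b * homMatrix U j a * Db k (D j f) := fun a b => by
    rw [homD_apply]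
    simp only [homD_apply, map_sum, Derivation.leibniz, h0, smul_eq_mul, mul_zero, add_zero,
      Finset.mul_sum]
    rw [Finset.sum_comm]
    exact Finset.sum_congr rfl fun _ _ => Finset.sum_congr rfl fun _ _ => by ring
  rw [fsLap]
  simp only [h1, Matrix.smul_apply, Matrix.mul_apply, Matrix.transpose_apply, smul_eq_mul,
    Finset.mul_sum, Finset.sum_mul]
  rw [← sum_swap_pairs (A := fun j k a b => U ⬝ᵥ Γ.mulVec Ub *
    (S b a * (homMatrix Ub k b * homMatrix U j a * Db k (D j f))))]
  refine Finset.sum_congr rfl fun _ _ => Finset.sum_congr rfl fun _ _ =>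
    Finset.sum_congr rfl fun _ _ => Finset.sum_congr rfl fun _ _ => by ring

variable {h : Sesq V} (b : Module.Basis (Fin (n + 1)) ℂ V)

/-- The dual norm is a positive real, so the principal logarithm turns the power `-d` into a factor.
-/
theorem log_inv_dualNormSq (hh : IsHermInner h) (ξ : Fin n → ℂ) :
    Complex.log (dualNormSq (symForm d h) (affDual b ξ))⁻¹ =
      -d * Complex.log (dualQuad (gramMat b h)⁻¹ (affVec ξ)) := by
  have h1 := dualQuad_affVec_pos b hh ξ
  rw [dualNormSq_symForm b hh]
  obtain ⟨x, hx⟩ : ∃ x : ℝ, dualQuad (gramMat b h)⁻¹ (affVec ξ) = x :=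
    ⟨_, (Complex.eq_re_of_ofReal_le h1.le)⟩
  rw [hx] at h1 ⊢
  have hx0 : 0 < x := by exact_mod_cast h1
  rw [← Complex.ofReal_pow, ← Complex.ofReal_inv, ← Complex.ofReal_log (by positivity),
    ← Complex.ofReal_log hx0.le, Real.log_inv, Real.log_pow]
  push_cast
  ring

/-- Since `log g = -d log N`, the matrix is `d ∂∂̄ log N`. Here `∂_j log N = y_j / N`, and
`homDb_w_y` differentiates this once more. -/
theorem metricMatrix_fibreForm (hh : IsHermInner h) (ξ : Fin n → ℂ) :
    metricMatrix (fibreForm b (symForm d h) ξ) =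
      (d : ℂ) • fsMatrix (gramMat b h)⁻¹ (affVec ξ) (fun a => conj (affVec ξ a))
        (dualQuad (gramMat b h)⁻¹ (affVec ξ))⁻¹ := by
  set Γ := (gramMat b h)⁻¹ with hΓdef
  have hS := hh.gramMat_posDef b
  obtain ⟨U, Ub, w, hR, hU, hUb, hw, hN⟩ := exists_projRing hS.inv
    (Matrix.mul_nonsing_inv _ (Matrix.isUnit_iff_isUnit_det _ |>.1 hS.isUnit)) ξ
  rw [← hΓdef] at hR hw hN
  have hpos := fun ζ => dualQuad_affVec_pos b hh ζ
  obtain ⟨L, hL⟩ := exists_rep_of_contDiffAt (contDiffAt_log hN.contDiffAt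
    (Or.inl (Complex.lt_def.1 (hpos ξ)).1))
  have hexp : Rep (fun ζ => Complex.exp (Complex.log (dualQuad Γ (affVec ζ))))
      (U ⬝ᵥ (Γ.map (cst ξ)).mulVec Ub) :=
    hN.congr (Eventually.of_forall fun ζ => (Complex.exp_log (hpos ζ).ne').symm)
  have hy : ∀ a, Rep (fun ζ => Γ.mulVec (fun a => conj (affVec ζ a)) a)
      ((Γ.map (cst ξ)).mulVec Ub a) := fun a => Rep.sum fun c _ => (Rep.cst (Γ a c)).mul (hUb c)
  have hy' : ∀ a, Rep (fun ζ => Matrix.vecMul (affVec ζ) Γ a)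
      (Matrix.vecMul U (Γ.map (cst ξ)) a) := fun a =>
    Rep.sum fun c _ => (hU c).mul (Rep.cst (Γ c a))
  ext j k
  have h1 : hol ξ j L = w * (Γ.map (cst ξ)).mulVec Ub j.succ := by
    have h2 : hol ξ j (U ⬝ᵥ (Γ.map (cst ξ)).mulVec Ub) = _ := wirtD_of_rep_exp hL hexp _ _ _
    have h3 := hR.homD_N j.succ
    rw [if_neg (Fin.succ_ne_zero j), sub_zero] at h3
    rw [← h3]
    change _ = w * hol ξ j _
    rw [h2, ← mul_assoc, hR.w_mul, one_mul]
    rfl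
  have h4 : ahol ξ k (w * (Γ.map (cst ξ)).mulVec Ub j.succ) = _ := hR.homDb_w_y k.succ j.succ
  have h5 : Rep (fun ζ => Complex.log (dualNormSq (symForm d h) (affDual b ζ))⁻¹)
      (cst ξ (-d) * L) :=
    ((Rep.cst _).mul hL).congr (Eventually.of_forall fun ζ => (log_inv_dualNormSq b hh ζ).symm)
  have h6 := ((h5.wd j).wdbar k).eval
  rw [Derivation.leibniz, hol_cst, smul_zero, add_zero, h1, smul_eq_mul, Derivation.leibniz,
      h4] at h6
  simp only [smul_eq_mul, mul_zero, add_zero, ahol_cst, map_mul, map_sub, evalG_cst, hw.eval,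
    (hy _).eval, (hy' _).eval, Matrix.map_apply] at h6
  simp only [metricMatrix, fibreForm, dbard, Matrix.smul_apply, Matrix.of_apply, smul_eq_mul, ← h6,
    fsMatrix]
  ring_nf
  simp only [Complex.I_sq]
  ring

theorem fibreVol_eq (hh : IsHermInner h) (ξ : Fin n → ℂ) : fibreVol b (symForm d h) ξ =
    2 ^ n * (d : ℂ) ^ n * (gramMat b h)⁻¹.det *
      (dualQuad (gramMat b h)⁻¹ (affVec ξ) ^ (n + 1))⁻¹ := by
  rw [fibreVol, metricMatrix_fibreForm b hh, Matrix.det_smul, Fintype.card_fin,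
    det_fsMatrix rfl (by simp [affVec]) rfl
      (inv_mul_cancel₀ (dualQuad_affVec_pos b hh ξ).ne'), inv_pow]
  ring

/-- The `1/d` inverts the factor in `metricMatrix_fibreForm`; the minus sign is that of `∂̄∂ =
-∂∂̄`. -/
theorem lam_fibreForm (hh : IsHermInner h) (hd : d ≠ 0) (ξ : Fin n → ℂ)
    {U Ub : Fin (n + 1) → smoothGerms ξ} {w : smoothGerms ξ}
    (hR : ProjRing (hol ξ) (ahol ξ) U Ub ((gramMat b h)⁻¹.map (cst ξ)) ((gramMat b h).map (cst ξ))
        w)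
    (hU : ∀ a, Rep (fun ζ => affVec ζ a) (U a))
    (hUb : ∀ a, Rep (fun ζ => conj (affVec ζ a)) (Ub a)) {f : (Fin n → ℂ) → ℂ} {r : smoothGerms ξ}
    (hf : Rep f r) :
    Lam (fibreForm b (symForm d h) ξ) (Complex.I • dbard f ξ) = -(d : ℂ)⁻¹ *
      evalG ξ (fsLap (hol ξ) (ahol ξ) U Ub ((gramMat b h)⁻¹.map (cst ξ)) ((gramMat b h).map (cst ξ))
        r) := by
  set Γ := (gramMat b h)⁻¹ with hΓdef
  have hS := hh.gramMat_posDef b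
  have hunit := Matrix.isUnit_iff_isUnit_det _ |>.1 hS.isUnit
  have hpos := dualQuad_affVec_pos b hh ξ
  set ub : Fin (n + 1) → ℂ := fun a => conj (affVec ξ a) with hub
  have hinv : (metricMatrix (fibreForm b (symForm d h) ξ))⁻¹ = (d : ℂ)⁻¹ •
      (dualQuad Γ (affVec ξ) • (homMatrix ub * gramMat b h * (homMatrix (affVec ξ)).transpose)) :=
          by
    refine Matrix.inv_eq_right_inv ?_
    rw [metricMatrix_fibreForm b hh, Matrix.smul_mul, Matrix.mul_smul,
      fsMatrix_mul_inv (N := dualQuad Γ (affVec ξ)) (Matrix.nonsing_inv_mul _ hunit) rfl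
        (by simp [affVec]) rfl (inv_mul_cancel₀ hpos.ne'), smul_smul,
            mul_inv_cancel₀ (by exact_mod_cast hd), one_smul]
  have hmU : ∀ j a, evalG ξ (homMatrix U j a) = homMatrix (affVec ξ) j a := fun j a => by
    simp only [homMatrix, Matrix.of_apply, map_sub]
    congr 1 <;> split_ifs <;> simp [(hU _).eval]
  have hmUb : ∀ j a, evalG ξ (homMatrix Ub j a) = homMatrix ub j a := fun j a => by
    simp only [homMatrix, Matrix.of_apply, map_sub]
    congr 1 <;> split_ifs <;> simp [(hUb _).eval, hub]
  have hN : evalG ξ (U ⬝ᵥ (Γ.map (cst ξ)).mulVec Ub) = dualQuad Γ (affVec ξ) := by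
    simp [dotProduct, Matrix.mulVec, dualQuad, (hU _).eval, (hUb _).eval]
  rw [← hR.lam_eq_fsLap]
  simp only [Lam, invMetric, hinv, dbard, map_sum, map_mul, Matrix.smul_apply, smul_eq_mul, hN,
    Matrix.mul_apply, Matrix.transpose_apply, Matrix.map_apply, evalG_cst, hmU, hmUb,
        Matrix.of_apply,
    ((hf.wd _).wdbar _).eval]
  rw [Finset.mul_sum]
  refine Finset.sum_congr rfl fun j _ => ?_
  rw [Finset.mul_sum]
  refine Finset.sum_congr rfl fun k _ => ?_
  ring_nf
  simp only [Complex.I_sq]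
  ring

/-- The integrand `F + Δ̃F` as a polynomial in the functions `rho`. -/
theorem exists_fibreFunLap_eq (hd : d ≠ 0) (Φ : Module.End ℂ (SymP d V)) :
    ∃ φ : (Fin d → Fin (n + 1)) → (Fin d → Fin (n + 1)) → ℂ, ∀ h : Sesq V, IsHermInner h →
      ∀ ξ : Fin n → ℂ, fibreFunLap b (symForm d h) Φ ξ =
        ∑ A, ∑ I, ∑ J : Fin d → Fin (n + 1), (φ A I * ∏ k, (gramMat b h)⁻¹ (A k) (J k)) *
          (rhoProd (rho (gramMat b h)⁻¹ ξ) (List.ofFn fun k => (I k, J k)) - (d : ℂ)⁻¹ *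
            lapProd (gramMat b h) (rho (gramMat b h)⁻¹ ξ) (List.ofFn fun k => (I k, J k))) := by
  obtain ⟨φ, hφ⟩ := exists_fibreFun_eq b Φ
  refine ⟨φ, fun h hh ξ => ?_⟩
  have hS := hh.gramMat_posDef b
  obtain ⟨U, Ub, w, hR, hU, hUb, hw, hN⟩ := exists_projRing hS.inv
    (Matrix.mul_nonsing_inv _ (Matrix.isUnit_iff_isUnit_det _ |>.1 hS.isUnit)) ξ
  have hρ : ∀ c e, Rep (fun ζ => rho (gramMat b h)⁻¹ ζ c e) (U c * Ub e * w) := fun c e =>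
    ((hU c).mul (hUb e)).mul hw
  have hprod : ∀ l, Rep (fun ζ => rhoProd (rho (gramMat b h)⁻¹ ζ) l)
      (rhoProd (fun c e => U c * Ub e * w) l) := fun l => by
    induction l with
    | nil => exact Rep.one
    | cons p l ih =>
      simp only [rhoProd_cons]
      exact (hρ _ _).mul ih
  have hF : Rep (fun ζ => fibreFun (symForm d h) Φ (affDual b ζ))
      (∑ A, ∑ I, ∑ J : Fin d → Fin (n + 1), cst ξ (φ A I * ∏ k, (gramMat b h)⁻¹ (A k) (J k)) *
        rhoProd (fun c e => U c * Ub e * w) (List.ofFn fun k => (I k, J k))) := by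
    simp only [hφ h hh]
    exact Rep.sum fun A _ => Rep.sum fun I _ => Rep.sum fun J _ => (Rep.cst _).mul (hprod _)
  have hhom0 : ∀ a c, homD (hol ξ) U a (cst ξ c) = 0 := fun a c => by simp [homD_apply, hol_cst]
  have hhomb0 : ∀ a c, homD (ahol ξ) Ub a (cst ξ c) = 0 := fun a c => by simp [homD_apply, ahol_cst]
  have hlin : ∀ c r, fsLap (hol ξ) (ahol ξ) U Ub ((gramMat b h)⁻¹.map (cst ξ))
      ((gramMat b h).map (cst ξ)) (cst ξ c * r) = cst ξ c * fsLap (hol ξ) (ahol ξ) U Ub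
        ((gramMat b h)⁻¹.map (cst ξ)) ((gramMat b h).map (cst ξ)) r := fun c r => by
    rw [ProjRing.fsLap_mul]
    simp [fsGrad, fsLap, hhom0, hhomb0]
  rw [fibreFunLap, lam_fibreForm b hh hd ξ hR hU hUb hF, ← hF.eval]
  simp only [ProjRing.fsLap_sum, hlin, hR.fsLap_rhoProd, map_sum, map_mul (evalG ξ), evalG_cst,
      map_lapProd, map_rhoProd,
    Finset.mul_sum, ← Finset.sum_add_distrib]
  refine Finset.sum_congr rfl fun A _ => Finset.sum_congr rfl fun I _ =>
    Finset.sum_congr rfl fun J _ => ?_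
  have e1 : (fun c e => evalG ξ (U c) * evalG ξ (Ub e) * evalG ξ w) =
      rho (gramMat b h)⁻¹ ξ := by
    funext c e
    rw [(hU c).eval, (hUb e).eval, hw.eval, rho]
  have e2 : ((gramMat b h).map (cst ξ)).map (evalG ξ) = gramMat b h := by
    ext a c; simp
  rw [e1, e2]
  ring

end FibreCalculus

/-! ### Continuity of fibre integrals in the metric -/

section FibreFamilies

variable {V : Type*} [AddCommGroup V] [Module ℂ V] {n d : ℕ}

/-- Families `f t` of continuous functions on `ℂ^n`,
    uniformly bounded for `t` near `0` and pointwise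
continuous in `t` at `0`. -/
def boundedFamilies (n : ℕ) : Subalgebra ℂ (ℝ → (Fin n → ℂ) → ℂ) where
  carrier := {f | (∀ᶠ t in 𝓝 (0 : ℝ), Continuous (f t)) ∧
    (∃ C, ∀ᶠ t in 𝓝 (0 : ℝ), ∀ ξ, ‖f t ξ‖ ≤ C) ∧ ∀ ξ, ContinuousAt (fun t => f t ξ) 0}
  mul_mem' := by
    rintro f g ⟨hf, ⟨C, hC⟩, hf'⟩ ⟨hg, ⟨C', hC'⟩, hg'⟩
    refine ⟨?_, ⟨C * C', ?_⟩, fun ξ => (hf' ξ).mul (hg' ξ)⟩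
    · filter_upwards [hf, hg] with t h1 h2 using h1.mul h2
    · filter_upwards [hC, hC'] with t h1 h2 ξ
      simp only [Pi.mul_apply, norm_mul]
      exact mul_le_mul (h1 ξ) (h2 ξ) (norm_nonneg _) ((norm_nonneg _).trans (h1 ξ))
  add_mem' := by
    rintro f g ⟨hf, ⟨C, hC⟩, hf'⟩ ⟨hg, ⟨C', hC'⟩, hg'⟩
    refine ⟨?_, ⟨C + C', ?_⟩, fun ξ => (hf' ξ).add (hg' ξ)⟩
    · filter_upwards [hf, hg] with t h1 h2 using h1.add h2
    · filter_upwards [hC, hC'] with t h1 h2 ξ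
      exact (norm_add_le _ _).trans (add_le_add (h1 ξ) (h2 ξ))
  algebraMap_mem' c := ⟨Eventually.of_forall fun _ => continuous_const,
    ⟨‖c‖, Eventually.of_forall fun _ _ => le_rfl⟩, fun _ => continuousAt_const⟩

theorem boundedFamilies_of_continuousAt {g : ℝ → ℂ} (hg : ContinuousAt g 0) :
    (fun t _ => g t) ∈ boundedFamilies n := by
  refine ⟨Eventually.of_forall fun _ => continuous_const, ⟨‖g 0‖ + 1, ?_⟩, fun _ => hg⟩
  filter_upwards [hg.norm.eventually_le_const (lt_add_one _)] with t ht ξ using ht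

/-- The weight `(1 + |ξ|²)^{-(n+1)}`. -/
def fsWeight (ξ : Fin n → ℂ) : ℝ := ((1 + ∑ j, ‖ξ j‖ ^ 2) ^ (n + 1))⁻¹

theorem continuous_fsWeight : Continuous (fsWeight (n := n)) := by
  unfold fsWeight
  refine Continuous.inv₀ (by fun_prop) fun ξ => ?_
  positivity

/-- The real dimension `2n` is less than the decay exponent `2(n + 1)`. The sup norm is at most the
Euclidean one, so the standard integrable function in the sup norm dominates. -/
theorem integrable_fsWeight : Integrable (fsWeight (n := n)) := by
  have h1 : Integrable (fun ξ : Fin n → ℂ => (1 + ‖ξ‖ ^ 2) ^ (-(2 * (n + 1) : ℝ) / 2)) :=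
    integrable_rpow_neg_one_add_norm_sq (by
      rw [Module.finrank_pi_fintype]
      simp [Complex.finrank_real_complex]
      linarith)
  refine h1.mono' continuous_fsWeight.aestronglyMeasurable (Eventually.of_forall fun ξ => ?_)
  have h2 : ‖ξ‖ ^ 2 ≤ ∑ j, ‖ξ j‖ ^ 2 := by
    have h3 : ‖ξ‖ ≤ √(∑ j, ‖ξ j‖ ^ 2) := (pi_norm_le_iff_of_nonneg (Real.sqrt_nonneg _)).2 fun j =>
      Real.le_sqrt_of_sq_le (Finset.single_le_sum (f := fun j => ‖ξ j‖ ^ 2)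
        (fun _ _ => by positivity) (Finset.mem_univ j))
    calc ‖ξ‖ ^ 2 ≤ √(∑ j, ‖ξ j‖ ^ 2) ^ 2 := by gcongr
      _ = _ := Real.sq_sqrt (by positivity)
  have h4 : (-(2 * (n + 1) : ℝ) / 2) = -((n + 1 : ℕ) : ℝ) := by push_cast; ring
  rw [h4, Real.rpow_neg (by positivity), Real.rpow_natCast, fsWeight,
      Real.norm_of_nonneg (by positivity)]
  gcongr

theorem eventually_integrable_boundedFamilies {f : ℝ → (Fin n → ℂ) → ℂ}
    (hf : f ∈ boundedFamilies n) : ∀ᶠ t in 𝓝 (0 : ℝ), Integrable fun ξ => f t ξ * fsWeight ξ := by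
  obtain ⟨h1, ⟨C, hC⟩, -⟩ := hf
  filter_upwards [h1, hC] with t h1 h2
  exact integrable_fsWeight.ofReal.bdd_mul h1.aestronglyMeasurable (Eventually.of_forall h2)

theorem continuousAt_integral_boundedFamilies {f : ℝ → (Fin n → ℂ) → ℂ}
    (hf : f ∈ boundedFamilies n) : ContinuousAt (fun t => ∫ ξ, f t ξ * fsWeight ξ) 0 := by
  obtain ⟨h1, ⟨C, hC⟩, h3⟩ := hf
  refine continuousAt_of_dominated (bound := fun ξ => C * fsWeight ξ) ?_ ?_
    (integrable_fsWeight.const_mul C) (Eventually.of_forall fun ξ => (h3 ξ).mul continuousAt_const)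
  · filter_upwards [h1] with t ht
    exact (ht.mul (Complex.continuous_ofReal.comp continuous_fsWeight)).aestronglyMeasurable
  · filter_upwards [hC] with t ht
    refine Eventually.of_forall fun ξ => ?_
    have h0 : 0 ≤ fsWeight ξ := by unfold fsWeight; positivity
    rw [norm_mul, Complex.norm_real, Real.norm_of_nonneg h0]
    exact mul_le_mul_of_nonneg_right (ht ξ) h0

theorem continuousAt_matrix_inv {κ : Type*} [Fintype κ] [DecidableEq κ] {M : ℝ → Matrix κ κ ℂ}
    {t₀ : ℝ} (hM : ∀ a c, ContinuousAt (fun t => M t a c) t₀) (hdet : (M t₀).det ≠ 0) (a c : κ) :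
    ContinuousAt (fun t => (M t)⁻¹ a c) t₀ := by
  have h1 : ContinuousAt M t₀ := continuousAt_pi.2 fun a => continuousAt_pi.2 (hM a)
  have h2 : ContinuousAt (fun t => (M t).det) t₀ :=
    (Continuous.matrix_det continuous_id).continuousAt.comp h1
  have h3 : ContinuousAt (fun t => (M t).adjugate a c) t₀ :=
    ((continuous_id.matrix_adjugate.matrix_elem a c).continuousAt (x := M t₀)).comp h1
  simp only [Matrix.inv_def, Matrix.smul_apply, Ring.inverse_eq_inv', smul_eq_mul]
  exact (h2.inv₀ hdet).mul h3

variable {H : ℝ → Sesq V} (b : Module.Basis (Fin (n + 1)) ℂ V)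

theorem boundedFamilies_gramMat (hc : ∀ u v,
    ContinuousAt (fun t => H t u v) 0) (a c : Fin (n + 1)) :
    (fun t _ => gramMat b (H t) a c) ∈ boundedFamilies n :=
  boundedFamilies_of_continuousAt (hc _ _)

theorem continuousAt_gramMat_inv {κ : Type*} [Fintype κ] [DecidableEq κ] (b : Module.Basis κ ℂ V)
    (hH : IsHermInner (H 0)) (hc : ∀ u v, ContinuousAt (fun t => H t u v) 0) (a c : κ) :
    ContinuousAt (fun t => (gramMat b (H t))⁻¹ a c) 0 :=
  continuousAt_matrix_inv (fun _ _ => hc _ _) (hH.gramMat_posDef b).det_pos.ne' a c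

/-- With `w` the Riesz vector, `u_c = ⟨e_c, w⟩` and `N = |w|²`, so Cauchy–Schwarz gives `|u_c|² ≤
⟨e_c, e_c⟩ N`. The bound is uniform in `ξ`, as domination requires. -/
theorem norm_rho_le {h : Sesq V} (hh : IsHermInner h) (ξ : Fin n → ℂ) (c e : Fin (n + 1)) :
    ‖rho (gramMat b h)⁻¹ ξ c e‖ ≤ ‖gramMat b h c c‖ + ‖gramMat b h e e‖ := by
  have hN := dualQuad_affVec_pos b hh ξ
  have hNa : h (affRiesz b h ξ) (affRiesz b h ξ) = dualQuad (gramMat b h)⁻¹ (affVec ξ) := by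
    rw [hh.apply_affRiesz b, affDual_affRiesz]
  have hu : ∀ c, affVec ξ c = h (b c) (affRiesz b h ξ) := fun c => by
    rw [hh.apply_affRiesz b, affDual_apply]
    simp [Finsupp.single_apply]
  set N := (dualQuad (gramMat b h)⁻¹ (affVec ξ)).re with hNdef
  have hN0 : 0 < N := (Complex.lt_def.1 hN).1
  have hNe : dualQuad (gramMat b h)⁻¹ (affVec ξ) = N := Complex.eq_re_of_ofReal_le hN.le
  have key : ∀ c, ‖affVec ξ c‖ ^ 2 ≤ ‖gramMat b h c c‖ * N := fun c => by
    have h1 := hh.normSq_le (b c) (affRiesz b h ξ)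
    rw [← hu, hNa, Complex.normSq_eq_norm_sq] at h1
    exact h1.trans (mul_le_mul_of_nonneg_right (Complex.re_le_norm _) hN0.le)
  rw [rho, hNe, norm_mul, norm_mul, norm_inv, Complex.norm_real, Real.norm_of_nonneg hN0.le,
    RCLike.norm_conj, mul_inv_le_iff₀ hN0]
  nlinarith [key c, key e, sq_nonneg (‖affVec ξ c‖ - ‖affVec ξ e‖), sq_nonneg (‖affVec ξ c‖),
    sq_nonneg (‖affVec ξ e‖)]

theorem boundedFamilies_rho (hH : ∀ᶠ t in 𝓝 (0 : ℝ), IsHermInner (H t))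
    (hc : ∀ u v, ContinuousAt (fun t => H t u v) 0) (c e : Fin (n + 1)) :
    (fun t ξ => rho (gramMat b (H t))⁻¹ ξ c e) ∈ boundedFamilies n := by
  refine ⟨?_, ?_, fun ξ => ?_⟩
  · filter_upwards [hH] with t ht
    unfold rho
    refine ((contDiff_affVec c).continuous.mul (contDiff_conj_affVec e).continuous).mul
      (Continuous.inv₀ ?_ fun ξ => (dualQuad_affVec_pos b ht ξ).ne')
    unfold dualQuad dotProduct Matrix.mulVec dotProduct
    exact continuous_finsetSum _ fun a _ => (contDiff_affVec a).continuous.mul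
      (continuous_finsetSum _ fun a' _ => continuous_const.mul (contDiff_conj_affVec a').continuous)
  · obtain ⟨-, ⟨C, hC⟩, -⟩ := boundedFamilies_gramMat b hc c c
    obtain ⟨-, ⟨C', hC'⟩, -⟩ := boundedFamilies_gramMat b hc e e
    refine ⟨C + C', ?_⟩
    filter_upwards [hH, hC, hC'] with t ht h1 h2 ξ
    exact (norm_rho_le b ht ξ c e).trans (add_le_add (h1 ξ) (h2 ξ))
  · unfold rho
    refine continuousAt_const.mul (ContinuousAt.inv₀ ?_
      (dualQuad_affVec_pos b hH.self_of_nhds ξ).ne')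
    unfold dualQuad dotProduct Matrix.mulVec dotProduct
    exact tendsto_finsetSum _ fun a _ => (tendsto_const_nhds).mul (tendsto_finsetSum _ fun a' _ =>
      (continuousAt_gramMat_inv b hH.self_of_nhds hc a a').tendsto.mul tendsto_const_nhds)

end FibreFamilies

/-! ### The operator `T`: existence, affine dependence on `Φ`, continuity in the metric -/

section FibreIntegrals

variable {V : Type*} [AddCommGroup V] [Module ℂ V] {n d : ℕ}
  {H : ℝ → Sesq V} (b : Module.Basis (Fin (n + 1)) ℂ V)

/-- The integrand in the definition of `T`. -/
def fibreIntegrand (d : ℕ) (h : Sesq V) (Φ : Module.End ℂ (SymP d V)) (s t : SymP d V)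
    (ξ : Fin n → ℂ) : ℂ :=
  fibreFunLap b (symForm d h) Φ ξ * hatPairing (symForm d h) s t (affDual b ξ) *
    fibreVol b (symForm d h) ξ

theorem sum_rho_diag (Γ : Matrix (Fin (n + 1)) (Fin (n + 1)) ℂ) (ξ : Fin n → ℂ) :
    ∑ c, rho Γ ξ c c = ((1 + ∑ j, ‖ξ j‖ ^ 2 : ℝ) : ℂ) * (dualQuad Γ (affVec ξ))⁻¹ := by
  simp only [rho, ← Finset.sum_mul]
  congr 1
  rw [Fin.sum_univ_succ]
  simp [affVec, Complex.mul_conj, Complex.normSq_eq_norm_sq]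

/-- The decay `N^{-(n+1)}` depends on the metric. As `∑ ρ_cc = (1 + |ξ|²) / N`, the density is a
bounded function times a weight that is the same for all metrics. -/
theorem fibreVol_eq_weight {h : Sesq V} (hh : IsHermInner h) (ξ : Fin n → ℂ) :
    fibreVol b (symForm d h) ξ = 2 ^ n * (d : ℂ) ^ n * (gramMat b h)⁻¹.det *
      (∑ c, rho (gramMat b h)⁻¹ ξ c c) ^ (n + 1) * fsWeight ξ := by
  have h0 : (1 + ∑ j, ‖ξ j‖ ^ 2 : ℝ) ≠ 0 := by positivity
  rw [fibreVol_eq b hh, sum_rho_diag, mul_pow, fsWeight, Complex.ofReal_inv, Complex.ofReal_pow,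
    inv_pow]
  field_simp [Complex.ofReal_ne_zero.2 h0]

theorem hatPairing_sum {ι : Type*} [Fintype ι] (K : Sesq (SymP d V)) (c c' : ι → ℂ)
    (e : ι → SymP d V) (v : Module.Dual ℂ V) :
    hatPairing K (∑ i, c i • e i) (∑ i, c' i • e i) v =
      ∑ i, ∑ j, (c i * conj (c' j)) * hatPairing K (e i) (e j) v := by
  simp only [hatPairing, map_sum, map_smul, smul_eq_mul, map_mul, div_eq_mul_inv]
  rw [Finset.sum_mul_sum, Finset.sum_mul]
  refine Finset.sum_congr rfl fun i _ => ?_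
  rw [Finset.sum_mul]
  exact Finset.sum_congr rfl fun j _ => by ring

/-- The integrand apart from its weight is a polynomial in the entries of the Gram matrix and its
inverse and in the functions `rho`, all of them bounded families. It is assembled inside that
subalgebra and needs no estimates of its own. -/
theorem exists_fibreIntegrand_eq (hd : d ≠ 0) (hH : ∀ᶠ t in 𝓝 (0 : ℝ), IsHermInner (H t))
    (hc : ∀ u v, ContinuousAt (fun t => H t u v) 0) (Φ : Module.End ℂ (SymP d V))
    (s t : SymP d V) : ∃ f ∈ boundedFamilies n, ∀ τ, IsHermInner (H τ) → ∀ ξ,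
      fibreIntegrand b d (H τ) Φ s t ξ = f τ ξ * fsWeight ξ := by
  obtain ⟨φ, hφ⟩ := exists_fibreFunLap_eq b hd Φ
  obtain ⟨cs, rfl⟩ := exists_eq_sum_sprod b s
  obtain ⟨ct, rfl⟩ := exists_eq_sum_sprod b t
  let S : Matrix (Fin (n + 1)) (Fin (n + 1)) (boundedFamilies n) := Matrix.of fun a c =>
    ⟨_, boundedFamilies_gramMat b hc a c⟩
  let Γ : Matrix (Fin (n + 1)) (Fin (n + 1)) (boundedFamilies n) := Matrix.of fun a c =>
    ⟨_, boundedFamilies_of_continuousAt (continuousAt_gramMat_inv b hH.self_of_nhds hc a c)⟩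
  let r : Fin (n + 1) → Fin (n + 1) → boundedFamilies n := fun c e =>
    ⟨_, boundedFamilies_rho b hH hc c e⟩
  -- Evaluation at `(τ, ξ)` is a ring homomorphism, so it passes through all these polynomials.
  let ev : ℝ → (Fin n → ℂ) → boundedFamilies n →+* ℂ := fun τ ξ =>
    ((Pi.evalRingHom (fun _ => ℂ) ξ).comp (Pi.evalRingHom (fun _ => (Fin n → ℂ) → ℂ) τ)).comp
      (boundedFamilies n).val.toRingHom
  have evS : ∀ τ ξ, S.map (ev τ ξ) = gramMat b (H τ) := fun τ ξ => rfl
  have evΓ' : ∀ τ ξ, (ev τ ξ).mapMatrix Γ = (gramMat b (H τ))⁻¹ := fun τ ξ => rfl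
  have evΓ : ∀ τ ξ a c, ev τ ξ (Γ a c) = (gramMat b (H τ))⁻¹ a c := fun τ ξ a c => rfl
  have evr' : ∀ τ ξ c e, ev τ ξ (r c e) = rho (gramMat b (H τ))⁻¹ ξ c e := fun τ ξ c e => rfl
  have evc : ∀ τ ξ c, ev τ ξ (algebraMap ℂ _ c) = c := fun τ ξ c => rfl
  let F : boundedFamilies n :=
    (∑ A, ∑ I, ∑ J : Fin d → Fin (n + 1), (algebraMap ℂ _ (φ A I) * ∏ k, Γ (A k) (J k)) *
      (rhoProd r (List.ofFn fun k => (I k, J k)) - algebraMap ℂ _ (d : ℂ)⁻¹ *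
        lapProd S r (List.ofFn fun k => (I k, J k)))) *
    (∑ I, ∑ J, algebraMap ℂ _ (cs I * conj (ct J)) * rhoProd r (List.ofFn fun k => (I k, J k))) *
    (algebraMap ℂ _ (2 ^ n * (d : ℂ) ^ n) * Γ.det * (∑ c, r c c) ^ (n + 1))
  refine ⟨F.1, F.2, fun τ hτ ξ => ?_⟩
  have hF : F.1 τ ξ = ev τ ξ F := rfl
  rw [hF, fibreIntegrand, hφ _ hτ, hatPairing_sum, fibreVol_eq_weight b hτ]
  simp only [F, map_mul, map_sum, map_prod, map_sub, map_pow, RingHom.map_det, map_rhoProd,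
    map_lapProd, evS, evΓ', evΓ, evr', evc, hatPairing_basis b hτ]
  ring

theorem continuousAt_integral_fibreIntegrand (hd : d ≠ 0)
    (hH : ∀ᶠ t in 𝓝 (0 : ℝ), IsHermInner (H t)) (hc : ∀ u v, ContinuousAt (fun t => H t u v) 0)
    (Φ : Module.End ℂ (SymP d V)) (s t : SymP d V) :
    ContinuousAt (fun τ => ∫ ξ, fibreIntegrand b d (H τ) Φ s t ξ) 0 := by
  obtain ⟨f, hf, h1⟩ := exists_fibreIntegrand_eq b hd hH hc Φ s t
  refine (continuousAt_integral_boundedFamilies hf).congr ?_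
  filter_upwards [hH] with τ hτ
  simp only [h1 τ hτ]

variable {h : Sesq V}

theorem integrable_fibreIntegrand (hd : d ≠ 0) (hh : IsHermInner h) (Φ : Module.End ℂ (SymP d V))
    (s t : SymP d V) : Integrable (fibreIntegrand b d h Φ s t) := by
  obtain ⟨f, hf, h1⟩ := exists_fibreIntegrand_eq (H := fun _ => h) b hd
    (Eventually.of_forall fun _ => hh) (fun _ _ => continuousAt_const) Φ s t
  refine (eventually_integrable_boundedFamilies hf).self_of_nhds.congr
    (Eventually.of_forall fun ξ => (h1 0 hh ξ).symm)

/-- The fibre integral as a sesquilinear form. -/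
def fibreSesq (hd : d ≠ 0) (hh : IsHermInner h) (Φ : Module.End ℂ (SymP d V)) : Sesq (SymP d V) :=
  LinearMap.mk₂'ₛₗ (RingHom.id ℂ) (starRingEnd ℂ) (fun s t => ∫ ξ, fibreIntegrand b d h Φ s t ξ)
    (fun s s' t => by
      rw [← integral_add (integrable_fibreIntegrand b hd hh Φ s t)
        (integrable_fibreIntegrand b hd hh Φ s' t)]
      congr 1; funext ξ
      simp only [fibreIntegrand, hatPairing, map_add]; ring)
    (fun c s t => by
      rw [smul_eq_mul, RingHom.id_apply, ← integral_const_mul]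
      congr 1; funext ξ
      simp only [fibreIntegrand, hatPairing, map_smul, smul_eq_mul]; ring)
    (fun s t t' => by
      rw [← integral_add (integrable_fibreIntegrand b hd hh Φ s t)
        (integrable_fibreIntegrand b hd hh Φ s t')]
      congr 1; funext ξ
      simp only [fibreIntegrand, hatPairing, map_add]; ring)
    (fun c s t => by
      rw [smul_eq_mul, ← integral_const_mul]
      congr 1; funext ξ
      simp only [fibreIntegrand, hatPairing, map_smul, smul_eq_mul, map_mul]; ring)

/-- A sesquilinear form is represented by an endomorphism. -/
theorem exists_end_of_sesq (b : Module.Basis (Fin (n + 1)) ℂ V) (hh : IsHermInner h) (B : Sesq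
    (SymP d V)) :
    ∃ A : Module.End ℂ (SymP d V), ∀ s t, symForm d h s (A t) = B s t := by
  obtain ⟨e, he⟩ := hh.exists_orthonormal b
  let E : (Fin d → Fin (n + 1)) → SymP d V := fun J => sprod fun k => e (J k)
  refine ⟨∑ J, ((starLinearEquiv ℂ (A := ℂ)).toLinearMap.comp (B (E J))).smulRight (E J),
    fun s t => ?_⟩
  conv_rhs => rw [← sum_symForm_smul e he s]
  simp only [LinearMap.sum_apply, map_sum, LinearMap.smulRight_apply, LinearMap.map_smulₛₗ,
    LinearMap.smul_apply, smul_eq_mul, RingHom.id_apply, E]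
  refine Finset.sum_congr rfl fun J _ => ?_
  rw [mul_comm]
  congr 1
  exact Complex.conj_conj _

/-- The choice in `opT` has a candidate: the fibre integral is a sesquilinear form, hence
represented by an endomorphism. -/
theorem symForm_opT (hd : d ≠ 0) (hh : IsHermInner h) (Φ : Module.End ℂ (SymP d V))
    (s t : SymP d V) : symForm d h s (opT d b h Φ t) =
      (fibreConst n d)⁻¹ * ∫ ξ, fibreIntegrand b d h Φ s t ξ :=
  Classical.epsilon_spec (p := fun S : Module.End ℂ (SymP d V) => ∀ s t : SymP d V,
    symForm d h s (S t) = (fibreConst n d)⁻¹ * ∫ ξ, fibreIntegrand b d h Φ s t ξ)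
    (exists_end_of_sesq b hh ((fibreConst n d)⁻¹ • fibreSesq b hd hh Φ)) s t

theorem contDiffAt_fibreFun (hh : IsHermInner h) (Φ : Module.End ℂ (SymP d V)) (ξ : Fin n → ℂ) :
    ContDiffAt ℝ ∞ (fun ζ => fibreFun (symForm d h) Φ (affDual b ζ)) ξ := by
  obtain ⟨φ, hφ⟩ := exists_fibreFun_eq b Φ
  have hN : ContDiffAt ℝ ∞ (fun ζ => (dualQuad (gramMat b h)⁻¹ (affVec ζ))⁻¹) ξ := by
    refine ContDiffAt.inv ?_ (dualQuad_affVec_pos b hh ξ).ne'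
    unfold dualQuad dotProduct Matrix.mulVec dotProduct
    exact ContDiffAt.sum fun a _ => (contDiff_affVec a).contDiffAt.mul (ContDiffAt.sum fun a' _ =>
      contDiffAt_const.mul (contDiff_conj_affVec a').contDiffAt)
  have hprod : ∀ l, ContDiffAt ℝ ∞ (fun ζ => rhoProd (rho (gramMat b h)⁻¹ ζ) l) ξ := fun l => by
    induction l with
    | nil => exact contDiffAt_const
    | cons p l ih =>
      simp only [rhoProd_cons]
      exact (((contDiff_affVec _).contDiffAt.mul (contDiff_conj_affVec _).contDiffAt).mul hN).mul ih
  simp only [hφ h hh]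
  exact ContDiffAt.sum fun A _ => ContDiffAt.sum fun I _ => ContDiffAt.sum fun J _ =>
    contDiffAt_const.mul (hprod _)

/-- `F(I) = 1`, and the Laplacian kills constants. -/
theorem fibreFunLap_one_add_smul (hh : IsHermInner h) (Φ : Module.End ℂ (SymP d V)) (c : ℂ)
    (ξ : Fin n → ℂ) : fibreFunLap b (symForm d h) (1 + c • Φ) ξ =
      1 + c * fibreFunLap b (symForm d h) Φ ξ := by
  have h1 : ∀ ζ, fibreFun (symForm d h) (1 + c • Φ) (affDual b ζ) =
      1 + c * fibreFun (symForm d h) Φ (affDual b ζ) := fun ζ => by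
    rw [← fibreFun_one b hh (d := d) ζ]
    simp only [fibreFun, mul_add, map_add, mul_smul_comm, map_smul, smul_eq_mul]
  obtain ⟨r, hr⟩ := exists_rep_of_contDiffAt (contDiffAt_fibreFun b hh Φ ξ)
  have h2 : dbard (fun ζ => 1 + c * fibreFun (symForm d h) Φ (affDual b ζ)) ξ =
      c • dbard (fun ζ => fibreFun (symForm d h) Φ (affDual b ζ)) ξ := by
    ext j k
    have h3 := (((Rep.one.add ((Rep.cst c).mul hr)).wd j).wdbar k).eval
    simp only [map_add, Derivation.leibniz, hol_cst, ahol_cst, smul_eq_mul, mul_zero, add_zero,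
      Derivation.map_one_eq_zero, zero_add, map_mul, evalG_cst,
      ((hr.wd j).wdbar k).eval] at h3
    simp only [dbard, Matrix.of_apply, Matrix.smul_apply, smul_eq_mul, ← h3]
    ring
  simp only [fibreFunLap, h1, h2, smul_comm Complex.I c]
  have h4 : ∀ α : Matrix (Fin n) (Fin n) ℂ,
      Lam (fibreForm b (symForm d h) ξ) (c • α) = c * Lam (fibreForm b (symForm d h) ξ) α := by
    intro α
    simp only [Lam, Finset.mul_sum, Matrix.smul_apply, smul_eq_mul]
    exact Finset.sum_congr rfl fun _ _ => Finset.sum_congr rfl fun _ _ => by ring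
  rw [h4]
  ring

theorem fibreIntegrand_one_add_smul (hh : IsHermInner h) (Φ : Module.End ℂ (SymP d V)) (c : ℂ)
    (s t : SymP d V) (ξ : Fin n → ℂ) : fibreIntegrand b d h (1 + c • Φ) s t ξ =
      hatPairing (symForm d h) s t (affDual b ξ) * fibreVol b (symForm d h) ξ +
        c * fibreIntegrand b d h Φ s t ξ := by
  rw [fibreIntegrand, fibreFunLap_one_add_smul b hh, fibreIntegrand]
  ring

theorem integrable_hatPairing (hd : d ≠ 0) (hh : IsHermInner h) (s t : SymP d V) :
    Integrable fun ξ : Fin n → ℂ =>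
      hatPairing (symForm d h) s t (affDual b ξ) * fibreVol b (symForm d h) ξ := by
  -- Without the factor `F + Δ̃F` the integrand is that of `Φ = I`, written `1 + 0 • 1` to fit the
  -- affine formula.
  refine (integrable_fibreIntegrand b hd hh (1 + (0 : ℂ) • 1) s t).congr
    (Eventually.of_forall fun ξ => ?_)
  simp only [fibreIntegrand_one_add_smul b hh, zero_mul, add_zero]

/-- The hypothesis `hone` is the normalization `T(I) = I`. The scalar is real because `F(Φ)` is
linear in `Φ` while `TΦ` stands in the conjugate-linear slot. -/
theorem opT_one_add_smul (hd : d ≠ 0) (hh : IsHermInner h)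
    (hone : ∀ s t : SymP d V, (fibreConst n d)⁻¹ * ∫ ξ : Fin n → ℂ,
      hatPairing (symForm d h) s t (affDual b ξ) * fibreVol b (symForm d h) ξ = symForm d h s t)
    (Φ : Module.End ℂ (SymP d V)) (c : ℝ) :
    opT d b h (1 + (c : ℂ) • Φ) = 1 + (c : ℂ) • opT d b h Φ := by
  ext1 t
  refine (hh.symForm b).ext_right fun s => ?_
  rw [symForm_opT b hd hh]
  simp only [fibreIntegrand_one_add_smul b hh]
  rw [integral_add (integrable_hatPairing b hd hh s t)
    ((integrable_fibreIntegrand b hd hh Φ s t).const_mul _), integral_const_mul, mul_add, hone]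
  simp only [LinearMap.add_apply, Module.End.one_apply, map_add, LinearMap.smul_apply,
    LinearMap.map_smulₛₗ, Complex.conj_ofReal, smul_eq_mul, symForm_opT b hd hh]
  ring

/-- The inverse Gram matrix of `Sym^d h` recovers the entries of `TΦ` from its pairings, and both
depend continuously on the parameter. -/
theorem continuousAt_opT (hd : d ≠ 0) (hH : ∀ᶠ t in 𝓝 (0 : ℝ), IsHermInner (H t))
    (hc : ∀ u v, ContinuousAt (fun t => H t u v) 0) (Φ : Module.End ℂ (SymP d V))
    (l : Module.Dual ℂ (Module.End ℂ (SymP d V))) :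
    ContinuousAt (fun τ => l (opT d b (H τ) Φ)) 0 := by
  have : Module.Finite ℂ V := Module.Finite.of_basis b
  let e := Module.finBasis ℂ (SymP d V)
  have hsym : ∀ s t, ContinuousAt (fun τ => symForm d (H τ) s t) 0 :=
    symForm_mem (continuousAtSubalgebra (0 : ℝ)) hc
  have hentry : ∀ i j, ContinuousAt (fun τ => LinearMap.toMatrix e e (opT d b (H τ) Φ) i j) 0 := by
    intro i j
    have h1 : ∀ᶠ τ in 𝓝 (0 : ℝ), LinearMap.toMatrix e e (opT d b (H τ) Φ) i j =
        ∑ a, (gramMat e (symForm d (H τ)))⁻¹ i a * conj ((fibreConst n d)⁻¹ *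
          ∫ ξ, fibreIntegrand b d (H τ) Φ (e a) (e j) ξ) := by
      filter_upwards [hH] with τ hτ
      have hS := (hτ.symForm b (d := d)).gramMat_posDef e
      have h2 : (gramMat e (symForm d (H τ))).mulVec (fun c => e.repr (opT d b (H τ) Φ (e j)) c) =
          fun a => conj ((fibreConst n d)⁻¹ *
            ∫ ξ, fibreIntegrand b d (H τ) Φ (e a) (e j) ξ) := by
        funext a
        rw [← symForm_opT b hd hτ, ← (hτ.symForm b).1, sesq_apply_eq_sum e]
        simp [Finsupp.single_apply, Matrix.mulVec, dotProduct, apply_ite]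
      have h3 := congrArg (gramMat e (symForm d (H τ)))⁻¹.mulVec h2
      rw [Matrix.mulVec_mulVec, Matrix.nonsing_inv_mul _
        (Matrix.isUnit_iff_isUnit_det _ |>.1 hS.isUnit), Matrix.one_mulVec] at h3
      rw [LinearMap.toMatrix_apply]
      exact congrFun h3 i
    refine ContinuousAt.congr ?_ (h1.mono fun _ h => h.symm)
    exact tendsto_finsetSum _ fun a _ =>
      (continuousAt_gramMat_inv e (hH.self_of_nhds.symForm b) hsym i a).tendsto.mul
        ((Complex.continuous_conj.continuousAt.comp (continuousAt_const.mul
          (continuousAt_integral_fibreIntegrand b hd hH hc Φ (e a) (e j)))).tendsto)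
  have h2 : ∀ τ, l (opT d b (H τ) Φ) = ∑ i, ∑ j, LinearMap.toMatrix e e (opT d b (H τ) Φ) i j *
      (l ∘ₗ (Matrix.toLin e e).toLinearMap) (Matrix.single i j 1) := fun τ => by
    rw [← linearMap_matrix_eq_sum]
    simp
  simp only [h2]
  exact tendsto_finsetSum _ fun i _ => tendsto_finsetSum _ fun j _ =>
    (hentry i j).tendsto.mul tendsto_const_nhds

/-- As `T_h(I + tΦ) = I + t T_hΦ` for each inner product `h`, the difference quotient is exactly
`T_{h_t}Φ`. Continuity along the family suffices; `T` is never differentiated in the metric. -/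
theorem hasDerivAt_opT (hd : d ≠ 0) (hH : ∀ᶠ t in 𝓝 (0 : ℝ), IsHermInner (H t))
    (hc : ∀ u v, ContinuousAt (fun t => H t u v) 0)
    (hone : ∀ h : Sesq V, IsHermInner h → ∀ s t : SymP d V,
      (fibreConst n d)⁻¹ * ∫ ξ : Fin n → ℂ, hatPairing (symForm d h) s t (affDual b ξ) *
        fibreVol b (symForm d h) ξ = symForm d h s t)
    (Φ : Module.End ℂ (SymP d V)) (l : Module.Dual ℂ (Module.End ℂ (SymP d V))) :
    HasDerivAt (fun t : ℝ => l (opT d b (H t) (1 + (t : ℂ) • Φ))) (l (opT d b (H 0) Φ)) 0 := by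
  have h1 : (fun t : ℝ => l (opT d b (H t) (1 + (t : ℂ) • Φ))) =ᶠ[𝓝 0]
      fun t : ℝ => l 1 + (t : ℂ) * l (opT d b (H t) Φ) := by
    filter_upwards [hH] with t ht
    rw [opT_one_add_smul b hd ht (hone _ ht), map_add, map_smul, smul_eq_mul]
  refine HasDerivAt.congr_of_eventuallyEq ?_ h1
  have h2 := continuousAt_opT b hd hH hc Φ l
  rw [hasDerivAt_iff_tendsto_slope]
  refine (h2.tendsto.mono_left nhdsWithin_le_nhds).congr' ?_
  filter_upwards [self_mem_nhdsWithin] with t ht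
  have ht' : (t : ℂ) ≠ 0 := Complex.ofReal_ne_zero.2 ht
  simp only [slope, vsub_eq_sub, sub_zero, Complex.ofReal_zero, zero_mul, add_zero,
      add_sub_cancel_left,
    Complex.real_smul, Complex.ofReal_inv]
  rw [inv_mul_cancel_left₀ ht']

end FibreIntegrals

/-! ### Gaussian integrals -/

section LinearChange

variable {κ : Type*} [Fintype κ] [DecidableEq κ] {G : Type*} [NormedAddCommGroup G]
  [NormedSpace ℝ G] {M : Matrix κ κ ℂ}

/-- The real determinant of a complex-linear map is the squared modulus of its complex determinant.
-/
theorem map_mulVec_volume (hM : M.det ≠ 0) : Measure.map (M.mulVec) (volume : Measure (κ → ℂ)) =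
    ENNReal.ofReal (Complex.normSq M.det)⁻¹ • volume := by
  have h1 : LinearMap.det ((Matrix.toLin' M).restrictScalars ℝ) = Complex.normSq M.det := by
    rw [LinearMap.det_restrictScalars, LinearMap.det_toLin', Algebra.norm_complex_apply]
  have h2 := Measure.map_linearMap_addHaar_eq_smul_addHaar (volume : Measure (κ → ℂ))
    (f := (Matrix.toLin' M).restrictScalars ℝ) (by rw [h1]; simpa using hM)
  rw [h1, abs_of_nonneg (inv_nonneg.2 (Complex.normSq_nonneg _))] at h2
  exact h2

theorem measurableEmbedding_mulVec (hM : M.det ≠ 0) : MeasurableEmbedding M.mulVec :=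
  Continuous.measurableEmbedding (by fun_prop) (Matrix.mulVec_injective_of_isUnit
    ((Matrix.isUnit_iff_isUnit_det _).2 (isUnit_iff_ne_zero.2 hM)))

theorem integral_comp_mulVec (hM : M.det ≠ 0) (f : (κ → ℂ) → G) :
    ∫ x, f (M.mulVec x) = (Complex.normSq M.det)⁻¹ • ∫ x, f x := by
  rw [← (measurableEmbedding_mulVec hM).integral_map, map_mulVec_volume hM, integral_smul_measure,
    ENNReal.toReal_ofReal (inv_nonneg.2 (Complex.normSq_nonneg _))]

theorem integrable_comp_mulVec {G : Type*} [NormedAddCommGroup G] (hM : M.det ≠ 0)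
    {f : (κ → ℂ) → G} (hf : Integrable f) :
    Integrable fun x => f (M.mulVec x) := by
  refine (measurableEmbedding_mulVec hM).integrable_map_iff.1 ?_
  rw [map_mulVec_volume hM]
  exact hf.smul_measure ENNReal.ofReal_ne_top

theorem integral_comp_complex_smul {n : ℕ} {c : ℂ} (hc : c ≠ 0) (f : (Fin n → ℂ) → G) :
    ‖c‖ ^ (2 * n) • ∫ x, f (c • x) = ∫ x, f x := by
  have h1 : (c • (1 : Matrix (Fin n) (Fin n) ℂ)).det = c ^ n := by simp
  have h2 := integral_comp_mulVec (M := c • (1 : Matrix (Fin n) (Fin n) ℂ))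
    (by rw [h1]; exact pow_ne_zero _ hc) f
  simp only [Matrix.smul_mulVec, Matrix.one_mulVec, h1] at h2
  rw [h2, smul_smul, map_pow, Complex.normSq_eq_norm_sq, ← pow_mul, mul_inv_cancel₀, one_smul]
  exact pow_ne_zero _ (norm_ne_zero_iff.2 hc)

theorem integrable_comp_complex_smul {G : Type*} [NormedAddCommGroup G] {n : ℕ} {c : ℂ}
    (hc : c ≠ 0) {f : (Fin n → ℂ) → G} (hf : Integrable f) : Integrable fun x => f (c • x) := by
  have h2 := integrable_comp_mulVec (M := c • (1 : Matrix (Fin n) (Fin n) ℂ))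
    (by simpa using pow_ne_zero n hc) hf
  simpa only [Matrix.smul_mulVec, Matrix.one_mulVec] using h2

/-- Integration over `ℂ^{n+1}` in the coordinates `v = c (1, ξ)`. -/
theorem integral_eq_integral_affVec {n : ℕ} {f : (Fin (n + 1) → ℂ) → ℂ} (hf : Integrable f)
    (hfc : Continuous f) :
    ∫ v, f v = ∫ ξ : Fin n → ℂ, ∫ c : ℂ, (‖c‖ ^ (2 * n) : ℝ) • f (c • affVec ξ) := by
  have hmp := (volume_preserving_piFinSuccAbove (fun _ : Fin (n + 1) => ℂ) 0).symm
  have hcons : ∀ p : ℂ × (Fin n → ℂ),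
      (MeasurableEquiv.piFinSuccAbove (fun _ : Fin (n + 1) => ℂ) 0).symm p = Fin.cons p.1 p.2 :=
    fun p => by
      simp [MeasurableEquiv.piFinSuccAbove]
      rfl
  have hcont : Continuous fun p : ℂ × (Fin n → ℂ) => f (Fin.cons p.1 p.2) :=
    hfc.comp (continuous_pi fun a => Fin.cases (by simpa using continuous_fst)
      (fun i => by simp only [Fin.cons_succ]; fun_prop) a)
  have h1 : ∫ v, f v = ∫ p : ℂ × (Fin n → ℂ), f (Fin.cons p.1 p.2) := by
    rw [← hmp.integral_comp (MeasurableEquiv.measurableEmbedding _)]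
    simp only [hcons]
  have h2 : Integrable fun p : ℂ × (Fin n → ℂ) => f (Fin.cons p.1 p.2) := by
    have := (hmp.integrable_comp_emb (MeasurableEquiv.measurableEmbedding _)).2 hf
    simpa only [Function.comp_def, hcons] using this
  have hsm : ∀ (c : ℂ) (ξ : Fin n → ℂ), (Fin.cons c (c • ξ) : Fin (n + 1) → ℂ) = c • affVec ξ :=
    fun c ξ => by
      funext a
      refine Fin.cases ?_ (fun i => ?_) a <;> simp [affVec]
  have hae : ∀ᵐ c : ℂ, c ≠ 0 := by
    simp [ae_iff]
  -- Fubini requires integrability in `(c, ξ)`. It is checked slicewise: for `c ≠ 0`, scaling by `c`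
  -- has Jacobian `|c|^{2n}`.
  have h3 : Integrable (Function.uncurry fun (c : ℂ) (ξ : Fin n → ℂ) =>
      (‖c‖ ^ (2 * n) : ℝ) • f (c • affVec ξ)) (volume.prod volume) := by
    rw [Measure.volume_eq_prod, integrable_prod_iff h2.aestronglyMeasurable] at h2
    refine (integrable_prod_iff ?_).2 ⟨?_, ?_⟩
    · refine Continuous.aestronglyMeasurable ?_
      simp only [← hsm]
      refine Continuous.smul (f := fun p : ℂ × (Fin n → ℂ) => ‖p.1‖ ^ (2 * n)) (by fun_prop) ?_
      exact hcont.comp (continuous_fst.prodMk (continuous_fst.smul continuous_snd))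
    · filter_upwards [h2.1, hae] with c h4 h5
      simp only [Function.uncurry_apply_pair, ← hsm]
      exact (integrable_comp_complex_smul h5 h4).smul (‖c‖ ^ (2 * n))
    · refine h2.2.congr ?_
      filter_upwards [hae] with c h5
      simp only [Function.uncurry_apply_pair, ← hsm, norm_smul, integral_const_mul, norm_pow,
          norm_norm]
      exact (integral_comp_complex_smul h5 fun ξ => ‖f (Fin.cons c ξ)‖).symm
  rw [h1, Measure.volume_eq_prod, integral_prod _ h2, ← integral_integral_swap h3]
  refine integral_congr_ae ?_
  filter_upwards [hae] with c h5
  simp only [← hsm, integral_smul]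
  exact (integral_comp_complex_smul h5 fun ξ => f (Fin.cons c ξ)).symm

end LinearChange

/-! ### Gaussian moments and the normalization of `T` -/

section GaussianMoments

theorem integral_norm_pow_mul_exp (k : ℕ) {a : ℝ} (ha : 0 < a) :
    ∫ z : ℂ, ‖z‖ ^ (2 * k) * Real.exp (-a * ‖z‖ ^ 2) = Real.pi * k.factorial / a ^ (k + 1) := by
  have h1 := Complex.integral_rpow_mul_exp_neg_mul_rpow (p := 2) (q := (2 * k : ℕ)) (b := a)
    (by norm_num) (lt_of_lt_of_le (by norm_num) (Nat.cast_nonneg _)) ha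
  simp only [Real.rpow_natCast, Real.rpow_two] at h1
  have h2 : (((2 * k : ℕ) : ℝ) + 2) / 2 = k + 1 := by push_cast; ring
  rw [h1, neg_div, h2, Real.Gamma_nat_eq_factorial, Real.rpow_neg ha.le, ← Nat.cast_succ,
    Real.rpow_natCast]
  field_simp

theorem integrable_norm_pow_mul_exp (k : ℕ) :
    Integrable fun z : ℂ => ‖z‖ ^ k * Real.exp (-‖z‖ ^ 2) := by
  have h1 := Complex.integral_rpow_mul_exp_neg_mul_rpow (p := 2) (q := k) (b := 1)
    (by norm_num) (lt_of_lt_of_le (by norm_num) (Nat.cast_nonneg _)) one_pos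
  simp only [Real.rpow_natCast, Real.rpow_two, neg_one_mul] at h1
  -- The integral of a non-integrable function is `0` by convention, whereas the value here is
  -- positive.
  refine not_imp_comm.1 integral_undef ?_
  rw [h1]
  have := Real.Gamma_pos_of_pos (s := ((k : ℝ) + 2) / 2) (by positivity)
  positivity

/-- The function `z^p z̄^q e^{-|z|²}`. -/
def gaussMonomial (p q : ℕ) (z : ℂ) : ℂ := z ^ p * conj z ^ q * Real.exp (-‖z‖ ^ 2)

theorem integrable_gaussMonomial (p q : ℕ) : Integrable (gaussMonomial p q) := by
  refine (integrable_norm_pow_mul_exp (p + q)).mono' ?_ (Eventually.of_forall fun z => ?_)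
  · unfold gaussMonomial
    exact Continuous.aestronglyMeasurable (by fun_prop)
  · rw [gaussMonomial, norm_mul, norm_mul, norm_pow, norm_pow, RCLike.norm_conj, ← pow_add,
      Complex.norm_real, Real.norm_of_nonneg (Real.exp_nonneg _)]

theorem integral_gaussMonomial (p q : ℕ) :
    ∫ z, gaussMonomial p q z = if p = q then (Real.pi * p.factorial : ℂ) else 0 := by
  split_ifs with hpq
  · subst hpq
    have h1 := integral_norm_pow_mul_exp p one_pos
    have h2 : gaussMonomial p p = fun z =>
        ((‖z‖ ^ (2 * p) * Real.exp (-1 * ‖z‖ ^ 2) : ℝ) : ℂ) := by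
      funext z
      rw [gaussMonomial, ← mul_pow, Complex.mul_conj, Complex.normSq_eq_norm_sq]
      push_cast
      ring_nf
    rw [h2, integral_complex_ofReal, h1]
    simp
  -- The angle makes `e^{i(p-q)θ} = -1`, so a rotation, which preserves the measure, changes the
  -- sign of the integrand.
  · let θ : ℝ := Real.pi / ((p : ℝ) - q)
    have hne : (p : ℝ) - q ≠ 0 := sub_ne_zero.2 (by exact_mod_cast hpq)
    let a : Circle := Circle.exp θ
    have h1 : ∀ z, gaussMonomial p q (rotation a z) = -gaussMonomial p q z := fun z => by
      have h2 : (a : ℂ) ^ p * conj (a : ℂ) ^ q = -1 := by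
        rw [← Circle.coe_inv_eq_conj]
        simp only [a]
        rw [← Circle.exp_neg, Circle.coe_exp, Circle.coe_exp, ← Complex.exp_nat_mul,
          ← Complex.exp_nat_mul, ← Complex.exp_add, ← Complex.exp_pi_mul_I]
        congr 1
        have h3 : (p : ℝ) * θ + q * (-θ) = Real.pi := by
          simp only [θ]; field_simp; ring
        rw [← h3]
        push_cast
        ring
      simp only [gaussMonomial, rotation_apply, map_mul, mul_pow, norm_mul, Circle.norm_coe,
          one_mul]
      linear_combination (z ^ p * conj z ^ q * Real.exp (-‖z‖ ^ 2)) * h2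
    have h4 := (rotation a).measurePreserving.integral_comp
      (rotation a).toHomeomorph.measurableEmbedding (gaussMonomial p q)
    simp only [h1, integral_neg] at h4
    exact self_eq_neg.1 h4.symm

variable {n d : ℕ}

theorem prod_coord_eq_prod_pow (x : Fin (n + 1) → ℂ) (I : Fin d → Fin (n + 1)) :
    ∏ k, x (I k) = ∏ a, x a ^ Fintype.card {k // I k = a} := by
  rw [← Finset.prod_fiberwise' Finset.univ I x]
  refine Finset.prod_congr rfl fun a _ => ?_
  rw [Finset.prod_const, Fintype.card_subtype]

theorem monomial_mul_exp (x : Fin (n + 1) → ℂ) (I J : Fin d → Fin (n + 1)) :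
    (∏ k, x (I k)) * conj (∏ k, x (J k)) * (Real.exp (-∑ a, ‖x a‖ ^ 2) : ℂ) =
      ∏ a, gaussMonomial (Fintype.card {k // I k = a}) (Fintype.card {k // J k = a}) (x a) := by
  simp only [gaussMonomial, Finset.prod_mul_distrib]
  rw [← Finset.sum_neg_distrib, Real.exp_sum, prod_coord_eq_prod_pow, prod_coord_eq_prod_pow x J]
  simp

/-- A permutation carrying `J` to `I` exists exactly when all fibres have equal sizes. Such
permutations then form a coset of the stabilizer of `J`, whose order is the product of the
factorials. This matches Gaussian moments with the permutation sum in `Sym^d h`. -/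
theorem sum_perm_eq (I J : Fin d → Fin (n + 1)) :
    (∑ σ : Equiv.Perm (Fin d), if I = fun k => J (σ k) then (1 : ℂ) else 0) =
      ∏ a, if Fintype.card {k // I k = a} = Fintype.card {k // J k = a} then
        ((Fintype.card {k // I k = a}).factorial : ℂ) else 0 := by
  by_cases hex : ∃ σ₀ : Equiv.Perm (Fin d), I = fun k => J (σ₀ k)
  · obtain ⟨σ₀, rfl⟩ := hex
    have hcard : ∀ a, Fintype.card {k // J (σ₀ k) = a} = Fintype.card {k // J k = a} := fun a =>
      Fintype.card_congr (σ₀.subtypeEquiv fun k => Iff.rfl)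
    simp only [hcard, if_true]
    rw [← Nat.cast_prod, ← DomMulAct.stabilizer_card J, Fintype.card_subtype, Finset.sum_boole]
    congr 1
    refine Finset.card_equiv (Equiv.mulRight σ₀⁻¹) fun σ => ?_
    simp only [Finset.mem_filter, Finset.mem_univ, true_and, Equiv.coe_mulRight, funext_iff,
      Function.comp_apply, Equiv.Perm.mul_apply]
    constructor
    · intro h k
      have := h (σ₀⁻¹ k)
      simpa using this.symm
    · intro h k
      have := h (σ₀ k)
      simpa using this.symm
  · rw [Finset.sum_eq_zero fun σ _ => if_neg fun h => hex ⟨σ, h⟩]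
    by_cases hall : ∀ a, Fintype.card {k // I k = a} = Fintype.card {k // J k = a}
    · refine (hex ⟨Equiv.ofFiberEquiv fun a => Fintype.equivOfCardEq (hall a), ?_⟩).elim
      funext k
      exact (Equiv.ofFiberEquiv_map _ k).symm
    · push Not at hall
      obtain ⟨a, ha⟩ := hall
      exact (Finset.prod_eq_zero (Finset.mem_univ a) (if_neg ha)).symm

/-- A Gaussian moment is computed twice: coordinatewise, and after substituting `M v` with `v = c
(1, ξ)`. In the second form the integral over `c` yields `π (n + d)!` times the integrand wanted
here, and the substitution contributes `|det M|⁻²`. -/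
theorem integral_monomial_fubiniStudy {M : Matrix (Fin (n + 1)) (Fin (n + 1)) ℂ} (hM : M.det ≠ 0)
    (I J : Fin d → Fin (n + 1)) :
    ∫ ξ : Fin n → ℂ, (∏ k, M.mulVec (affVec ξ) (I k)) * conj (∏ k, M.mulVec (affVec ξ) (J k)) *
      (((∑ a, ‖M.mulVec (affVec ξ) a‖ ^ 2 : ℝ) : ℂ) ^ (n + 1 + d))⁻¹ =
    (Complex.normSq M.det : ℂ)⁻¹ * (Real.pi ^ n / (n + d).factorial) *
      ∑ σ : Equiv.Perm (Fin d), if I = fun k => J (σ k) then 1 else 0 := by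
  let F : (Fin (n + 1) → ℂ) → ℂ := fun x =>
    (∏ k, x (I k)) * conj (∏ k, x (J k)) * (Real.exp (-∑ a, ‖x a‖ ^ 2) : ℂ)
  have hFprod : F = fun x => ∏ a, gaussMonomial (Fintype.card {k // I k = a})
    (Fintype.card {k // J k = a}) (x a) := funext fun x => monomial_mul_exp x I J
  have hFint : Integrable F := by
    rw [hFprod]
    exact Integrable.fintype_prod fun a => integrable_gaussMonomial _ _
  have hFc : Continuous F := by fun_prop
  have hF : ∫ x, F x = Real.pi ^ (n + 1) *
      ∑ σ : Equiv.Perm (Fin d), if I = fun k => J (σ k) then 1 else 0 := by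
    rw [hFprod, integral_fintype_prod_volume_eq_prod, sum_perm_eq]
    simp only [integral_gaussMonomial]
    have hcst : (Real.pi : ℂ) ^ (n + 1) = ∏ _a : Fin (n + 1), (Real.pi : ℂ) := by simp
    rw [hcst, ← Finset.prod_mul_distrib]
    refine Finset.prod_congr rfl fun a _ => ?_
    split_ifs <;> simp
  have hpol := integral_eq_integral_affVec (integrable_comp_mulVec hM hFint)
    (hFc.comp (by fun_prop : Continuous M.mulVec))
  rw [integral_comp_mulVec hM, hF] at hpol
  have hinner : ∀ ξ : Fin n → ℂ, ∫ c : ℂ, (‖c‖ ^ (2 * n) : ℝ) • F (M.mulVec (c • affVec ξ)) =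
      (Real.pi * (n + d).factorial : ℂ) * ((∏ k, M.mulVec (affVec ξ) (I k)) *
        conj (∏ k, M.mulVec (affVec ξ) (J k)) *
          (((∑ a, ‖M.mulVec (affVec ξ) a‖ ^ 2 : ℝ) : ℂ) ^ (n + 1 + d))⁻¹) := fun ξ => by
    set y := M.mulVec (affVec ξ) with hy
    have hy0 : y ≠ 0 := fun h0 => affVec_ne_zero ξ (Matrix.mulVec_injective_of_isUnit
      ((Matrix.isUnit_iff_isUnit_det _).2 (isUnit_iff_ne_zero.2 hM)) (by rw [← hy, h0]; simp))
    have hpos : 0 < ∑ a, ‖y a‖ ^ 2 := by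
      obtain ⟨a, ha⟩ := Function.ne_iff.1 hy0
      exact Finset.sum_pos' (fun _ _ => by positivity) ⟨a, Finset.mem_univ a, by
        have := norm_pos_iff.2 ha; positivity⟩
    have h1 : ∀ c : ℂ, (‖c‖ ^ (2 * n) : ℝ) • F (M.mulVec (c • affVec ξ)) =
        ((∏ k, y (I k)) * conj (∏ k, y (J k))) *
          ((‖c‖ ^ (2 * (n + d)) * Real.exp (-(∑ a, ‖y a‖ ^ 2) * ‖c‖ ^ 2) : ℝ) : ℂ) := fun c => by
      have h2 : c ^ d * conj c ^ d = (‖c‖ : ℂ) ^ (2 * d) := by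
        rw [← mul_pow, Complex.mul_conj, Complex.normSq_eq_norm_sq, pow_mul]; push_cast; ring
      have h3 : ∑ a, (‖c‖ * ‖y a‖) ^ 2 = (∑ a, ‖y a‖ ^ 2) * ‖c‖ ^ 2 := by
        rw [Finset.sum_mul]
        exact Finset.sum_congr rfl fun a _ => by ring
      simp only [F, Matrix.mulVec_smul, ← hy, Pi.smul_apply, smul_eq_mul, Finset.prod_mul_distrib,
        Finset.prod_const, Finset.card_univ, Fintype.card_fin, norm_mul, h3, Complex.real_smul,
        map_mul, map_pow, neg_mul]
      push_cast
      linear_combination ((‖c‖ : ℂ) ^ (2 * n) * (∏ k, y (I k)) * conj (∏ k, y (J k)) *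
        Complex.exp (-((∑ a, (‖y a‖ : ℂ) ^ 2) * (‖c‖ : ℂ) ^ 2))) * h2
    simp only [h1]
    rw [integral_const_mul, integral_complex_ofReal, integral_norm_pow_mul_exp _ hpos,
      show n + 1 + d = n + d + 1 by ring]
    push_cast
    ring
  simp only [hinner] at hpol
  rw [integral_const_mul] at hpol
  have hfac : ((n + d).factorial : ℂ) ≠ 0 := by exact_mod_cast (n + d).factorial_ne_zero
  have hpi : (Real.pi : ℂ) ≠ 0 := by exact_mod_cast Real.pi_ne_zero
  have h4 := mul_left_cancel₀ (mul_ne_zero hpi hfac) (hpol.symm.trans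
    (b := _) (c := (Real.pi * (n + d).factorial : ℂ) * ((Complex.normSq M.det : ℂ)⁻¹ *
      (Real.pi ^ n / (n + d).factorial) *
        ∑ σ : Equiv.Perm (Fin d), if I = fun k => J (σ k) then 1 else 0)) (by
    rw [Complex.real_smul]
    push_cast
    field_simp
    ring))
  exact h4

/-- The case `M = 1`, `I = J = 0` of the preceding integral, in which all `d!` permutations
contribute. -/
theorem fibreConst_eq : fibreConst n d =
    (d : ℂ) ^ n * 2 ^ n * (Real.pi ^ n * d.factorial / (n + d).factorial) := by
  have h1 := integral_monomial_fubiniStudy (n := n) (d := d) (M := 1) (by simp) (fun _ => 0)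
    (fun _ => 0)
  have h2 : ∀ ξ : Fin n → ℂ, ((∑ a, ‖affVec ξ a‖ ^ 2 : ℝ) : ℂ) = 1 + ∑ j, (‖ξ j‖ : ℂ) ^ 2 := by
    intro ξ
    rw [Fin.sum_univ_succ]
    simp [affVec]
  have h3 : ∀ ξ : Fin n → ℂ, affVec ξ 0 = 1 := fun ξ => rfl
  simp only [Matrix.one_mulVec, h2, h3, Finset.prod_const_one, map_one, one_mul, if_true,
    Matrix.det_one, Finset.sum_const, Finset.card_univ, Fintype.card_perm, Fintype.card_fin,
    nsmul_eq_mul, mul_one, Complex.ofReal_one, inv_one] at h1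
  rw [fibreConst]
  simp only [div_eq_mul_inv]
  rw [integral_const_mul, h1]
  ring

theorem fibreConst_ne_zero (hd : d ≠ 0) : fibreConst n d ≠ 0 := by
  have hpi : (Real.pi : ℂ) ≠ 0 := by exact_mod_cast Real.pi_ne_zero
  have h1 : ((n + d).factorial : ℂ) ≠ 0 := by exact_mod_cast (n + d).factorial_ne_zero
  have h2 : (d.factorial : ℂ) ≠ 0 := by exact_mod_cast d.factorial_ne_zero
  have h3 : (d : ℂ) ≠ 0 := by exact_mod_cast hd
  rw [fibreConst_eq]
  positivity

variable {V : Type*} [AddCommGroup V] [Module ℂ V] (b : Module.Basis (Fin (n + 1)) ℂ V)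
  {h : Sesq V}

theorem dualQuad_eq_sum (hh : IsHermInner h) {e : Module.Basis (Fin (n + 1)) ℂ V}
    (he : ∀ i j, h (e i) (e j) = if i = j then 1 else 0) (ξ : Fin n → ℂ) :
    dualQuad (gramMat b h)⁻¹ (affVec ξ) = ((∑ i, ‖affDual b ξ (e i)‖ ^ 2 : ℝ) : ℂ) := by
  have h1 : ∀ i, conj (e.repr (affRiesz b h ξ) i) = affDual b ξ (e i) := fun i => by
    rw [← hh.apply_affRiesz b, sesq_apply_eq_sum e]
    simp [gramMat, he, Finsupp.single_apply]
  rw [← affDual_affRiesz]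
  conv_lhs => rw [← e.sum_repr (affRiesz b h ξ)]
  simp only [map_sum, map_smul, smul_eq_mul]
  push_cast
  refine Finset.sum_congr rfl fun i _ => ?_
  rw [← h1, RCLike.norm_conj, Complex.mul_conj, Complex.normSq_eq_norm_sq]
  push_cast
  ring

/-- The Gram matrix is `P† P` for the transition matrix `P` to an orthonormal basis, and `b.toMatrix
e` inverts `P`. -/
theorem det_gramMat_inv {e : Module.Basis (Fin (n + 1)) ℂ V}
    (he : ∀ i j, h (e i) (e j) = if i = j then 1 else 0) :
    (gramMat b h)⁻¹.det = Complex.normSq (b.toMatrix e).transpose.det := by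
  have h1 : gramMat b h = (e.toMatrix b).conjTranspose * e.toMatrix b := by
    ext a c
    rw [gramMat, Matrix.of_apply, sesq_apply_eq_sum e]
    simp [gramMat, he, Matrix.mul_apply, Module.Basis.toMatrix_apply]
  have h2 : (e.toMatrix b).det * (b.toMatrix e).det = 1 := by
    rw [← Matrix.det_mul, Module.Basis.toMatrix_mul_toMatrix_flip, Matrix.det_one]
  have h3 : conj (e.toMatrix b).det * conj (b.toMatrix e).det = 1 := by
    rw [← map_mul, h2, map_one]
  rw [Matrix.det_nonsing_inv, Ring.inverse_eq_inv', h1, Matrix.det_mul, Matrix.det_conjTranspose,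
    Matrix.det_transpose, Complex.normSq_eq_conj_mul_self]
  refine inv_eq_of_mul_eq_one_right ?_
  change conj (e.toMatrix b).det * (e.toMatrix b).det * _ = 1
  linear_combination (conj (e.toMatrix b).det * conj (b.toMatrix e).det) * h2 + h3

/-- The normalization `T(I) = I`. -/
theorem integral_hatPairing_fibreVol (hd : d ≠ 0) (hh : IsHermInner h) (s t : SymP d V) :
    (fibreConst n d)⁻¹ * ∫ ξ : Fin n → ℂ, hatPairing (symForm d h) s t (affDual b ξ) *
      fibreVol b (symForm d h) ξ = symForm d h s t := by
  obtain ⟨e, he⟩ := hh.exists_orthonormal b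
  have hM : (b.toMatrix e).transpose.det ≠ 0 := by
    rw [Matrix.det_transpose]
    exact fun h0 => one_ne_zero (α := ℂ) (by
      rw [← Matrix.det_one (n := Fin (n + 1)), ← b.toMatrix_mul_toMatrix_flip e, Matrix.det_mul, h0,
        zero_mul])
  -- The chart belongs to `b`, the moments to the orthonormal basis `e`. The transition matrix plays
  -- the role of `M`, and its `|det M|⁻²` cancels the factor `|det M|²` of the volume.
  have hdual : ∀ (ξ : Fin n → ℂ) i,
      (b.toMatrix e).transpose.mulVec (affVec ξ) i = affDual b ξ (e i) := fun ξ i => by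
    rw [affDual_apply]
    simp only [Matrix.mulVec, dotProduct, Matrix.transpose_apply, Module.Basis.toMatrix_apply]
    exact Finset.sum_congr rfl fun a _ => mul_comm _ _
  have hB : ∀ I J : Fin d → Fin (n + 1), ∫ ξ : Fin n → ℂ,
      hatPairing (symForm d h) (sprod fun k => e (I k)) (sprod fun k => e (J k)) (affDual b ξ) *
        fibreVol b (symForm d h) ξ =
      fibreConst n d * symForm d h (sprod fun k => e (I k)) (sprod fun k => e (J k)) := by
    intro I J
    have h1 := integral_monomial_fubiniStudy hM I J
    simp only [hdual] at h1
    have h2 : ∀ ξ : Fin n → ℂ,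
        hatPairing (symForm d h) (sprod fun k => e (I k)) (sprod fun k => e (J k)) (affDual b ξ) *
          fibreVol b (symForm d h) ξ = (2 ^ n * (d : ℂ) ^ n *
            (Complex.normSq (b.toMatrix e).transpose.det : ℂ)) *
          ((∏ k, affDual b ξ (e (I k))) * conj (∏ k, affDual b ξ (e (J k))) *
            (((∑ a, ‖affDual b ξ (e a)‖ ^ 2 : ℝ) : ℂ) ^ (n + 1 + d))⁻¹) := fun ξ => by
      rw [hatPairing, dualPow_sprod, dualPow_sprod, fibreVol_eq b hh, dualNormSq_symForm b hh,
        det_gramMat_inv b he, dualQuad_eq_sum b hh he, pow_add _ (n + 1), mul_inv, div_eq_mul_inv]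
      ring
    have hn : (Complex.normSq (b.toMatrix e).transpose.det : ℂ) ≠ 0 := by
      exact_mod_cast (Complex.normSq_pos.2 hM).ne'
    have hf : (d.factorial : ℂ) ≠ 0 := by exact_mod_cast d.factorial_ne_zero
    simp only [h2]
    rw [integral_const_mul, h1, fibreConst_eq, symForm_orthonormal he]
    field_simp
  have hC := fibreConst_ne_zero (n := n) hd
  -- As a sesquilinear form, the integral needs to be compared only on products of basis vectors.
  have hsesq : ∀ s t, fibreSesq b hd hh (1 + (0 : ℂ) • 1) s t =
      ∫ ξ : Fin n → ℂ, hatPairing (symForm d h) s t (affDual b ξ) * fibreVol b (symForm d h) ξ := by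
    intro s t
    change ∫ ξ, fibreIntegrand b d h (1 + (0 : ℂ) • 1) s t ξ = _
    simp only [fibreIntegrand_one_add_smul b hh, zero_mul, add_zero]
  rw [inv_mul_eq_iff_eq_mul₀ hC, ← hsesq]
  refine symP_basis_induction e (P := fun s => fibreSesq b hd hh (1 + (0 : ℂ) • 1) s t =
    fibreConst n d * symForm d h s t) (fun I => ?_) (fun s s' h1 h2 => ?_) (fun c s h1 => ?_) ?_ s
  · refine symP_basis_induction e (P := fun t => fibreSesq b hd hh (1 + (0 : ℂ) • 1)
      (sprod fun k => e (I k)) t = fibreConst n d * symForm d h (sprod fun k => e (I k)) t)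
      (fun J => ?_) (fun s s' h1 h2 => ?_) (fun c s h1 => ?_) ?_ t
    · rw [hsesq, hB]
    · rw [map_add, map_add, h1, h2, mul_add]
    · rw [LinearMap.map_smulₛₗ, LinearMap.map_smulₛₗ, h1, smul_eq_mul, smul_eq_mul]; ring
    · rw [map_zero, map_zero, mul_zero]
  · rw [map_add, map_add, LinearMap.add_apply, LinearMap.add_apply, h1, h2, mul_add]
  · rw [map_smul, map_smul, LinearMap.smul_apply, LinearMap.smul_apply, h1, smul_eq_mul,
      smul_eq_mul]; ring
  · rw [map_zero, map_zero, LinearMap.zero_apply, mul_zero]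

theorem hasDerivAt_opT_perturbation (hd : d ≠ 0) {H : ℝ → Sesq V}
    (hH : ∀ᶠ t in 𝓝 (0 : ℝ), IsHermInner (H t)) (hc : ∀ u v, ContinuousAt (fun t => H t u v) 0)
    (Φ : Module.End ℂ (SymP d V)) (l : Module.Dual ℂ (Module.End ℂ (SymP d V))) :
    HasDerivAt (fun t : ℝ => l (opT d b (H t) (1 + (t : ℂ) • Φ))) (l (opT d b (H 0) Φ)) 0 :=
  hasDerivAt_opT b hd hH hc (fun _ hh s t => integral_hatPairing_fibreVol b hd hh s t) Φ l

end GaussianMoments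

/-! ### Perturbations of a Hermitian metric -/

section Perturbation

variable {V : Type*} [AddCommGroup V] [Module ℂ V] {n m : ℕ}

/-- In an orthonormal basis `|h(Au, u)| ≤ C h(u, u)`, so positivity persists while `|t| C < 1`.
Hermitian symmetry uses that `A` is self-adjoint. -/
theorem eventually_isHermInner_comp {h : Sesq V} (hh : IsHermInner h)
    (b : Module.Basis (Fin (n + 1)) ℂ V) {A : Module.End ℂ V}
    (hA : ∀ u v, h (A u) v = h u (A v)) :
    ∀ᶠ t : ℝ in 𝓝 0, IsHermInner (h.comp (1 + (t : ℂ) • A)) := by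
  obtain ⟨e, he⟩ := hh.exists_orthonormal b
  let C : ℝ := ∑ i, ∑ j, ‖h (A (e i)) (e j)‖
  have hself : ∀ u, h u u = ((∑ k, ‖e.repr u k‖ ^ 2 : ℝ) : ℂ) := fun u => by
    rw [sesq_apply_eq_sum e]
    simp [gramMat, he, Complex.conj_mul']
  have hbound : ∀ u, ‖h (A u) u‖ ≤ C * ∑ k, ‖e.repr u k‖ ^ 2 := fun u => by
    have h1 : h (A u) u = ∑ i, ∑ j, (e.repr u i * conj (e.repr u j)) * h (A (e i)) (e j) := by
      conv_lhs => rw [← e.sum_repr u]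
      simp only [map_sum, map_smul, LinearMap.sum_apply, LinearMap.smul_apply,
        LinearMap.map_smulₛₗ, smul_eq_mul, Finset.mul_sum]
      rw [Finset.sum_comm]
      exact Finset.sum_congr rfl fun i _ => Finset.sum_congr rfl fun j _ => by ring
    have h2 : ∀ i, ‖e.repr u i‖ ^ 2 ≤ ∑ k, ‖e.repr u k‖ ^ 2 := fun i =>
      Finset.single_le_sum (f := fun k => ‖e.repr u k‖ ^ 2) (fun _ _ => by positivity)
        (Finset.mem_univ i)
    rw [h1]
    simp only [C, Finset.sum_mul]
    refine (norm_sum_le _ _).trans (Finset.sum_le_sum fun i _ => (norm_sum_le _ _).trans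
      (Finset.sum_le_sum fun j _ => ?_))
    rw [norm_mul, norm_mul, RCLike.norm_conj, mul_comm]
    refine mul_le_mul_of_nonneg_left ?_ (norm_nonneg _)
    nlinarith [h2 i, h2 j, sq_nonneg (‖e.repr u i‖ - ‖e.repr u j‖)]
  have hsmall : ∀ᶠ t : ℝ in 𝓝 0, |t| * C < 1 := by
    have : ContinuousAt (fun t : ℝ => |t| * C) 0 := by fun_prop
    exact this.eventually_lt_const (by simp)
  filter_upwards [hsmall] with t ht
  have happ : ∀ u v, h.comp (1 + (t : ℂ) • A) u v = h u v + t * h (A u) v := fun u v => by simp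
  refine ⟨fun u v => ?_, fun u hu => ?_⟩
  · rw [happ, happ, map_add, map_mul, Complex.conj_ofReal, ← hh.1 u v, hA, ← hh.1 (A u) v]
  · have hpos : 0 < ∑ k, ‖e.repr u k‖ ^ 2 := by
      have := hh.2 u hu
      rwa [hself, Complex.ofReal_re] at this
    have h3 : |((t : ℂ) * h (A u) u).re| ≤ |t| * (C * ∑ k, ‖e.repr u k‖ ^ 2) := by
      refine (Complex.abs_re_le_norm _).trans ?_
      rw [norm_mul, Complex.norm_real, Real.norm_eq_abs]
      exact mul_le_mul_of_nonneg_left (hbound u) (abs_nonneg _)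
    rw [happ, Complex.add_re, hself, Complex.ofReal_re]
    have h4 := neg_le_of_abs_le h3
    nlinarith

theorem continuousAt_comp_one_add_smul (h : Sesq V) (A : Module.End ℂ V) (u v : V) :
    ContinuousAt (fun t : ℝ => h.comp (1 + (t : ℂ) • A) u v) 0 := by
  have happ : ∀ t : ℝ, h.comp (1 + (t : ℂ) • A) u v = h u v + t * h (A u) v := fun t => by simp
  simp only [happ]
  fun_prop

theorem chernCurv_congr {κ : Type*} [Fintype κ] [DecidableEq κ] (b : Module.Basis κ ℂ V)
    {K K' : (Fin m → ℂ) → Sesq V} {z : Fin m → ℂ} (hK : K =ᶠ[𝓝 z] K') (j k : Fin m) :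
    chernCurv b K z j k = chernCurv b K' z j k := by
  have h1 : ∀ᶠ y in 𝓝 z, gram b K y = gram b K' y := hK.mono fun y hy => by simp only [gram, hy]
  have h2 : ∀ᶠ y in 𝓝 z, chernConn b K j y = chernConn b K' j y := by
    filter_upwards [h1.eventually_nhds] with y hy
    rw [chernConn, chernConn, hy.self_of_nhds]
    congr 2
    ext a c
    rw [wd_eq_wirt]
    exact wirt_congr (hy.mono fun y' hy' => by simp only [hy']) _ _
  rw [chernCurv, chernCurv]
  congr 2
  ext a c
  rw [wdbar_eq_wirt]
  exact congrArg _ (wirt_congr (h2.mono fun y hy => by simp only [hy]) _ _)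

theorem map_lamVar {M M' : Type*} [AddCommGroup M] [Module ℂ M] [AddCommGroup M'] [Module ℂ M']
    (l : M →ₗ[ℂ] M') (om α : Matrix (Fin m) (Fin m) ℂ) (F : Fin m → Fin m → M) :
    l (lamVar om α F) = lamVar om α fun j k => l (F j k) := by
  simp only [lamVar, map_sum, map_smul]

end Perturbation

/-! ### Local expressions -/

section LocalExpressions

variable {m : ℕ} {X : Type*} [TopologicalSpace X] [ChartedSpace (Fin m → ℂ) X]

theorem contDiffAt_of_contMDiffAt {F : Type*} [NormedAddCommGroup F] [NormedSpace ℝ F] {f : X → F}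
    {x : X} (hf : ContMDiffAt 𝓘(ℝ, Fin m → ℂ) 𝓘(ℝ, F) ∞ f x) :
    ContDiffAt ℝ ∞ (fun z => f ((chartAt (Fin m → ℂ) x).symm z)) (chartAt (Fin m → ℂ) x x) := by
  have h1 := (contMDiffAt_iff.1 hf).2
  simpa [mfld_simps, Function.comp_def, chartAt_self_eq, contDiffWithinAt_univ] using h1

theorem eventually_mem_baseSet (n : ℕ) (E : X → Type*) [∀ x, AddCommGroup (E x)]
    [∀ x, TopologicalSpace (E x)] [TopologicalSpace (Bundle.TotalSpace (Fin (n + 1) → ℂ) E)]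
    [FiberBundle (Fin (n + 1) → ℂ) E] (x : X) : ∀ᶠ z in 𝓝 (chartAt (Fin m → ℂ) x x),
    (chartAt (Fin m → ℂ) x).symm z ∈ (trivializationAt (Fin (n + 1) → ℂ) E x).baseSet := by
  have h1 := (chartAt (Fin m → ℂ) x).continuousAt_symm (mem_chart_target (Fin m → ℂ) x)
  refine h1.eventually ?_
  rw [(chartAt (Fin m → ℂ) x).left_inv (mem_chart_source _ x)]
  exact (trivializationAt (Fin (n + 1) → ℂ) E x).open_baseSet.mem_nhds
      (FiberBundle.mem_baseSet_trivializationAt' x)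

variable {n d : ℕ} {E : X → Type*} [∀ x, AddCommGroup (E x)] [∀ x, Module ℂ (E x)]
  [∀ x, TopologicalSpace (E x)] [TopologicalSpace (Bundle.TotalSpace (Fin (n + 1) → ℂ) E)]
  [FiberBundle (Fin (n + 1) → ℂ) E] [VectorBundle ℂ (Fin (n + 1) → ℂ) E]

theorem trivSymm_triv {x y : X} (hy : y ∈ (trivializationAt (Fin (n + 1) → ℂ) E x).baseSet)
    (v : E y) : trivSymm (n := n) x y (triv x y v) = v :=
  (trivializationAt (Fin (n + 1) → ℂ) E x).symmₗ_linearMapAt hy v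

theorem triv_trivSymm {x y : X} (hy : y ∈ (trivializationAt (Fin (n + 1) → ℂ) E x).baseSet)
    (v : Fin (n + 1) → ℂ) : triv (E := E) x y (trivSymm x y v) = v :=
  (trivializationAt (Fin (n + 1) → ℂ) E x).linearMapAt_symmₗ hy v

/-- Inserting `trivSymm ∘ triv` between metric and endomorphism is legitimate only over the base set
of the trivialization, hence an identity of germs. -/
theorem locMetric_perturbMetric (h : ∀ x, Sesq (E x)) (φ : ∀ x, Module.End ℂ (E x)) (t : ℝ)
    (x : X) : locMetric (m := m) n (perturbMetric h φ t) x =ᶠ[𝓝 (chartAt (Fin m → ℂ) x x)]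
      fun z => (locMetric n h x z).comp (1 + (t : ℂ) • locEnd n φ x z) := by
  filter_upwards [eventually_mem_baseSet n E x] with z hz
  refine LinearMap.ext fun u => LinearMap.ext fun v => ?_
  simp [locMetric, perturbMetric, locEnd, trivSymm_triv hz]

theorem locMetric_isHermInner {h : ∀ x, Sesq (E x)} {x : X} {z : Fin m → ℂ}
    (hh : IsHermInner (h ((chartAt (Fin m → ℂ) x).symm z)))
    (hz : (chartAt (Fin m → ℂ) x).symm z ∈ (trivializationAt (Fin (n + 1) → ℂ) E x).baseSet) :
    IsHermInner (locMetric n h x z) := by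
  refine ⟨fun u v => hh.1 _ _, fun u hu => hh.2 _ fun h0 => hu ?_⟩
  rw [← triv_trivSymm hz u, h0, map_zero]

/-- Transport of endomorphisms of `ℂ^r` to the fibre at `x`. -/
def trivConj (x : X) : Module.End ℂ (Fin (n + 1) → ℂ) →ₗ[ℂ] Module.End ℂ (E x) where
  toFun A := trivSymm x x ∘ₗ A ∘ₗ triv x x
  map_add' A B := by simp [LinearMap.add_comp, LinearMap.comp_add]
  map_smul' c A := by simp [LinearMap.smul_comp, LinearMap.comp_smul]

/-- This removes the arbitrary basis of `Sym^d ℂ^r` from `curvSym`. The local expression `K` is left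
free so that both `h` and its perturbations are covered. -/
theorem curvSym_eq_symDer {h : ∀ x, Sesq (E x)} {x : X} {K : (Fin m → ℂ) → Sesq (Fin (n + 1) → ℂ)}
    (hK : locMetric n h x =ᶠ[𝓝 (chartAt (Fin m → ℂ) x x)] K)
    (hs : ∀ u v, ContDiffAt ℝ ∞ (fun z => K z u v) (chartAt (Fin m → ℂ) x x))
    (hh : IsHermInner (h x)) (j k : Fin m) :
    curvSym n d h x j k = symDer d (trivConj x
      (chernCurv (Pi.basisFun ℂ (Fin (n + 1))) K (chartAt (Fin m → ℂ) x x) j k)) := by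
  have hx := FiberBundle.mem_baseSet_trivializationAt' (F := Fin (n + 1) → ℂ) (E := E) x
  have hleft := (chartAt (Fin m → ℂ) x).left_inv (mem_chart_source _ x)
  have hK0 : IsHermInner (K (chartAt (Fin m → ℂ) x x)) := by
    rw [← hK.self_of_nhds]
    exact locMetric_isHermInner (hleft.symm ▸ hh) (hleft.symm ▸ hx)
  rw [curvSym, chernCurv_congr _ (K' := fun z => symForm d (K z)) (hK.mono fun z hz => by
    simp only [hz]), chernCurv_symForm (Pi.basisFun ℂ (Fin (n + 1))) _ hs
      (hK0.gramMat_posDef _).det_pos.ne'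
      ((hK0.symForm (Pi.basisFun ℂ (Fin (n + 1)))).gramMat_posDef _).det_pos.ne',
    symMap_comp_symDer_comp (LinearMap.ext fun v => trivSymm_triv hx v)]
  rfl

end LocalExpressions

/-! ### First variation of the scalar curvature and of the contracted curvature -/

section FirstVariation

variable {m n d : ℕ} {X : Type*} [TopologicalSpace X] [ChartedSpace (Fin m → ℂ) X]
  {E : X → Type*} [∀ x, AddCommGroup (E x)] [∀ x, Module ℂ (E x)]
  [∀ x, TopologicalSpace (E x)] [TopologicalSpace (Bundle.TotalSpace (Fin (n + 1) → ℂ) E)]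
  [FiberBundle (Fin (n + 1) → ℂ) E] [VectorBundle ℂ (Fin (n + 1) → ℂ) E]

theorem hasDerivAt_scalarCurv {Om : Form11 m X} (hOm : IsKahlerForm Om) (hcsc : IsCscK Om)
    {η : X → ℝ} (hη : ContMDiff 𝓘(ℝ, Fin m → ℂ) 𝓘(ℝ, ℝ) ∞ η) (x : X) :
    HasDerivAt (fun t : ℝ => scalarCurv (Om + (t : ℂ) • iDbarD η) x)
      (2 * lichnerowicz Om η x) 0 := by
  have hx := mem_chart_target (Fin m → ℂ) x
  have hopen := (chartAt (Fin m → ℂ) x).open_target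
  have he := chart_mem_atlas (Fin m → ℂ) x
  have hev : ∀ᶠ z in 𝓝 (chartAt (Fin m → ℂ) x x), z ∈ (chartAt (Fin m → ℂ) x).target :=
    hopen.mem_nhds hx
  obtain ⟨c, hc⟩ := hcsc
  exact hasDerivAt_scalarCurvLoc
    (fun j k => (hOm.smooth _ he j k).contDiffAt (hopen.mem_nhds hx))
    (hev.mono fun z hz => hOm.posDef _ he z hz) (hev.mono fun z hz => hOm.closed _ he z hz)
    (Complex.ofRealCLM.contDiff.contDiffAt.comp _ (contDiffAt_of_contMDiffAt (hη x)))
    ⟨c, hev.mono fun z hz => hc _ he z hz⟩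

/-- The curvature moves by `S^d ∂̄∂φ` and the contraction by `lamVar`. The latter differs from `Λ²(F
∧ α)` by a multiple of `ΛF`, which the Hermitian–Einstein equation makes scalar, so the trace-free
part does not see it. -/
theorem hasDerivAt_traceFree_Lam_curvSym {Om : Form11 m X} (hOm : IsKahlerForm Om)
    {h : ∀ x, Sesq (E x)} (hh : IsHermMetric (m := m) n h) (hHE : IsHermEinstein n Om h)
    {φ : ∀ x, Module.End ℂ (E x)} (hφ : IsSmoothEnd (m := m) n φ)
    (hφh : ∀ x u v, h x (φ x u) v = h x u (φ x v)) (α : Form11 m X) (x : X)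
    (l : Module.Dual ℂ (Module.End ℂ (SymP d (E x)))) :
    HasDerivAt (fun t : ℝ => l (traceFree (Lam (formAt (Om + (t : ℂ) • α) x)
        (curvSym n d (perturbMetric h φ t) x))))
      (l (traceFree (symDer d (Lam (formAt Om x) (dbardEndE n h φ x)) +
        Lam2 (formAt Om x) (wedge11 (curvSym n d h x) (formAt α x))))) 0 := by
  have : Module.Finite ℂ (E x) := Module.Finite.of_basis (frameAt n x)
  set b := Pi.basisFun ℂ (Fin (n + 1))
  set z₀ := chartAt (Fin m → ℂ) x x with hz₀
  set K := locMetric (m := m) n h x with hKdef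
  set ψ := locEnd (m := m) n φ x with hψdef
  have hK : ∀ u v, ContDiffAt ℝ ∞ (fun z => K z u v) z₀ := fun u v =>
    contDiffAt_of_contMDiffAt (hh.smooth x u v)
  have hψ : ∀ u i, ContDiffAt ℝ ∞ (fun z => ψ z u i) z₀ := fun u =>
    contDiffAt_pi.1 (contDiffAt_of_contMDiffAt (hφ x u))
  have hψ' : ∀ a c, ContDiffAt ℝ ∞ (fun z => LinearMap.toMatrix b b (ψ z) a c) z₀ := fun a c => by
    simpa [LinearMap.toMatrix_apply, b] using hψ (b c) a
  have hKt : ∀ (t : ℝ) u v,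
      ContDiffAt ℝ ∞ (fun z => (K z).comp (1 + (t : ℂ) • ψ z) u v) z₀ := fun t u v => by
    have h1 : ∀ z, (K z).comp (1 + (t : ℂ) • ψ z) u v =
        K z u v + t * ∑ i, ψ z u i * K z (b i) v := fun z => by
      have h2 : K z (ψ z u) v = ∑ i, ψ z u i * K z (b i) v := by
        conv_lhs => rw [← b.sum_repr (ψ z u)]
        simp [b]
      simp [← h2]
    simp only [h1]
    exact (hK u v).add (contDiffAt_const.mul (ContDiffAt.sum fun i _ => (hψ u i).mul (hK _ v)))
  have hx := FiberBundle.mem_baseSet_trivializationAt' (F := Fin (n + 1) → ℂ) (E := E) x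
  have hleft := (chartAt (Fin m → ℂ) x).left_inv (mem_chart_source _ x)
  have hK0 : IsHermInner (K z₀) := locMetric_isHermInner (hleft.symm ▸ hh.inner x) (hleft.symm ▸ hx)
  -- All fixed linear operations on the curvature of `h` are gathered in one functional, since
  -- `hasDerivAt_chernCurv` is stated for functionals.
  let L : Module.Dual ℂ (Module.End ℂ (Fin (n + 1) → ℂ)) :=
    l ∘ₗ traceFreeL (SymP d (E x)) ∘ₗ symDerL (E x) d ∘ₗ trivConj x
  have hcurv : ∀ᶠ t : ℝ in 𝓝 0, ∀ j k, curvSym n d (perturbMetric h φ t) x j k =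
      symDer d (trivConj x (chernCurv b (fun z => (K z).comp (1 + (t : ℂ) • ψ z)) z₀ j k)) := by
    -- Only for small `t` is the perturbed form an inner product, which the curvature formula for
    -- `Sym^d` requires at `x`.
    filter_upwards [eventually_isHermInner_comp (hh.inner x) (frameAt n x) (hφh x)] with t ht j k
    exact curvSym_eq_symDer (locMetric_perturbMetric h φ t x) (hKt t) ht j k
  have hcurv0 : ∀ j k, curvSym n d h x j k = symDer d (trivConj x (chernCurv b K z₀ j k)) :=
    curvSym_eq_symDer (EventuallyEq.refl _ _) hK (hh.inner x)
  have hdet : (metricMatrix (formAt Om x)).det ≠ 0 :=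
    (hOm.posDef _ (chart_mem_atlas _ x) _ (mem_chart_target _ x)).det_pos.ne'
  have hmain := hasDerivAt_Lam (α := formAt α x) hdet fun j k =>
    hasDerivAt_chernCurv b hK hψ' (hK0.gramMat_posDef b).det_pos.ne' L j k
  have hzero : (fun z => (K z).comp (1 + ((0 : ℝ) : ℂ) • ψ z)) = K := by
    funext z
    refine LinearMap.ext fun u => ?_
    simp
  rw [hzero] at hmain
  obtain ⟨μ, hμ⟩ := hHE
  -- `S^d (μ I) = μ d I`, so the contraction of the curvature of `Sym^d h` is scalar as well.
  have hLam : Lam (formAt Om x) (curvSym n d h x) = (μ * d) • (1 : Module.End ℂ (SymP d (E x))) :=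
      by
    have h1 : curvSym n d h x = fun j k => symDerL (E x) d (curvE n h x j k) :=
      funext fun j => funext fun k => hcurv0 j k
    rw [h1, ← map_Lam, hμ x, map_smul, symDerL_apply, symDer_one, smul_smul]
  refine (hmain.congr_of_eventuallyEq ?_).congr_deriv ?_
  · filter_upwards [hcurv] with t ht
    have h1 : curvSym n d (perturbMetric h φ t) x = fun j k => symDer d (trivConj x
      (chernCurv b (fun z => (K z).comp (1 + (t : ℂ) • ψ z)) z₀ j k)) :=
      funext fun j => funext fun k => ht j k
    rw [h1]
    exact map_Lam (l ∘ₗ traceFreeL (SymP d (E x))) _ _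
  · rw [Lam2_wedge11, hLam, smul_smul]
    change _ = (l ∘ₗ traceFreeL (SymP d (E x))) _
    rw [map_add, map_add, map_lamVar]
    have h2 : (l ∘ₗ traceFreeL (SymP d (E x)))
        ((Lam (formAt Om x) (formAt α x) * (μ * d)) • (1 : Module.End ℂ (SymP d (E x)))) = 0 := by
      change l (traceFree _) = 0
      rw [traceFree_smul_one, map_zero]
    rw [h2, zero_add]
    congr 1
    · change _ = (l ∘ₗ traceFreeL (SymP d (E x)) ∘ₗ symDerL (E x) d) _
      rw [map_Lam]
      rfl
    · simp only [hcurv0]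
      rfl

end FirstVariation

end SymBalanced

end

/-- No norm is fixed on `End (Sym^d E_x)`. The space is finite-dimensional, so a derivative there,
including its existence, is expressed by testing against every linear functional `l`. The factor
`1/2` before the scalar curvature cancels the `2` in its linearization. -/
theorem proposition3p8 {m n d : ℕ} (hd : 0 < d)
    {X : Type*} [TopologicalSpace X] [T2Space X] [ChartedSpace (Fin m → ℂ) X]
    [IsManifold 𝓘(ℂ, Fin m → ℂ) ω X]
    {E : X → Type*} [∀ x, AddCommGroup (E x)] [∀ x, Module ℂ (E x)]
    [∀ x, TopologicalSpace (E x)] [TopologicalSpace (Bundle.TotalSpace (Fin (n + 1) → ℂ) E)]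
    [FiberBundle (Fin (n + 1) → ℂ) E] [VectorBundle ℂ (Fin (n + 1) → ℂ) E]
    [ContMDiffVectorBundle ω (Fin (n + 1) → ℂ) E 𝓘(ℂ, Fin m → ℂ)]
    (Om : SymBalanced.Form11 m X) (hOm : SymBalanced.IsKahlerForm Om)
    (hcsc : SymBalanced.IsCscK Om)
    (h : ∀ x, SymBalanced.Sesq (E x)) (hh : SymBalanced.IsHermMetric (m := m) n h)
    (hHE : SymBalanced.IsHermEinstein n Om h)
    (φ : ∀ x, Module.End ℂ (E x)) (hφ : SymBalanced.IsSmoothEnd (m := m) n φ)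
    (hφh : ∀ x u v, h x (φ x u) v = h x u (φ x v))
    (η : X → ℝ) (hη : ContMDiff 𝓘(ℝ, Fin m → ℂ) 𝓘(ℝ, ℝ) ∞ η)
    (Φ : ∀ x, Module.End ℂ (SymBalanced.SymP d (E x)))
    (x : X) (l : Module.Dual ℂ (Module.End ℂ (SymBalanced.SymP d (E x)))) :
    HasDerivAt
      (fun t : ℝ => l (SymBalanced.coeffA1 n d (SymBalanced.perturbMetric h φ t)
        (Om + (t : ℂ) • SymBalanced.iDbarD η) (fun y => 1 + (t : ℂ) • Φ y) x))
      (l (SymBalanced.lichnerowicz Om η x • (1 : Module.End ℂ (SymBalanced.SymP d (E x))) +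
        SymBalanced.coeffA n d • SymBalanced.traceFree
          (SymBalanced.symDer d
              (SymBalanced.Lam (SymBalanced.formAt Om x) (SymBalanced.dbardEndE n h φ x)) +
            SymBalanced.Lam2 (SymBalanced.formAt Om x)
              (SymBalanced.wedge11 (SymBalanced.curvSym n d h x)
                (SymBalanced.formAt (SymBalanced.iDbarD η) x))) +
        Φ x - SymBalanced.opT d (SymBalanced.frameAt n x) (h x) (Φ x))) 0 := by
  have hfun : ∀ t : ℝ, l (SymBalanced.coeffA1 n d (SymBalanced.perturbMetric h φ t)
      (Om + (t : ℂ) • SymBalanced.iDbarD η) (fun y => 1 + (t : ℂ) • Φ y) x) =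
      SymBalanced.coeffA n d * l (SymBalanced.traceFree
        (SymBalanced.Lam (SymBalanced.formAt (Om + (t : ℂ) • SymBalanced.iDbarD η) x)
          (SymBalanced.curvSym n d (SymBalanced.perturbMetric h φ t) x))) +
      1 / 2 * SymBalanced.scalarCurv (Om + (t : ℂ) • SymBalanced.iDbarD η) x * l 1 +
      (l 1 + (t : ℂ) * l (Φ x)) -
      l (SymBalanced.opT d (SymBalanced.frameAt n x) (SymBalanced.perturbMetric h φ t x)
        (1 + (t : ℂ) • Φ x)) := by
    intro t
    simp only [SymBalanced.coeffA1, map_sub, map_add, map_smul, smul_eq_mul]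
  simp only [hfun]
  have hT := SymBalanced.hasDerivAt_opT_perturbation (SymBalanced.frameAt n x) hd.ne'
    (H := fun t => SymBalanced.perturbMetric h φ t x)
    (SymBalanced.eventually_isHermInner_comp (hh.inner x) (SymBalanced.frameAt n x) (hφh x))
    (SymBalanced.continuousAt_comp_one_add_smul (h x) (φ x)) (Φ x) l
  have h0 : SymBalanced.perturbMetric h φ 0 x = h x := LinearMap.ext fun u => by
    simp [SymBalanced.perturbMetric]
  rw [h0] at hT
  have hΦ : HasDerivAt (fun t : ℝ => l 1 + (t : ℂ) * l (Φ x)) (l (Φ x)) 0 := by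
    simpa using ((Complex.ofRealCLM.hasDerivAt (x := (0 : ℝ))).mul_const (l (Φ x))).const_add (l 1)
  refine (((((SymBalanced.hasDerivAt_traceFree_Lam_curvSym hOm hh hHE hφ hφh
    (SymBalanced.iDbarD η) x l).const_mul (SymBalanced.coeffA n d)).add
      (((SymBalanced.hasDerivAt_scalarCurv hOm hcsc hη x).const_mul (1 / 2)).mul_const (l 1))).add
        hΦ).sub hT).congr_deriv ?_
  simp only [map_sub, map_add, map_smul, smul_eq_mul]
  ring
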